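/- Let $n\ge 3$ and let $(M,g)$ be a smooth Riemannian manifold of dimension $n$ (Hausdorff, second countable, without boundary), with $g=(g_{ij})$, inverse metric $g^{-1}=(g^{ij})$, Ricci tensor $R_{ij}$, scalar curvature $R^g=g^{ij}R_{ij}$ and Riemannian volume measure $d\mu_g=\sqrt{\det(g_{ij})}\,dx^1\cdots dx^n$. For a relatively compact open set $\Omega\subseteq M$ consider the total scalar curvature $I_\Omega(g^{-1})=\int_\Omega R^g\,d\mu_g$ as a functional of the inverse metric. An admissible variation on $\Omega$ is a smooth symmetric contravariant $2$-tensor field $k=(k^{ij})$ on $M$ whose support is contained in $\Omega$. Then: 1. There is a unique smooth symmetric covariant $2$-tensor field $E=(E_{ij})$ on $M$ (the Euler–Lagrange expression of the functional at $g$, with respect to $g^{-1}$) such that, for all $\Omega$ and all admissible $k$, the function $t\mapsto I_\Omega(g^{-1}+t\,k)$ is differentiable at $t=0$ and $$\frac{d}{dt}\Big|_{t=0} I_\Omega(g^{-1}+t\,k)=\int_\Omega E_{ij}k^{ij}\,d\mu_g .$$ 2. The Euler–Lagrange equations $E_{ij}=0$ are the vacuum equations: at each point $p\in M$, $E_{ij}(p)=0$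 for all $i,j$ if and only if $R_{ij}(p)=0$ for all $i,j$. 3. Consequently $g$ is an extremal of the functional, that is, $\frac{d}{dt}\big|_{t=0} I_\Omega(g^{-1}+t\,k)=0$ for all $\Omega$ and all admissible $k$, if and only if $R_{ij}=0$ on $M$. -/

import Mathlib

open scoped Manifold ContDiff Topology
open MeasureTheory

noncomputable section

namespace EinsteinHilbert

/-! ### Local formulas on open subsets of `ℝⁿ` -/

section Local

variable {n : ℕ}

/-- The partial derivative `∂f/∂xⁱ` at `y`. -/
def pderiv (i : Fin n) (f : EuclideanSpace ℝ (Fin n) → ℝ) (y : EuclideanSpace ℝ (Fin n)) : ℝ :=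
  fderiv ℝ f y (EuclideanSpace.single i 1)

/-- The Christoffel symbols of the second kind of the matrix field `G = (g_ij)`:
`Γⁱ_jk = ½ ∑ₗ gⁱˡ (∂ₖ g_lj + ∂ⱼ g_lk - ∂ₗ g_jk)`. -/
def christoffel (G : EuclideanSpace ℝ (Fin n) → Matrix (Fin n) (Fin n) ℝ) (i j k : Fin n)
    (y : EuclideanSpace ℝ (Fin n)) : ℝ :=
  (1 / 2 : ℝ) * ∑ l, (G y)⁻¹ i l *
    (pderiv k (fun z => G z l j) y + pderiv j (fun z => G z l k) y
      - pderiv l (fun z => G z j k) y)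

/-- The components of the Ricci tensor of the matrix field `G = (g_ij)`:
`R_ik = ∂ₗ Γˡ_ik - ∂ₖ Γˡ_il + Γˡ_ls Γˢ_ik - Γˡ_ks Γˢ_il` (summed over `l`, `s`). -/
def ricci (G : EuclideanSpace ℝ (Fin n) → Matrix (Fin n) (Fin n) ℝ)
    (y : EuclideanSpace ℝ (Fin n)) (i k : Fin n) : ℝ :=
  (∑ l, pderiv l (christoffel G l i k) y) - (∑ l, pderiv k (christoffel G l i l) y)
    + (∑ l, ∑ s, christoffel G l l s y * christoffel G s i k y)
    - (∑ l, ∑ s, christoffel G l k s y * christoffel G s i l y)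

end Local

/-! ### Symmetric 2-tensors on a manifold and their components in a chart -/

section Manifold

variable {n : ℕ} {M : Type*} [TopologicalSpace M] [ChartedSpace (EuclideanSpace ℝ (Fin n)) M]

/-- The coordinate vector `∂/∂xⁱ` of the chart `e`, at the point of coordinates `y`. -/
def coordVector (e : OpenPartialHomeomorph M (EuclideanSpace ℝ (Fin n)))
    (y : EuclideanSpace ℝ (Fin n)) (i : Fin n) : TangentSpace (𝓡 n) (e.symm y) :=
  mfderiv (𝓡 n) (𝓡 n) e.symm y (EuclideanSpace.single i (1 : ℝ) : EuclideanSpace ℝ (Fin n))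

/-- The coordinate covector `dxⁱ` of the chart `e`, at the point of coordinates `y`. -/
def coordCovector (e : OpenPartialHomeomorph M (EuclideanSpace ℝ (Fin n)))
    (y : EuclideanSpace ℝ (Fin n)) (i : Fin n) :
    Module.Dual ℝ (TangentSpace (𝓡 n) (e.symm y)) :=
  ((EuclideanSpace.proj i : EuclideanSpace ℝ (Fin n) →L[ℝ] ℝ).comp
    (mfderiv (𝓡 n) (𝓡 n) e (e.symm y) :
      TangentSpace (𝓡 n) (e.symm y) →L[ℝ] EuclideanSpace ℝ (Fin n))).toLinearMap

/-- The components `b_ij = b(∂ᵢ, ∂ⱼ)`, in the chart `e`, of a field of bilinear forms on the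
tangent spaces. -/
def lowerComponents (b : ∀ p : M, LinearMap.BilinForm ℝ (TangentSpace (𝓡 n) p))
    (e : OpenPartialHomeomorph M (EuclideanSpace ℝ (Fin n))) (y : EuclideanSpace ℝ (Fin n)) :
    Matrix (Fin n) (Fin n) ℝ :=
  Matrix.of fun i j => b (e.symm y) (coordVector e y i) (coordVector e y j)

/-- The components `γⁱʲ = γ(dxⁱ, dxʲ)`, in the chart `e`, of a field of bilinear forms on the
cotangent spaces. -/
def upperComponents
    (γ : ∀ p : M, LinearMap.BilinForm ℝ (Module.Dual ℝ (TangentSpace (𝓡 n) p)))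
    (e : OpenPartialHomeomorph M (EuclideanSpace ℝ (Fin n))) (y : EuclideanSpace ℝ (Fin n)) :
    Matrix (Fin n) (Fin n) ℝ :=
  Matrix.of fun i j => γ (e.symm y) (coordCovector e y i) (coordCovector e y j)

variable (n M) in
/-- A smooth symmetric covariant 2-tensor field `E = (E_ij)` on `M`. -/
structure SymTensorLower where
  toFun : ∀ p : M, LinearMap.BilinForm ℝ (TangentSpace (𝓡 n) p)
  symm : ∀ p v w, toFun p v w = toFun p w v
  smooth : ∀ e ∈ atlas (EuclideanSpace ℝ (Fin n)) M, ∀ i j,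
    ContDiffOn ℝ ∞ (fun y => lowerComponents toFun e y i j) e.target

variable (n M) in
/-- A smooth symmetric contravariant 2-tensor field `k = (kⁱʲ)` on `M`. -/
structure SymTensorUpper where
  toFun : ∀ p : M, LinearMap.BilinForm ℝ (Module.Dual ℝ (TangentSpace (𝓡 n) p))
  symm : ∀ p α β, toFun p α β = toFun p β α
  smooth : ∀ e ∈ atlas (EuclideanSpace ℝ (Fin n)) M, ∀ i j,
    ContDiffOn ℝ ∞ (fun y => upperComponents toFun e y i j) e.target

/-- The full contraction `E_ij kⁱʲ` as a function on `M`. -/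
def contraction (E : SymTensorLower n M) (k : SymTensorUpper n M) (p : M) : ℝ :=
  ∑ i, ∑ j, lowerComponents E.toFun (chartAt (EuclideanSpace ℝ (Fin n)) p)
      (chartAt (EuclideanSpace ℝ (Fin n)) p p) i j *
    upperComponents k.toFun (chartAt (EuclideanSpace ℝ (Fin n)) p)
      (chartAt (EuclideanSpace ℝ (Fin n)) p p) i j

/-! ### The total scalar curvature as a functional of the inverse metric

In this part `γ` stands for the inverse `g⁻¹ = (gⁱʲ)` of a metric `g`. It is allowed to be an
arbitrary field of bilinear forms on the cotangent spaces, so that the functional can be evaluated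
along `g⁻¹ + t k` without a proof that this is positive definite (it is, for small `t`). -/

/-- The components `g_ij`, in the chart `e`, of the metric whose inverse is `γ`. -/
def metricOfInverse
    (γ : ∀ p : M, LinearMap.BilinForm ℝ (Module.Dual ℝ (TangentSpace (𝓡 n) p)))
    (e : OpenPartialHomeomorph M (EuclideanSpace ℝ (Fin n))) (y : EuclideanSpace ℝ (Fin n)) :
    Matrix (Fin n) (Fin n) ℝ :=
  (upperComponents γ e y)⁻¹

/-- The scalar curvature `R = gⁱʲ R_ij` of the metric whose inverse is `γ`. -/
def scalarCurvature
    (γ : ∀ p : M, LinearMap.BilinForm ℝ (Module.Dual ℝ (TangentSpace (𝓡 n) p))) (p : M) : ℝ :=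
  ∑ i, ∑ j, upperComponents γ (chartAt (EuclideanSpace ℝ (Fin n)) p)
      (chartAt (EuclideanSpace ℝ (Fin n)) p p) i j *
    ricci (metricOfInverse γ (chartAt (EuclideanSpace ℝ (Fin n)) p))
      (chartAt (EuclideanSpace ℝ (Fin n)) p p) i j

variable [MeasurableSpace M]

/-- The measure `√det(g_ij) dx¹ ⋯ dxⁿ` on the domain of the chart `e`, for the metric whose inverse
is `γ`, as a measure on `M` that vanishes outside the domain of `e`. -/
def chartVolume
    (γ : ∀ p : M, LinearMap.BilinForm ℝ (Module.Dual ℝ (TangentSpace (𝓡 n) p)))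
    (e : OpenPartialHomeomorph M (EuclideanSpace ℝ (Fin n))) : Measure M :=
  Measure.map e.symm
    (((volume : Measure (EuclideanSpace ℝ (Fin n))).restrict e.target).withDensity
      fun y => ENNReal.ofReal (Real.sqrt (metricOfInverse γ e y).det))

/-- The Riemannian volume measure `μ` of the metric whose inverse is `γ`: the least measure on `M`
that dominates `√det(g_ij) dx¹ ⋯ dxⁿ` on each chart domain. The chart measures of a metric agree on
the overlaps of chart domains, so on each chart domain `μ` is equal to `√det(g_ij) dx¹ ⋯ dxⁿ`. -/
def riemannianVolume
    (γ : ∀ p : M, LinearMap.BilinForm ℝ (Module.Dual ℝ (TangentSpace (𝓡 n) p))) : Measure M :=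
  ⨆ e ∈ atlas (EuclideanSpace ℝ (Fin n)) M, chartVolume γ e

/-- The total scalar curvature `∫_Ω R dμ` over the domain `Ω` of the metric whose inverse is `γ`. -/
def totalScalarCurvature (Ω : Set M)
    (γ : ∀ p : M, LinearMap.BilinForm ℝ (Module.Dual ℝ (TangentSpace (𝓡 n) p))) : ℝ :=
  ∫ p in Ω, scalarCurvature γ p ∂(riemannianVolume γ)

end Manifold

/-! ### Riemannian metrics, Ricci curvature and the Euler-Lagrange equations -/

section Metric

variable {n : ℕ} {M : Type*} [TopologicalSpace M] [ChartedSpace (EuclideanSpace ℝ (Fin n)) M]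
  [IsManifold (𝓡 n) ∞ M]

variable (n M) in
/-- Smooth Riemannian metrics on `M`. -/
abbrev Metric : Type _ :=
  Bundle.ContMDiffRiemannianMetric (𝓡 n) ∞ (EuclideanSpace ℝ (Fin n))
    (fun p : M => TangentSpace (𝓡 n) p)

/-- The metric at `p` as a bilinear form on the tangent space, without its continuity. -/
def Metric.bilin (g : Metric n M) (p : M) : LinearMap.BilinForm ℝ (TangentSpace (𝓡 n) p) :=
  LinearMap.mk₂ ℝ (fun v w => g.inner p v w) (by simp) (by simp) (by simp) (by simp)

theorem Metric.bilin_injective (g : Metric n M) (p : M) : Function.Injective (g.bilin p) := by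
  rw [injective_iff_map_eq_zero]
  intro v hv
  by_contra h
  exact (g.pos p v h).ne' (LinearMap.congr_fun hv v)

/-- The musical isomorphism `v ↦ g(v, ·)` from the tangent to the cotangent space at `p`. -/
def Metric.flat (g : Metric n M) (p : M) :
    TangentSpace (𝓡 n) p ≃ₗ[ℝ] Module.Dual ℝ (TangentSpace (𝓡 n) p) :=
  haveI : FiniteDimensional ℝ (TangentSpace (𝓡 n) p) :=
    inferInstanceAs (FiniteDimensional ℝ (EuclideanSpace ℝ (Fin n)))
  LinearMap.linearEquivOfInjective (g.bilin p) (g.bilin_injective p)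
    Subspace.dual_finrank_eq.symm

/-- The inverse metric `g⁻¹`: the inner product on cotangent spaces carried over from `g` by the
musical isomorphism. Its components `gⁱʲ` form the inverse of the matrix `(g_ij)`. -/
def Metric.inverse (g : Metric n M) (p : M) :
    LinearMap.BilinForm ℝ (Module.Dual ℝ (TangentSpace (𝓡 n) p)) :=
  (g.bilin p).compl₁₂ (g.flat p).symm.toLinearMap (g.flat p).symm.toLinearMap

/-- `R_ij = 0` at the point `p`, in each chart around `p`. -/
def Metric.RicciVanishesAt (g : Metric n M) (p : M) : Prop :=
  ∀ e ∈ atlas (EuclideanSpace ℝ (Fin n)) M, p ∈ e.source →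
    ∀ i j, ricci (lowerComponents g.bilin e) (e p) i j = 0

variable [MeasurableSpace M]

/-- `g` is an extremal of the total scalar curvature with respect to variations of the inverse
metric: over each relatively compact domain `Ω`, and for each smooth symmetric `k = (kⁱʲ)` that
vanishes near the boundary of `Ω`, the derivative of `∫_Ω R dμ` along `g⁻¹ + t k` at `t = 0` is
zero. -/
def Metric.IsExtremal (g : Metric n M) : Prop :=
  ∀ Ω : Set M, IsOpen Ω → IsCompact (closure Ω) →
    ∀ k : SymTensorUpper n M, closure {p | k.toFun p ≠ 0} ⊆ Ω →
      HasDerivAt (fun t : ℝ => totalScalarCurvature Ω (fun p => g.inverse p + t • k.toFun p)) 0 0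

/-- `E = (E_ij)` is the Euler-Lagrange expression at `g` of the total scalar curvature with respect
to the inverse metric: over each relatively compact domain `Ω`, and for each smooth symmetric
`k = (kⁱʲ)` that vanishes near the boundary of `Ω`, the derivative of `∫_Ω R dμ` along `g⁻¹ + t k`
at `t = 0` exists and equals `∫_Ω E_ij kⁱʲ dμ`. The Euler-Lagrange equations are `E_ij = 0`. -/
def Metric.IsEulerLagrangeExpression (g : Metric n M) (E : SymTensorLower n M) : Prop :=
  ∀ Ω : Set M, IsOpen Ω → IsCompact (closure Ω) →
    ∀ k : SymTensorUpper n M, closure {p | k.toFun p ≠ 0} ⊆ Ω →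
      HasDerivAt (fun t : ℝ => totalScalarCurvature Ω (fun p => g.inverse p + t • k.toFun p))
        (∫ p in Ω, contraction E k p ∂(riemannianVolume g.inverse)) 0

end Metric

end EinsteinHilbert

end

noncomputable section

namespace EinsteinHilbert

/-! In a chart the functional has density `R √det g`, a smooth function of the components `γⁱʲ` of
the inverse metric and their first two derivatives. Along `γ + t k` the Leibniz rule gives three
terms: `kⁱʲ R_ij √g`, then `γⁱʲ δR_ij √g`, then `R δ√g`. Jacobi's formula turns the last into `-½ R
g_ij kⁱʲ √g`. Since Ricci is polynomial in the Christoffel symbols and their first derivatives,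
`δR_ij` is linear in `C = δΓ`, and the Palatini identity `sum_mul_linearRicci` with metric
compatibility shows that the middle term is `∂ₗ(√g Wˡ)`. Hence `hasDerivAt_curvatureDensity`: the
derivative is `(R_ij - ½ R g_ij) kⁱʲ √g` plus a divergence, and the Euler–Lagrange expression is the
Einstein tensor.

Two invariance facts make this global. Ricci is a tensor (`SmoothSymm.ricci_comp`): the Koszul
formula yields the transformation law of `Γ`, differentiating that law yields the law of the
curvature, and Ricci is a trace of it. The coordinate volumes agree on overlaps
(`chartVolume_inter`), by the change of variables formula.

The volume of `g⁻¹ + t k` is then a density against the fixed volume of `g`, so that `t` occurs only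
in the integrand. Compactness of the support of `k` keeps `g⁻¹ + t k` nondegenerate for small `t`
and bounds the integrand's derivative, which allows differentiation under the integral
(`Metric.hasDerivAt_totalScalarCurvature`). That derivative is linear in `k`, so a partition of
unity reduces to `k` supported in one chart, where the divergence integrates to zero
(`Metric.integral_relativeDensityDeriv_of_subset_source`).

Uniqueness is the fundamental lemma `Metric.toFun_eq_zero_of_integral_contraction_eq_zero`, tested
with a bump function times the tensor with both indices raised, whose contraction with the original
is a squared norm. Tracing `E_ij = 0` gives `(1 - n/2) R = 0`; as `n ≥ 3` this forces `R = 0` and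
then `R_ij = 0` (`SmoothSymm.einstein_eq_zero_iff`). -/

/-- The model space `ℝⁿ`. -/
abbrev Coord (n : ℕ) : Type := EuclideanSpace ℝ (Fin n)

/-! ### Smoothness of matrix operations -/

section Smooth

variable {n : ℕ} {P : Type*} [NormedAddCommGroup P] [NormedSpace ℝ P]

theorem contDiffOn_det {s : Set P} {A : P → Matrix (Fin n) (Fin n) ℝ}
    (hA : ∀ i j, ContDiffOn ℝ ∞ (fun q => A q i j) s) : ContDiffOn ℝ ∞ (fun q => (A q).det) s := by
  simp only [Matrix.det_apply, Units.smul_def, zsmul_eq_mul]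
  exact ContDiffOn.sum fun σ _ => contDiffOn_const.mul (contDiffOn_prod fun i _ => hA _ _)

/-- Cramer's rule: an adjugate entry is again a determinant, of a matrix whose entries are constants
or entries of `A`. -/
theorem contDiffOn_inv_entry {s : Set P} {A : P → Matrix (Fin n) (Fin n) ℝ}
    (hA : ∀ i j, ContDiffOn ℝ ∞ (fun q => A q i j) s) (hd : ∀ q ∈ s, (A q).det ≠ 0) (i j : Fin n) :
    ContDiffOn ℝ ∞ (fun q => (A q)⁻¹ i j) s := by
  have h : (fun q => (A q)⁻¹ i j) = fun q => (A q).det⁻¹ * (A q).adjugate i j := by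
    funext q
    simp [Matrix.inv_def]
  rw [h]
  refine ((contDiffOn_det hA).inv hd).mul ?_
  simp only [Matrix.adjugate_apply]
  refine contDiffOn_det fun a b => ?_
  by_cases hj : a = j
  · subst hj
    simpa using contDiffOn_const
  · simpa [Matrix.updateRow_ne hj] using hA a b

/-- `P` is the space of variation parameters: `ℝ` for the line `γ + t k`, and `ι → ℝ` for several
directions at once. Reading slice derivatives as directional derivatives on the product preserves
joint smoothness. -/
theorem pderiv_eq_fderiv_prod {U : Set (P × Coord n)} {f : P → Coord n → ℝ}
    (hf : ContDiffOn ℝ ∞ (fun q : P × Coord n => f q.1 q.2) U) (hU : IsOpen U) {q : P × Coord n}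
    (hq : q ∈ U) (l : Fin n) :
    pderiv l (f q.1) q.2
      = fderiv ℝ (fun q : P × Coord n => f q.1 q.2) q (0, EuclideanSpace.single l 1) := by
  have h1 : HasFDerivAt (fun q : P × Coord n => f q.1 q.2)
      (fderiv ℝ (fun q : P × Coord n => f q.1 q.2) q) (q.1, q.2) :=
    ((hf.contDiffAt (hU.mem_nhds hq)).differentiableAt (by simp)).hasFDerivAt
  have h2 := h1.comp q.2 (hasFDerivAt_prodMk_right (𝕜 := ℝ) q.1 q.2)
  have h3 : HasFDerivAt (f q.1) _ q.2 := h2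
  rw [pderiv, h3.fderiv]
  simp

theorem contDiffOn_pderiv {U : Set (P × Coord n)} {f : P → Coord n → ℝ}
    (hf : ContDiffOn ℝ ∞ (fun q : P × Coord n => f q.1 q.2) U) (hU : IsOpen U) (l : Fin n) :
    ContDiffOn ℝ ∞ (fun q : P × Coord n => pderiv l (f q.1) q.2) U := by
  refine ContDiffOn.congr ?_ fun q hq => pderiv_eq_fderiv_prod hf hU hq l
  exact (hf.fderiv_of_isOpen hU (m := ∞) (by simp)).clm_apply contDiffOn_const

theorem pderiv_congr {f g : Coord n → ℝ} {y : Coord n} (h : f =ᶠ[𝓝 y] g) (l : Fin n) :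
    pderiv l f y = pderiv l g y := by
  rw [pderiv, pderiv, h.fderiv_eq]

theorem contDiffOn_christoffel {U : Set (P × Coord n)} {G : P → Coord n → Matrix (Fin n) (Fin n) ℝ}
    (hG : ∀ i j, ContDiffOn ℝ ∞ (fun q : P × Coord n => G q.1 q.2 i j) U) (hU : IsOpen U)
    (hd : ∀ q ∈ U, (G q.1 q.2).det ≠ 0) (i j k : Fin n) :
    ContDiffOn ℝ ∞ (fun q : P × Coord n => christoffel (G q.1) i j k q.2) U := by
  have hp : ∀ a b c, ContDiffOn ℝ ∞
      (fun q : P × Coord n => pderiv c (fun z => G q.1 z a b) q.2) U := fun a b c =>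
    contDiffOn_pderiv (f := fun t z => G t z a b) (hG a b) hU c
  exact contDiffOn_const.mul (ContDiffOn.sum fun l _ => (contDiffOn_inv_entry hG hd i l).mul
    (((hp _ _ _).add (hp _ _ _)).sub (hp _ _ _)))

theorem contDiffOn_ricci {U : Set (P × Coord n)} {G : P → Coord n → Matrix (Fin n) (Fin n) ℝ}
    (hG : ∀ i j, ContDiffOn ℝ ∞ (fun q : P × Coord n => G q.1 q.2 i j) U) (hU : IsOpen U)
    (hd : ∀ q ∈ U, (G q.1 q.2).det ≠ 0) (i k : Fin n) :
    ContDiffOn ℝ ∞ (fun q : P × Coord n => ricci (G q.1) q.2 i k) U := by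
  have hc := contDiffOn_christoffel hG hU hd
  have hp : ∀ a b c d, ContDiffOn ℝ ∞
      (fun q : P × Coord n => pderiv d (christoffel (G q.1) a b c) q.2) U := fun a b c d =>
    contDiffOn_pderiv (f := fun t => christoffel (G t) a b c) (hc a b c) hU d
  refine ((ContDiffOn.sub ?_ ?_).add ?_).sub ?_
  · exact ContDiffOn.sum fun l _ => hp _ _ _ _
  · exact ContDiffOn.sum fun l _ => hp _ _ _ _
  · exact ContDiffOn.sum fun l _ => ContDiffOn.sum fun s _ => (hc _ _ _).mul (hc _ _ _)
  · exact ContDiffOn.sum fun l _ => ContDiffOn.sum fun s _ => (hc _ _ _).mul (hc _ _ _)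

/-- The density `R √det(g_ij)` of the total scalar curvature, as a function of the components `γⁱʲ`
of the inverse metric. -/
def curvatureDensity (γ : Coord n → Matrix (Fin n) (Fin n) ℝ) (y : Coord n) : ℝ :=
  (∑ i, ∑ j, γ y i j * ricci (fun z => (γ z)⁻¹) y i j) * Real.sqrt ((γ y)⁻¹).det

theorem contDiffOn_curvatureDensity {U : Set (P × Coord n)}
    {γ : P → Coord n → Matrix (Fin n) (Fin n) ℝ}
    (hγ : ∀ i j, ContDiffOn ℝ ∞ (fun q : P × Coord n => γ q.1 q.2 i j) U) (hU : IsOpen U)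
    (hd : ∀ q ∈ U, 0 < (γ q.1 q.2).det) :
    ContDiffOn ℝ ∞ (fun q : P × Coord n => curvatureDensity (γ q.1) q.2) U := by
  have hi : ∀ i j, ContDiffOn ℝ ∞ (fun q : P × Coord n => (γ q.1 q.2)⁻¹ i j) U :=
    contDiffOn_inv_entry (A := fun q : P × Coord n => γ q.1 q.2) hγ fun q hq => (hd q hq).ne'
  have hdi : ∀ q ∈ U, 0 < ((γ q.1 q.2)⁻¹).det := fun q hq => by
    rw [Matrix.det_nonsing_inv, Ring.inverse_eq_inv']
    exact inv_pos.mpr (hd q hq)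
  refine ContDiffOn.mul ?_ ((contDiffOn_det hi).sqrt fun q hq => (hdi q hq).ne')
  exact ContDiffOn.sum fun i _ => ContDiffOn.sum fun j _ => (hγ i j).mul
    (contDiffOn_ricci (G := fun t z => (γ t z)⁻¹) hi hU (fun q hq => (hdi q hq).ne') i j)

end Smooth

/-! ### Mixed partial derivatives -/

section Mixed

variable {n : ℕ}

theorem deriv_eq_fderiv_prod {U : Set (ℝ × Coord n)} {f : ℝ → Coord n → ℝ}
    (hf : ContDiffOn ℝ ∞ (fun q : ℝ × Coord n => f q.1 q.2) U) (hU : IsOpen U) {q : ℝ × Coord n}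
    (hq : q ∈ U) :
    HasDerivAt (fun t => f t q.2) (fderiv ℝ (fun q : ℝ × Coord n => f q.1 q.2) q (1, 0)) q.1 := by
  have h1 : HasFDerivAt (fun q : ℝ × Coord n => f q.1 q.2)
      (fderiv ℝ (fun q : ℝ × Coord n => f q.1 q.2) q) (q.1, q.2) :=
    ((hf.contDiffAt (hU.mem_nhds hq)).differentiableAt (by simp)).hasFDerivAt
  have h2 := h1.comp q.1 (hasFDerivAt_prodMk_left (𝕜 := ℝ) q.1 q.2)
  have h3 : HasDerivAt (fun t => f t q.2) _ q.1 := h2.hasDerivAt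
  simpa using h3

theorem differentiableAt_slice {U : Set (ℝ × Coord n)} {f : ℝ → Coord n → ℝ}
    (hf : ContDiffOn ℝ ∞ (fun q : ℝ × Coord n => f q.1 q.2) U) (hU : IsOpen U) {q : ℝ × Coord n}
    (hq : q ∈ U) : HasDerivAt (fun t => f t q.2) (deriv (fun t => f t q.2) q.1) q.1 :=
  (deriv_eq_fderiv_prod hf hU hq).differentiableAt.hasDerivAt

theorem contDiffOn_deriv {U : Set (ℝ × Coord n)} {f : ℝ → Coord n → ℝ}
    (hf : ContDiffOn ℝ ∞ (fun q : ℝ × Coord n => f q.1 q.2) U) (hU : IsOpen U) :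
    ContDiffOn ℝ ∞ (fun q : ℝ × Coord n => deriv (fun t => f t q.2) q.1) U := by
  refine ContDiffOn.congr ?_ fun q hq => (deriv_eq_fderiv_prod hf hU hq).deriv
  exact (hf.fderiv_of_isOpen hU (m := ∞) (by simp)).clm_apply contDiffOn_const

theorem fderiv_fderiv_apply {F : Type*} [NormedAddCommGroup F] [NormedSpace ℝ F] {f : F → ℝ} {x : F}
    (hf : ContDiffAt ℝ ∞ f x) (u v : F) :
    fderiv ℝ (fun z => fderiv ℝ f z v) x u = fderiv ℝ (fun z => fderiv ℝ f z u) x v := by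
  have hd : DifferentiableAt ℝ (fderiv ℝ f) x :=
    (hf.fderiv_right (m := ∞) (by simp)).differentiableAt (by simp)
  have h : ∀ w, fderiv ℝ (fun z => fderiv ℝ f z w) x = (fderiv ℝ (fderiv ℝ f) x).flip w := fun w => by
    rw [fderiv_clm_apply hd (differentiableAt_const w)]
    simp
  rw [h, h]
  exact (hf.isSymmSndFDerivAt (by simpa using ENat.LEInfty.out)).eq u v

theorem pderiv_comm {f : Coord n → ℝ} {x : Coord n} (hf : ContDiffAt ℝ ∞ f x) (i j : Fin n) :
    pderiv i (pderiv j f) x = pderiv j (pderiv i f) x :=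
  fderiv_fderiv_apply hf _ _

/-- Symmetry of the second derivative on `ℝ × ℝⁿ`, in the directions `(1, 0)` and `(0, eₗ)`. It lets
the variation pass through coordinate derivatives. -/
theorem deriv_pderiv {U : Set (ℝ × Coord n)} {f : ℝ → Coord n → ℝ}
    (hf : ContDiffOn ℝ ∞ (fun q : ℝ × Coord n => f q.1 q.2) U) (hU : IsOpen U) {q : ℝ × Coord n}
    (hq : q ∈ U) (l : Fin n) :
    HasDerivAt (fun t => pderiv l (f t) q.2)
      (pderiv l (fun z => deriv (fun t => f t z) q.1) q.2) q.1 := by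
  have h1 := deriv_eq_fderiv_prod (f := fun t y => pderiv l (f t) y) (contDiffOn_pderiv hf hU l) hU hq
  have h2 := pderiv_eq_fderiv_prod (f := fun s z => deriv (fun t => f t z) s)
    (contDiffOn_deriv hf hU) hU hq l
  have e1 : (fun q : ℝ × Coord n => pderiv l (f q.1) q.2) =ᶠ[𝓝 q]
      fun q => fderiv ℝ (fun q : ℝ × Coord n => f q.1 q.2) q (0, EuclideanSpace.single l 1) := by
    filter_upwards [hU.mem_nhds hq] with z hz using pderiv_eq_fderiv_prod hf hU hz l
  have e2 : (fun q : ℝ × Coord n => deriv (fun t => f t q.2) q.1) =ᶠ[𝓝 q]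
      fun q => fderiv ℝ (fun q : ℝ × Coord n => f q.1 q.2) q (1, 0) := by
    filter_upwards [hU.mem_nhds hq] with z hz using (deriv_eq_fderiv_prod hf hU hz).deriv
  rw [e1.fderiv_eq] at h1
  rw [e2.fderiv_eq] at h2
  rw [h2, ← fderiv_fderiv_apply (hf.contDiffAt (hU.mem_nhds hq))]
  exact h1

end Mixed

/-! ### Jacobi's formula -/

section Jacobi

variable {n : ℕ}

/-- Factor out `A`: `det (1 + t A⁻¹B)` is a polynomial in `t` with constant term `1`, linear
coefficient the trace, and the rest divisible by `t²`. -/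
theorem hasDerivAt_det_add_smul (A B : Matrix (Fin n) (Fin n) ℝ) (hA : A.det ≠ 0) :
    HasDerivAt (fun t : ℝ => (A + t • B).det) (A.det * (A⁻¹ * B).trace) 0 := by
  have hu : IsUnit A.det := isUnit_iff_ne_zero.mpr hA
  have h : ∀ t : ℝ, (A + t • B).det = A.det * (1 + (A⁻¹ * B).trace * t
      + (Polynomial.eval t ((1 + (Polynomial.X : Polynomial ℝ) •
        (A⁻¹ * B).map Polynomial.C).det.divX.divX)) * t ^ 2) := fun t => by
    rw [← Matrix.det_one_add_smul, ← Matrix.det_mul, mul_add, mul_one, mul_smul_comm,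
      Matrix.mul_nonsing_inv_cancel_left _ _ hu]
  simp only [h]
  refine HasDerivAt.const_mul _ ?_
  set p := (1 + (Polynomial.X : Polynomial ℝ) • (A⁻¹ * B).map Polynomial.C).det.divX.divX
  have := (((hasDerivAt_id (0 : ℝ)).const_mul (A⁻¹ * B).trace).const_add 1).add
    ((p.hasDerivAt 0).mul ((hasDerivAt_id (0 : ℝ)).pow 2))
  exact this.congr_deriv (by simp)

/-- The derivative of the determinant at an invertible matrix, along a differentiable family. -/
theorem fderiv_det {F : Type*} [NormedAddCommGroup F] [NormedSpace ℝ F]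
    {A : F → Matrix (Fin n) (Fin n) ℝ} {x : F}
    (hA : ∀ i j, DifferentiableAt ℝ (fun z => A z i j) x) (hx : (A x).det ≠ 0) (v : F) :
    fderiv ℝ (fun z => (A z).det) x v
      = (A x).det * ∑ i, ∑ j, (A x)⁻¹ i j * fderiv ℝ (fun z => A z j i) x v := by
  let D : (Fin n → Fin n → ℝ) → ℝ := fun a => (Matrix.of a).det
  have hD : ContDiffOn ℝ ∞ D Set.univ := contDiffOn_det (A := fun a => Matrix.of a) fun i j => by
    simp only [Matrix.of_apply]
    fun_prop
  have hD' : DifferentiableAt ℝ D (A x) := (hD.contDiffAt Filter.univ_mem).differentiableAt (by simp)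
  have hA' : HasFDerivAt (fun z i j => A z i j)
      (ContinuousLinearMap.pi fun i => ContinuousLinearMap.pi fun j => fderiv ℝ (fun z => A z i j) x)
      x := hasFDerivAt_pi.mpr fun i => hasFDerivAt_pi.mpr fun j => (hA i j).hasFDerivAt
  have h1 := (hD'.hasFDerivAt.comp x hA').fderiv
  have h1' : fderiv ℝ (fun z => (A z).det) x = _ := h1
  rw [h1']
  let a : Fin n → Fin n → ℝ := A x
  let B : Fin n → Fin n → ℝ := fun i j => fderiv ℝ (fun z => A z i j) x v
  -- The total derivative in the direction `B` is the derivative along the line `a + t B`, which the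
  -- previous lemma has computed.
  have h2 : HasDerivAt (fun t : ℝ => D (a + t • B)) (fderiv ℝ D a B) 0 := by
    have hl : HasDerivAt (fun t : ℝ => a + t • B) B 0 := by
      simpa using ((hasDerivAt_id (0 : ℝ)).smul_const B).const_add a
    have h0 : HasFDerivAt D (fderiv ℝ D a) (a + (0 : ℝ) • B) := by
      simpa using hD'.hasFDerivAt
    exact h0.comp_hasDerivAt 0 hl
  have h3 := h2.unique (hasDerivAt_det_add_smul (A x) (Matrix.of B) hx)
  refine h3.trans ?_
  simp [Matrix.trace, Matrix.mul_apply, B]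

end Jacobi

/-! ### Metric compatibility of the Christoffel symbols -/

section Local

variable {n : ℕ}

theorem pderiv_sub {f g : Coord n → ℝ} {y : Coord n} (hf : DifferentiableAt ℝ f y)
    (hg : DifferentiableAt ℝ g y) (l : Fin n) :
    pderiv l (fun z => f z - g z) y = pderiv l f y - pderiv l g y := by
  simp only [pderiv]
  rw [fderiv_fun_sub hf hg]
  rfl

theorem pderiv_mul {f g : Coord n → ℝ} {y : Coord n} (hf : DifferentiableAt ℝ f y)
    (hg : DifferentiableAt ℝ g y) (l : Fin n) :
    pderiv l (fun z => f z * g z) y = pderiv l f y * g y + f y * pderiv l g y := by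
  simp only [pderiv]
  rw [fderiv_fun_mul hf hg]
  simp only [add_apply, smul_apply, smul_eq_mul]
  ring

theorem pderiv_sum {ι : Type*} {s : Finset ι} {f : ι → Coord n → ℝ} {y : Coord n}
    (hf : ∀ i ∈ s, DifferentiableAt ℝ (f i) y) (l : Fin n) :
    pderiv l (fun z => ∑ i ∈ s, f i z) y = ∑ i ∈ s, pderiv l (f i) y := by
  simp only [pderiv]
  rw [fderiv_fun_sum hf]
  simp

theorem contDiffOn_pderiv_of_isOpen {V : Set (Coord n)} {f : Coord n → ℝ} (hf : ContDiffOn ℝ ∞ f V)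
    (hV : IsOpen V) (l : Fin n) : ContDiffOn ℝ ∞ (pderiv l f) V :=
  (hf.fderiv_of_isOpen hV (m := ∞) (by simp)).clm_apply contDiffOn_const

/-- A field of symmetric matrices with positive determinant, smooth on the open set `V`. -/
structure SmoothSymm (V : Set (Coord n)) (G : Coord n → Matrix (Fin n) (Fin n) ℝ) : Prop where
  isOpen : IsOpen V
  smooth : ∀ i j, ContDiffOn ℝ ∞ (fun y => G y i j) V
  symm : ∀ y ∈ V, ∀ i j, G y i j = G y j i
  det_pos : ∀ y ∈ V, 0 < (G y).det

namespace SmoothSymm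

variable {V : Set (Coord n)} {G : Coord n → Matrix (Fin n) (Fin n) ℝ}

theorem isUnit_det (h : SmoothSymm V G) {y : Coord n} (hy : y ∈ V) : IsUnit (G y).det :=
  isUnit_iff_ne_zero.mpr (h.det_pos y hy).ne'

theorem differentiableAt (h : SmoothSymm V G) {y : Coord n} (hy : y ∈ V) (i j : Fin n) :
    DifferentiableAt ℝ (fun y => G y i j) y :=
  ((h.smooth i j).contDiffAt (h.isOpen.mem_nhds hy)).differentiableAt (by simp)

theorem transpose_eq (h : SmoothSymm V G) {y : Coord n} (hy : y ∈ V) : (G y).transpose = G y := by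
  ext i j
  exact h.symm y hy j i

theorem inv_symm (h : SmoothSymm V G) {y : Coord n} (hy : y ∈ V) (i j : Fin n) :
    (G y)⁻¹ i j = (G y)⁻¹ j i := by
  conv_rhs => rw [← h.transpose_eq hy, ← Matrix.transpose_nonsing_inv]
  rfl

theorem inv_det_pos (h : SmoothSymm V G) {y : Coord n} (hy : y ∈ V) : 0 < ((G y)⁻¹).det := by
  rw [Matrix.det_nonsing_inv, Ring.inverse_eq_inv']
  exact inv_pos.mpr (h.det_pos y hy)

/-- Metric and inverse metric play symmetric roles here, so statements about a metric `G` apply to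
`γ⁻¹` as soon as they are known for a field `γ` of this kind. -/
theorem inv (h : SmoothSymm V G) : SmoothSymm V fun y => (G y)⁻¹ where
  isOpen := h.isOpen
  smooth := contDiffOn_inv_entry h.smooth fun y hy => (h.det_pos y hy).ne'
  symm _ hy := h.inv_symm hy
  det_pos _ hy := h.inv_det_pos hy

theorem mono (h : SmoothSymm V G) {W : Set (Coord n)} (hW : IsOpen W) (hWV : W ⊆ V) :
    SmoothSymm W G where
  isOpen := hW
  smooth i j := (h.smooth i j).mono hWV
  symm y hy := h.symm y (hWV hy)
  det_pos y hy := h.det_pos y (hWV hy)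

theorem contDiffOn_christoffel (h : SmoothSymm V G) (i j k : Fin n) :
    ContDiffOn ℝ ∞ (christoffel G i j k) V := by
  have hp := fun a b c => contDiffOn_pderiv_of_isOpen (h.smooth a b) h.isOpen c
  exact contDiffOn_const.mul (ContDiffOn.sum fun l _ => (h.inv.smooth i l).mul
    (((hp _ _ _).add (hp _ _ _)).sub (hp _ _ _)))

theorem contDiffOn_ricci (h : SmoothSymm V G) (i k : Fin n) :
    ContDiffOn ℝ ∞ (fun y => ricci G y i k) V := by
  have hc := h.contDiffOn_christoffel
  have hp := fun a b c d => contDiffOn_pderiv_of_isOpen (hc a b c) h.isOpen d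
  refine ContDiffOn.sub (ContDiffOn.add (ContDiffOn.sub ?_ ?_) ?_) ?_
  · exact ContDiffOn.sum fun l _ => hp _ _ _ _
  · exact ContDiffOn.sum fun l _ => hp _ _ _ _
  · exact ContDiffOn.sum fun l _ => ContDiffOn.sum fun s _ => (hc _ _ _).mul (hc _ _ _)
  · exact ContDiffOn.sum fun l _ => ContDiffOn.sum fun s _ => (hc _ _ _).mul (hc _ _ _)

theorem pderiv_symm (h : SmoothSymm V G) {y : Coord n} (hy : y ∈ V) (l i j : Fin n) :
    pderiv l (fun z => G z i j) y = pderiv l (fun z => G z j i) y := by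
  refine pderiv_congr ?_ l
  filter_upwards [h.isOpen.mem_nhds hy] with z hz using h.symm z hz i j

theorem christoffel_symm (h : SmoothSymm V G) {y : Coord n} (hy : y ∈ V) (i j k : Fin n) :
    christoffel G i j k y = christoffel G i k j y := by
  simp only [christoffel]
  congr 1
  refine Finset.sum_congr rfl fun l _ => ?_
  rw [h.pderiv_symm hy l j k]
  ring

/-- Lowering the upper index cancels the inverse metric and leaves the Christoffel symbols of the
first kind. -/
theorem sum_mul_christoffel (h : SmoothSymm V G) {y : Coord n} (hy : y ∈ V) (a b c : Fin n) :
    ∑ m, G y c m * christoffel G m a b y = (1 / 2 : ℝ) *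
      (pderiv b (fun z => G z c a) y + pderiv a (fun z => G z c b) y
        - pderiv c (fun z => G z a b) y) := by
  have hinv : ∀ l, ∑ m, G y c m * (G y)⁻¹ m l = if c = l then 1 else 0 := fun l => by
    rw [← Matrix.mul_apply, Matrix.mul_nonsing_inv _ (h.isUnit_det hy), Matrix.one_apply]
  simp only [christoffel, Finset.mul_sum]
  rw [Finset.sum_comm]
  calc _ = ∑ l, (∑ m, G y c m * (G y)⁻¹ m l) * ((1 / 2 : ℝ) *
      (pderiv b (fun z => G z l a) y + pderiv a (fun z => G z l b) y
        - pderiv l (fun z => G z a b) y)) := by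
        refine Finset.sum_congr rfl fun l _ => ?_
        rw [Finset.sum_mul]
        exact Finset.sum_congr rfl fun m _ => by ring
    _ = _ := by simp [hinv]

/-- The covariant derivative of the metric vanishes. -/
theorem pderiv_metric (h : SmoothSymm V G) {y : Coord n} (hy : y ∈ V) (l a b : Fin n) :
    pderiv l (fun z => G z a b) y
      = ∑ m, (G y m b * christoffel G m l a y + G y a m * christoffel G m l b y) := by
  have h1 := h.sum_mul_christoffel hy l a b
  have h2 := h.sum_mul_christoffel hy l b a
  rw [Finset.sum_add_distrib, h2]
  simp only [h.symm y hy _ b]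
  rw [h1, h.pderiv_symm hy l b a, h.pderiv_symm hy b l a]
  rw [h.pderiv_symm hy a l b]
  ring

/-- The matrix `(Γⁱ_lj)` with fixed `l`. -/
def connectionMatrix (G : Coord n → Matrix (Fin n) (Fin n) ℝ) (l : Fin n) (y : Coord n) :
    Matrix (Fin n) (Fin n) ℝ := Matrix.of fun i j => christoffel G i l j y

/-- In matrix form `∇g = 0` hands its consequences for the inverse metric and the volume density
over to matrix algebra. -/
theorem pderiv_metric_matrix (h : SmoothSymm V G) {y : Coord n} (hy : y ∈ V) (l : Fin n) :
    (Matrix.of fun a b => pderiv l (fun z => G z a b) y)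
      = (connectionMatrix G l y).transpose * G y + G y * connectionMatrix G l y := by
  ext a b
  simp only [Matrix.of_apply, h.pderiv_metric hy, Matrix.add_apply, Matrix.mul_apply,
    Matrix.transpose_apply, connectionMatrix, Finset.sum_add_distrib]
  congr 1
  exact Finset.sum_congr rfl fun m _ => mul_comm _ _

/-- Differentiate `G⁻¹ G = 1`. -/
theorem pderiv_inv_matrix (h : SmoothSymm V G) {y : Coord n} (hy : y ∈ V) (l : Fin n) :
    (Matrix.of fun a b => pderiv l (fun z => (G z)⁻¹ a b) y)
      = - ((G y)⁻¹ * (Matrix.of fun a b => pderiv l (fun z => G z a b) y) * (G y)⁻¹) := by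
  set dA := (Matrix.of fun a b => pderiv l (fun z => (G z)⁻¹ a b) y)
  set dG := (Matrix.of fun a b => pderiv l (fun z => G z a b) y)
  have key : dA * G y + (G y)⁻¹ * dG = 0 := by
    ext a b
    have h1 : pderiv l (fun z => ∑ m, (G z)⁻¹ a m * G z m b) y = 0 := by
      have : (fun z => ∑ m, (G z)⁻¹ a m * G z m b) =ᶠ[𝓝 y]
          fun _ => (1 : Matrix (Fin n) (Fin n) ℝ) a b := by
        filter_upwards [h.isOpen.mem_nhds hy] with z hz
        rw [← Matrix.mul_apply, Matrix.nonsing_inv_mul _ (h.isUnit_det hz)]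
      rw [pderiv_congr this]
      simp [pderiv]
    rw [pderiv_sum (fun m _ => (h.inv.differentiableAt hy a m).fun_mul (h.differentiableAt hy m b))] at h1
    simp only [pderiv_mul (h.inv.differentiableAt hy a _) (h.differentiableAt hy _ b),
      Finset.sum_add_distrib] at h1
    simpa [Matrix.mul_apply, dA, dG] using h1
  have h2 : dA * G y = -((G y)⁻¹ * dG) := eq_neg_of_add_eq_zero_left key
  calc dA = dA * G y * (G y)⁻¹ := by
        rw [Matrix.mul_assoc, Matrix.mul_nonsing_inv _ (h.isUnit_det hy), Matrix.mul_one]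
    _ = _ := by rw [h2, Matrix.neg_mul]

/-- The covariant derivative of the inverse metric vanishes. -/
theorem pderiv_inv (h : SmoothSymm V G) {y : Coord n} (hy : y ∈ V) (l i j : Fin n) :
    pderiv l (fun z => (G z)⁻¹ i j) y
      = -∑ m, (christoffel G i l m y * (G y)⁻¹ m j + christoffel G j l m y * (G y)⁻¹ i m) := by
  have h1 := h.pderiv_inv_matrix hy l
  rw [h.pderiv_metric_matrix hy, Matrix.mul_add, Matrix.add_mul, ← Matrix.mul_assoc,
    Matrix.mul_assoc _ (G y), Matrix.mul_nonsing_inv _ (h.isUnit_det hy), Matrix.mul_one,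
    Matrix.nonsing_inv_mul_cancel_left _ _ (h.isUnit_det hy)] at h1
  have h2 := congrFun (congrFun h1 i) j
  simp only [Matrix.of_apply, Matrix.neg_apply, Matrix.add_apply, Matrix.mul_apply,
    Matrix.transpose_apply, connectionMatrix] at h2
  rw [h2, Finset.sum_add_distrib, add_comm]
  congr 2
  exact Finset.sum_congr rfl fun m _ => mul_comm _ _

/-- The trace of `G⁻¹ (ΓᵀG + GΓ)` is twice the trace of `Γ`, by cyclicity. -/
theorem sum_christoffel (h : SmoothSymm V G) {y : Coord n} (hy : y ∈ V) (l : Fin n) :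
    ∑ m, christoffel G m l m y
      = (1 / 2 : ℝ) * ∑ i, ∑ j, (G y)⁻¹ i j * pderiv l (fun z => G z j i) y := by
  have h1 : ∑ i, ∑ j, (G y)⁻¹ i j * pderiv l (fun z => G z j i) y
      = ((G y)⁻¹ * Matrix.of fun a b => pderiv l (fun z => G z a b) y).trace := by
    simp [Matrix.trace, Matrix.mul_apply]
  rw [h1, h.pderiv_metric_matrix hy, Matrix.mul_add, Matrix.trace_add,
    Matrix.nonsing_inv_mul_cancel_left _ _ (h.isUnit_det hy), Matrix.trace_mul_comm,
    Matrix.mul_nonsing_inv_cancel_right _ _ (h.isUnit_det hy), Matrix.trace_transpose]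
  simp only [Matrix.trace, connectionMatrix, Matrix.diag_apply, Matrix.of_apply]
  ring

/-- Jacobi's formula combined with `sum_christoffel`. It gives `∂ₗ(√g Wˡ) = √g (∂ₗWˡ + Γᵐₗₘ Wˡ)`,
the form in which divergences appear below. -/
theorem pderiv_sqrt_det (h : SmoothSymm V G) {y : Coord n} (hy : y ∈ V) (l : Fin n) :
    pderiv l (fun z => Real.sqrt (G z).det) y
      = Real.sqrt (G y).det * ∑ m, christoffel G m l m y := by
  have hd : DifferentiableAt ℝ (fun z => (G z).det) y :=
    ((contDiffOn_det h.smooth).contDiffAt (h.isOpen.mem_nhds hy)).differentiableAt (by simp)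
  have h1 := fderiv_det (h.differentiableAt hy) (h.det_pos y hy).ne' (EuclideanSpace.single l 1)
  have h2 := h.sum_christoffel hy l
  have hp := h.det_pos y hy
  have hs := Real.sq_sqrt hp.le
  have hs0 : Real.sqrt (G y).det ≠ 0 := (Real.sqrt_pos.mpr hp).ne'
  simp only [pderiv] at h1 h2 ⊢
  rw [fderiv_sqrt hd hp.ne', smul_apply, h1, h2]
  generalize ∑ i, ∑ j, (G y)⁻¹ i j * (fderiv ℝ (fun z => G z j i) y) (EuclideanSpace.single l 1) = T
  simp only [smul_eq_mul]
  field_simp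
  rw [hs]

theorem contDiffOn_log_sqrt_det (h : SmoothSymm V G) :
    ContDiffOn ℝ ∞ (fun z => Real.log (Real.sqrt (G z).det)) V :=
  ((contDiffOn_det h.smooth).sqrt fun z hz => (h.det_pos z hz).ne').log
    fun z hz => (Real.sqrt_pos.mpr (h.det_pos z hz)).ne'

/-- The contracted Christoffel symbols form a gradient; this is what makes Ricci symmetric. -/
theorem pderiv_log_sqrt_det (h : SmoothSymm V G) {y : Coord n} (hy : y ∈ V) (l : Fin n) :
    pderiv l (fun z => Real.log (Real.sqrt (G z).det)) y = ∑ m, christoffel G m l m y := by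
  have hd : DifferentiableAt ℝ (fun z => Real.sqrt (G z).det) y :=
    (((contDiffOn_det h.smooth).sqrt fun z hz => (h.det_pos z hz).ne').contDiffAt
      (h.isOpen.mem_nhds hy)).differentiableAt (by simp)
  have hs0 : Real.sqrt (G y).det ≠ 0 := (Real.sqrt_pos.mpr (h.det_pos y hy)).ne'
  have h1 := h.pderiv_sqrt_det hy l
  simp only [pderiv] at h1 ⊢
  rw [fderiv.log hd hs0, smul_apply, h1, smul_eq_mul,
    inv_mul_cancel_left₀ hs0]

/-- The Ricci tensor is symmetric. -/
theorem ricci_symm (h : SmoothSymm V G) {y : Coord n} (hy : y ∈ V) (i k : Fin n) :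
    ricci G y i k = ricci G y k i := by
  have hV := h.isOpen.mem_nhds hy
  -- The one term whose symmetry is not algebraic: it is the Hessian of `log √det g`.
  have h1 : ∀ i k, ∑ l, pderiv k (christoffel G l i l) y
      = pderiv k (pderiv i (fun z => Real.log (Real.sqrt (G z).det))) y := fun i k => by
    rw [← pderiv_sum (fun l _ => ((h.contDiffOn_christoffel l i l).contDiffAt hV).differentiableAt
      (by simp))]
    refine pderiv_congr ?_ k
    filter_upwards [hV] with z hz using (h.pderiv_log_sqrt_det hz i).symm
  have h2 : ∀ l, pderiv l (christoffel G l i k) y = pderiv l (christoffel G l k i) y := fun l => by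
    refine pderiv_congr ?_ l
    filter_upwards [hV] with z hz using h.christoffel_symm hz l i k
  have h3 : ∑ l, ∑ s, christoffel G l k s y * christoffel G s i l y
      = ∑ l, ∑ s, christoffel G l i s y * christoffel G s k l y := by
    rw [Finset.sum_comm]
    exact Finset.sum_congr rfl fun l _ => Finset.sum_congr rfl fun s _ => mul_comm _ _
  simp only [ricci]
  rw [h1, h1, pderiv_comm (h.contDiffOn_log_sqrt_det.contDiffAt hV), h3]
  simp only [h2, h.christoffel_symm hy _ i k]

end SmoothSymm

end Local

/-! ### The first variation of the curvature density in coordinates -/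

section FirstVariation

variable {n : ℕ}

/-- The linearized Ricci tensor: the derivative of the Ricci tensor as a function of the Christoffel
symbols `Γ`, in the direction `C`, where `D l i j k` stands for `∂ₗ Cⁱ_jk`. -/
def linearRicci (Γ C : Fin n → Fin n → Fin n → ℝ) (D : Fin n → Fin n → Fin n → Fin n → ℝ)
    (i k : Fin n) : ℝ :=
  (∑ l, D l l i k) - (∑ l, D k l i l)
    + (∑ l, ∑ s, (C l l s * Γ s i k + Γ l l s * C s i k))
    - (∑ l, ∑ s, (C l k s * Γ s i l + Γ l k s * C s i l))

theorem sum_four_comm {ι : Type*} [Fintype ι] (f : ι → ι → ι → ι → ℝ) :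
    ∑ a, ∑ b, ∑ c, ∑ d, f a b c d = ∑ c, ∑ d, ∑ a, ∑ b, f a b c d := by
  calc _ = ∑ a, ∑ c, ∑ b, ∑ d, f a b c d :=
        Finset.sum_congr rfl fun _ _ => Finset.sum_comm
    _ = ∑ c, ∑ a, ∑ b, ∑ d, f a b c d := Finset.sum_comm
    _ = ∑ c, ∑ a, ∑ d, ∑ b, f a b c d :=
        Finset.sum_congr rfl fun _ _ => Finset.sum_congr rfl fun _ _ => Finset.sum_comm
    _ = _ := Finset.sum_congr rfl fun _ _ => Finset.sum_comm

/-- The contracted Palatini identity: the trace of the linearized Ricci tensor is the divergence of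
the vector field `Wˡ = aⁱʲ Cˡ_ij - aⁱˡ Cᵐ_im`. -/
theorem sum_mul_linearRicci (a : Fin n → Fin n → ℝ) (Γ C : Fin n → Fin n → Fin n → ℝ)
    (D : Fin n → Fin n → Fin n → Fin n → ℝ)
    (hΓ : ∀ i j k, Γ i j k = Γ i k j) (hC : ∀ i j k, C i j k = C i k j) :
    ∑ i, ∑ j, a i j * linearRicci Γ C D i j
      = ∑ l, ((∑ m, Γ m l m) * (∑ i, ∑ j, a i j * C l i j - ∑ i, a i l * ∑ m, C m i m)
        + (∑ i, ∑ j, ((-∑ m, (Γ i l m * a m j + Γ j l m * a i m)) * C l i j + a i j * D l l i j)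
          - ∑ i, ((-∑ m, (Γ i l m * a m l + Γ l l m * a i m)) * (∑ m, C m i m)
            + a i l * ∑ m, D l m i m))) := by
  set c : Fin n → ℝ := fun i => ∑ m, C m i m with hc
  -- The right side is `(1/√g) ∂ₗ(√g Wˡ)` expanded by the product rule, with `∂ₗaⁱʲ` already
  -- replaced through metric compatibility. `T1` to `T6` match its terms with the six kinds of term
  -- of the traced linearized Ricci tensor, by renaming indices and using the symmetry of `Γ` and
  -- `C`.
  have T1 : ∑ l, ∑ i, ∑ j, a i j * D l l i j = ∑ i, ∑ j, ∑ l, a i j * D l l i j := by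
    rw [Finset.sum_comm]
    exact Finset.sum_congr rfl fun _ _ => Finset.sum_comm
  have T2 : ∑ l, ∑ i, a i l * ∑ m, D l m i m = ∑ i, ∑ j, a i j * ∑ l, D j l i l := Finset.sum_comm
  have T3 : ∑ l, ∑ i, ∑ m, Γ i l m * a m l * c i
      = ∑ i, ∑ j, ∑ l, ∑ s, a i j * (C l l s * Γ s i j) := by
    calc _ = ∑ j, ∑ s, ∑ i, ∑ l, a i j * (C l l s * Γ s i j) := by
          refine Finset.sum_congr rfl fun j _ => Finset.sum_congr rfl fun s _ =>
            Finset.sum_congr rfl fun i _ => ?_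
          rw [hc, Finset.mul_sum]
          refine Finset.sum_congr rfl fun l _ => ?_
          rw [hΓ s j i, hC l s l]
          ring
      _ = ∑ i, ∑ l, ∑ j, ∑ s, a i j * (C l l s * Γ s i j) := sum_four_comm _
      _ = _ := Finset.sum_congr rfl fun _ _ => Finset.sum_comm
  have T4 : ∑ l, (∑ m, Γ m l m) * ∑ i, ∑ j, a i j * C l i j
      = ∑ i, ∑ j, ∑ l, ∑ s, a i j * (Γ l l s * C s i j) := by
    calc _ = ∑ s, ∑ l, ∑ i, ∑ j, a i j * (Γ l l s * C s i j) := by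
          refine Finset.sum_congr rfl fun s _ => ?_
          rw [Finset.sum_mul]
          refine Finset.sum_congr rfl fun l _ => ?_
          simp only [Finset.mul_sum]
          refine Finset.sum_congr rfl fun i _ => Finset.sum_congr rfl fun j _ => ?_
          rw [hΓ l s l]
          ring
      _ = ∑ i, ∑ j, ∑ s, ∑ l, a i j * (Γ l l s * C s i j) := sum_four_comm _
      _ = _ := Finset.sum_congr rfl fun _ _ => Finset.sum_congr rfl fun _ _ => Finset.sum_comm
  have T5 : ∑ l, ∑ i, ∑ j, ∑ m, Γ i l m * a m j * C l i j
      = ∑ i, ∑ j, ∑ l, ∑ s, a i j * (C l j s * Γ s i l) := by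
    calc _ = ∑ l, ∑ s, ∑ j, ∑ i, a i j * (C l j s * Γ s i l) := by
          refine Finset.sum_congr rfl fun l _ => Finset.sum_congr rfl fun s _ =>
            Finset.sum_congr rfl fun j _ => Finset.sum_congr rfl fun i _ => ?_
          rw [hΓ s l i, hC l s j]
          ring
      _ = ∑ j, ∑ i, ∑ l, ∑ s, a i j * (C l j s * Γ s i l) := sum_four_comm _
      _ = _ := Finset.sum_comm
  have T6 : ∑ l, ∑ i, ∑ j, ∑ m, Γ j l m * a i m * C l i j
      = ∑ i, ∑ j, ∑ l, ∑ s, a i j * (Γ l j s * C s i l) := by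
    calc _ = ∑ s, ∑ i, ∑ l, ∑ j, a i j * (Γ l j s * C s i l) := by
          refine Finset.sum_congr rfl fun s _ => Finset.sum_congr rfl fun i _ =>
            Finset.sum_congr rfl fun l _ => Finset.sum_congr rfl fun j _ => ?_
          rw [hΓ l s j]
          ring
      _ = ∑ i, ∑ s, ∑ l, ∑ j, a i j * (Γ l j s * C s i l) := Finset.sum_comm
      _ = ∑ i, ∑ j, ∑ s, ∑ l, a i j * (Γ l j s * C s i l) := by
          refine Finset.sum_congr rfl fun i _ => ?_
          rw [Finset.sum_congr rfl fun s _ => Finset.sum_comm]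
          exact Finset.sum_comm
      _ = _ := Finset.sum_congr rfl fun _ _ => Finset.sum_congr rfl fun _ _ => Finset.sum_comm
  -- These two terms of the divergence have no counterpart in the Ricci tensor; they cancel each
  -- other.
  have T7 : ∑ l, (∑ m, Γ m l m) * ∑ i, a i l * c i = ∑ l, ∑ i, ∑ m, Γ l l m * a i m * c i := by
    calc _ = ∑ m, ∑ l, ∑ i, Γ l l m * a i m * c i := by
          refine Finset.sum_congr rfl fun m _ => ?_
          rw [Finset.sum_mul]
          refine Finset.sum_congr rfl fun l _ => ?_
          rw [Finset.mul_sum]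
          refine Finset.sum_congr rfl fun i _ => ?_
          rw [hΓ l m l]
          ring
      _ = ∑ l, ∑ m, ∑ i, Γ l l m * a i m * c i := Finset.sum_comm
      _ = _ := Finset.sum_congr rfl fun _ _ => Finset.sum_comm
  have hL : ∑ i, ∑ j, a i j * linearRicci Γ C D i j
      = ∑ i, ∑ j, ∑ l, a i j * D l l i j - ∑ i, ∑ j, a i j * ∑ l, D j l i l
        + (∑ i, ∑ j, ∑ l, ∑ s, a i j * (C l l s * Γ s i j)
          + ∑ i, ∑ j, ∑ l, ∑ s, a i j * (Γ l l s * C s i j))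
        - (∑ i, ∑ j, ∑ l, ∑ s, a i j * (C l j s * Γ s i l)
          + ∑ i, ∑ j, ∑ l, ∑ s, a i j * (Γ l j s * C s i l)) := by
    simp only [linearRicci, mul_sub, mul_add, Finset.mul_sum, Finset.sum_add_distrib,
      Finset.sum_sub_distrib]
  rw [hL, ← T1, ← T2, ← T3, ← T4, ← T5, ← T6]
  simp only [mul_sub, add_mul, neg_mul, Finset.sum_mul, Finset.sum_add_distrib,
    Finset.sum_sub_distrib, Finset.sum_neg_distrib] at T7 ⊢
  simp only [← Finset.sum_mul] at T7 ⊢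
  rw [T7]
  ring

/-- The family `γ + t k` of inverse metrics. -/
def lineFamily (γ k : Coord n → Matrix (Fin n) (Fin n) ℝ) (t : ℝ) (y : Coord n) :
    Matrix (Fin n) (Fin n) ℝ := γ y + t • k y

/-- The derivative `Cⁱ_jk` of the Christoffel symbols along `γ + t k` at `t = 0`. -/
def christoffelVariation (γ k : Coord n → Matrix (Fin n) (Fin n) ℝ) (i j l : Fin n)
    (y : Coord n) : ℝ :=
  deriv (fun t => christoffel (fun z => (lineFamily γ k t z)⁻¹) i j l y) 0

/-- The vector field whose divergence is the trace of the variation of the Ricci tensor. -/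
def variationField (γ k : Coord n → Matrix (Fin n) (Fin n) ℝ) (l : Fin n) (y : Coord n) : ℝ :=
  ∑ i, ∑ j, γ y i j * christoffelVariation γ k l i j y
    - ∑ i, γ y i l * ∑ m, christoffelVariation γ k m i m y

/-- The components `R_ij - ½ R g_ij` of the Einstein tensor of the metric with inverse `γ`. -/
def einstein (γ : Coord n → Matrix (Fin n) (Fin n) ℝ) (y : Coord n) (i j : Fin n) : ℝ :=
  ricci (fun z => (γ z)⁻¹) y i j
    - 1 / 2 * (∑ a, ∑ b, γ y a b * ricci (fun z => (γ z)⁻¹) y a b) * (γ y)⁻¹ i j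

/-- The set of `(t, y)` where `γ + t k` has positive determinant. -/
def lineDomain (V : Set (Coord n)) (γ k : Coord n → Matrix (Fin n) (Fin n) ℝ) :
    Set (ℝ × Coord n) :=
  {q | q.2 ∈ V ∧ 0 < (lineFamily γ k q.1 q.2).det}

variable {V : Set (Coord n)} {γ k : Coord n → Matrix (Fin n) (Fin n) ℝ}

theorem contDiffOn_lineFamily (hγ : SmoothSymm V γ)
    (hk : ∀ i j, ContDiffOn ℝ ∞ (fun y => k y i j) V) (i j : Fin n) :
    ContDiffOn ℝ ∞ (fun q : ℝ × Coord n => lineFamily γ k q.1 q.2 i j) (Set.univ ×ˢ V) := by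
  have h1 : ContDiffOn ℝ ∞ (fun q : ℝ × Coord n => γ q.2 i j) (Set.univ ×ˢ V) :=
    (hγ.smooth i j).comp contDiffOn_snd fun q hq => hq.2
  have h2 : ContDiffOn ℝ ∞ (fun q : ℝ × Coord n => k q.2 i j) (Set.univ ×ˢ V) :=
    (hk i j).comp contDiffOn_snd fun q hq => hq.2
  simp only [lineFamily, Matrix.add_apply, Matrix.smul_apply, smul_eq_mul]
  exact h1.add (contDiffOn_fst.mul h2)

theorem isOpen_lineDomain (hγ : SmoothSymm V γ)
    (hk : ∀ i j, ContDiffOn ℝ ∞ (fun y => k y i j) V) : IsOpen (lineDomain V γ k) := by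
  have h := (contDiffOn_det (contDiffOn_lineFamily hγ hk)).continuousOn.isOpen_inter_preimage
    (isOpen_univ.prod hγ.isOpen) (isOpen_Ioi (a := (0 : ℝ)))
  have he : lineDomain V γ k = Set.univ ×ˢ V ∩
      (fun q : ℝ × Coord n => (lineFamily γ k q.1 q.2).det) ⁻¹' Set.Ioi 0 := by
    ext q
    simp [lineDomain]
  rwa [he]

theorem zero_mem_lineDomain (hγ : SmoothSymm V γ) {y : Coord n} (hy : y ∈ V) :
    ((0 : ℝ), y) ∈ lineDomain V γ k := ⟨hy, by simpa [lineFamily] using hγ.det_pos y hy⟩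

theorem contDiffOn_lineFamily_lineDomain (hγ : SmoothSymm V γ)
    (hk : ∀ i j, ContDiffOn ℝ ∞ (fun y => k y i j) V) (i j : Fin n) :
    ContDiffOn ℝ ∞ (fun q : ℝ × Coord n => lineFamily γ k q.1 q.2 i j) (lineDomain V γ k) :=
  (contDiffOn_lineFamily hγ hk i j).mono fun _ hq => ⟨Set.mem_univ _, hq.1⟩

theorem lineFamily_zero : lineFamily γ k 0 = γ := by
  funext y
  simp [lineFamily]

theorem contDiffOn_lineFamily_inv (hγ : SmoothSymm V γ)
    (hk : ∀ i j, ContDiffOn ℝ ∞ (fun y => k y i j) V) (i j : Fin n) :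
    ContDiffOn ℝ ∞ (fun q : ℝ × Coord n => (lineFamily γ k q.1 q.2)⁻¹ i j) (lineDomain V γ k) :=
  contDiffOn_inv_entry (A := fun q : ℝ × Coord n => lineFamily γ k q.1 q.2)
    (contDiffOn_lineFamily_lineDomain hγ hk) (fun _ hq => hq.2.ne') i j

theorem contDiffOn_lineFamily_christoffel (hγ : SmoothSymm V γ)
    (hk : ∀ i j, ContDiffOn ℝ ∞ (fun y => k y i j) V) (i j l : Fin n) :
    ContDiffOn ℝ ∞ (fun q : ℝ × Coord n =>
      christoffel (fun z => (lineFamily γ k q.1 z)⁻¹) i j l q.2) (lineDomain V γ k) :=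
  contDiffOn_christoffel (G := fun t z => (lineFamily γ k t z)⁻¹) (contDiffOn_lineFamily_inv hγ hk)
    (isOpen_lineDomain hγ hk) (fun q hq => by
      rw [Matrix.det_nonsing_inv, Ring.inverse_eq_inv']
      exact (inv_pos.mpr hq.2).ne') i j l

theorem contDiffOn_christoffelVariation (hγ : SmoothSymm V γ)
    (hk : ∀ i j, ContDiffOn ℝ ∞ (fun y => k y i j) V) (i j l : Fin n) :
    ContDiffOn ℝ ∞ (christoffelVariation γ k i j l) V := by
  have h := contDiffOn_deriv (f := fun t y => christoffel (fun z => (lineFamily γ k t z)⁻¹) i j l y)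
    (contDiffOn_lineFamily_christoffel hγ hk i j l) (isOpen_lineDomain hγ hk)
  exact h.comp (g := fun q : ℝ × Coord n => deriv (fun t => christoffel (fun z =>
    (lineFamily γ k t z)⁻¹) i j l q.2) q.1) (f := fun y => ((0 : ℝ), y))
    (contDiffOn_const.prodMk contDiffOn_id) fun y hy => zero_mem_lineDomain hγ hy

theorem contDiffOn_variationField (hγ : SmoothSymm V γ)
    (hk : ∀ i j, ContDiffOn ℝ ∞ (fun y => k y i j) V) (l : Fin n) :
    ContDiffOn ℝ ∞ (variationField γ k l) V := by
  have hC := contDiffOn_christoffelVariation hγ hk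
  refine ContDiffOn.sub ?_ ?_
  · exact ContDiffOn.sum fun i _ => ContDiffOn.sum fun j _ => (hγ.smooth i j).mul (hC l i j)
  · exact ContDiffOn.sum fun i _ => (hγ.smooth i l).mul (ContDiffOn.sum fun m _ => hC m i m)

/-- For each `t` near `0`, `γ + t k` is a smooth symmetric field of positive determinant near `y`,
so its Christoffel symbols are symmetric, and the symmetry passes to the `t`-derivative. -/
theorem christoffelVariation_symm (hγ : SmoothSymm V γ)
    (hk : ∀ i j, ContDiffOn ℝ ∞ (fun y => k y i j) V) (hks : ∀ y ∈ V, ∀ i j, k y i j = k y j i)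
    {y : Coord n} (hy : y ∈ V) (i j l : Fin n) :
    christoffelVariation γ k i j l y = christoffelVariation γ k i l j y := by
  have hU := (isOpen_lineDomain hγ hk).mem_nhds (zero_mem_lineDomain (k := k) hγ hy)
  refine Filter.EventuallyEq.deriv_eq ?_
  have hc : Continuous fun t : ℝ => (t, y) := by fun_prop
  filter_upwards [hc.continuousAt.preimage_mem_nhds hU] with t ht
  have hW : IsOpen {z | (t, z) ∈ lineDomain V γ k} :=
    (isOpen_lineDomain hγ hk).preimage (by fun_prop : Continuous fun z : Coord n => (t, z))
  have hs : SmoothSymm {z | (t, z) ∈ lineDomain V γ k} (lineFamily γ k t) :=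
    { isOpen := hW
      smooth := fun i j => (contDiffOn_lineFamily_lineDomain hγ hk i j).comp
        (f := fun z : Coord n => (t, z)) (contDiffOn_const.prodMk contDiffOn_id) fun z hz => hz
      symm := fun z hz i j => by
        simp [lineFamily, hγ.symm z hz.1 i j, hks z hz.1 i j]
      det_pos := fun z hz => hz.2 }
  exact hs.inv.christoffel_symm ht i j l

theorem hasDerivAt_christoffelVariation (hγ : SmoothSymm V γ)
    (hk : ∀ i j, ContDiffOn ℝ ∞ (fun y => k y i j) V) {y : Coord n} (hy : y ∈ V) (a b c : Fin n) :
    HasDerivAt (fun t => christoffel (fun z => (lineFamily γ k t z)⁻¹) a b c y)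
      (christoffelVariation γ k a b c y) 0 := by
  have h := contDiffOn_lineFamily_christoffel hγ hk a b c
  have hU := isOpen_lineDomain hγ hk
  have h0 := zero_mem_lineDomain (k := k) hγ hy
  unfold christoffelVariation
  generalize hf : (fun t y => christoffel (fun z => (lineFamily γ k t z)⁻¹) a b c y) = f at *
  have e : ∀ t y, christoffel (fun z => (lineFamily γ k t z)⁻¹) a b c y = f t y := fun t y => by
    rw [← hf]
  simp only [e] at h ⊢
  exact differentiableAt_slice h hU h0

/-- Interchange of `∂/∂t` with a coordinate derivative. -/
theorem hasDerivAt_pderiv_christoffel (hγ : SmoothSymm V γ)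
    (hk : ∀ i j, ContDiffOn ℝ ∞ (fun y => k y i j) V) {y : Coord n} (hy : y ∈ V) (d a b c : Fin n) :
    HasDerivAt (fun t => pderiv d (christoffel (fun z => (lineFamily γ k t z)⁻¹) a b c) y)
      (pderiv d (christoffelVariation γ k a b c) y) 0 := by
  have h := contDiffOn_lineFamily_christoffel hγ hk a b c
  have hU := isOpen_lineDomain hγ hk
  have h0 := zero_mem_lineDomain (k := k) hγ hy
  have hv : christoffelVariation γ k a b c = fun y =>
    deriv (fun t => christoffel (fun z => (lineFamily γ k t z)⁻¹) a b c y) 0 := rfl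
  rw [hv]
  generalize hf : (fun t y => christoffel (fun z => (lineFamily γ k t z)⁻¹) a b c y) = f at *
  have e : ∀ t y, christoffel (fun z => (lineFamily γ k t z)⁻¹) a b c y = f t y := fun t y => by
    rw [← hf]
  have e' : ∀ t, christoffel (fun z => (lineFamily γ k t z)⁻¹) a b c = f t := fun t => by
    rw [← hf]
  simp only [e, e'] at h ⊢
  exact deriv_pderiv h hU h0 d

theorem hasDerivAt_ricci (hγ : SmoothSymm V γ)
    (hk : ∀ i j, ContDiffOn ℝ ∞ (fun y => k y i j) V) {y : Coord n} (hy : y ∈ V) (i j : Fin n) :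
    HasDerivAt (fun t => ricci (fun z => (lineFamily γ k t z)⁻¹) y i j)
      (linearRicci (fun a b c => christoffel (fun z => (γ z)⁻¹) a b c y)
        (fun a b c => christoffelVariation γ k a b c y)
        (fun d a b c => pderiv d (christoffelVariation γ k a b c) y) i j) 0 := by
  have hC := hasDerivAt_christoffelVariation hγ hk hy
  have hD := hasDerivAt_pderiv_christoffel hγ hk hy
  have e : ∀ a b c, christoffel (fun z => (γ z)⁻¹) a b c y
      = christoffel (fun z => (lineFamily γ k 0 z)⁻¹) a b c y := by
    simp [lineFamily_zero]
  unfold ricci linearRicci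
  simp only [e]
  have s1 := HasDerivAt.fun_sum (u := Finset.univ) fun l _ => hD l l i j
  have s2 := HasDerivAt.fun_sum (u := Finset.univ) fun l _ => hD j l i l
  have s3 := HasDerivAt.fun_sum (u := Finset.univ) fun l _ =>
    HasDerivAt.fun_sum (u := Finset.univ) fun s _ => (hC l l s).fun_mul (hC s i j)
  have s4 := HasDerivAt.fun_sum (u := Finset.univ) fun l _ =>
    HasDerivAt.fun_sum (u := Finset.univ) fun s _ => (hC l j s).fun_mul (hC s i l)
  exact ((s1.fun_sub s2).fun_add s3).fun_sub s4

/-- Jacobi's formula for `(det A)⁻¹`, then the square root. The sign is negative because the inverse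
metric is the one varied. -/
theorem hasDerivAt_sqrt_det_inv (A B : Matrix (Fin n) (Fin n) ℝ) (hA : 0 < A.det) :
    HasDerivAt (fun t : ℝ => Real.sqrt ((A + t • B)⁻¹).det)
      (-(1 / 2) * (∑ i, ∑ j, A⁻¹ i j * B j i) * Real.sqrt (A⁻¹).det) 0 := by
  have h1 := hasDerivAt_det_add_smul A B hA.ne'
  have h2 : HasDerivAt (fun t : ℝ => ((A + t • B).det)⁻¹) _ 0 := h1.fun_inv (by simpa using hA.ne')
  have h3 := h2.sqrt (by simpa using hA.ne')
  have he : ∀ A : Matrix (Fin n) (Fin n) ℝ, (A⁻¹).det = A.det⁻¹ := fun A => by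
    rw [Matrix.det_nonsing_inv, Ring.inverse_eq_inv']
  simp only [he]
  refine h3.congr_deriv ?_
  have hp : 0 < A.det⁻¹ := inv_pos.mpr hA
  have hs := Real.sq_sqrt hp.le
  have hs0 : Real.sqrt A.det⁻¹ ≠ 0 := (Real.sqrt_pos.mpr hp).ne'
  simp only [zero_smul, add_zero, Matrix.trace, Matrix.diag_apply, Matrix.mul_apply]
  generalize ∑ i, ∑ j, A⁻¹ i j * B j i = T
  have hd : A.det ≠ 0 := hA.ne'
  rw [div_eq_iff (by positivity)]
  have : -(1 / 2) * T * √A.det⁻¹ * (2 * √A.det⁻¹) = - T * √A.det⁻¹ ^ 2 := by ring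
  rw [this, hs]
  field_simp

/-- The first variation of the curvature density: the derivative along `γ + t k` is the contraction
of `k` with the Einstein tensor, up to a divergence. -/
theorem hasDerivAt_curvatureDensity (hγ : SmoothSymm V γ)
    (hk : ∀ i j, ContDiffOn ℝ ∞ (fun y => k y i j) V) (hks : ∀ y ∈ V, ∀ i j, k y i j = k y j i)
    {y : Coord n} (hy : y ∈ V) :
    HasDerivAt (fun t => curvatureDensity (lineFamily γ k t) y)
      ((∑ i, ∑ j, einstein γ y i j * k y i j) * Real.sqrt ((γ y)⁻¹).det
        + ∑ l, pderiv l (fun z => Real.sqrt ((γ z)⁻¹).det * variationField γ k l z) y) 0 := by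
  have hR := fun i j => hasDerivAt_ricci hγ hk hy i j
  have hS := hasDerivAt_sqrt_det_inv (γ y) (k y) (hγ.det_pos y hy)
  have hl : ∀ i j, HasDerivAt (fun t => lineFamily γ k t y i j) (k y i j) 0 := fun i j => by
    simpa [lineFamily] using ((hasDerivAt_id (0 : ℝ)).mul_const (k y i j)).const_add (γ y i j)
  have h1 := (HasDerivAt.fun_sum (u := Finset.univ) fun i _ =>
    HasDerivAt.fun_sum (u := Finset.univ) fun j _ => (hl i j).fun_mul (hR i j)).mul hS
  have h2 : HasDerivAt (fun t => curvatureDensity (lineFamily γ k t) y) _ 0 := h1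
  refine h2.congr_deriv ?_
  have hV := hγ.isOpen.mem_nhds hy
  have hg := hγ.inv
  set S := Real.sqrt ((γ y)⁻¹).det
  have hdS : DifferentiableAt ℝ (fun z => Real.sqrt ((γ z)⁻¹).det) y :=
    (((contDiffOn_det hg.smooth).sqrt fun z hz => (hg.det_pos z hz).ne').contDiffAt
      hV).differentiableAt (by simp)
  have hdW : ∀ l, DifferentiableAt ℝ (variationField γ k l) y := fun l =>
    ((contDiffOn_variationField hγ hk l).contDiffAt hV).differentiableAt (by simp)
  have hdC : ∀ a b c, DifferentiableAt ℝ (christoffelVariation γ k a b c) y := fun a b c =>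
    ((contDiffOn_christoffelVariation hγ hk a b c).contDiffAt hV).differentiableAt (by simp)
  have hdg : ∀ a b, DifferentiableAt ℝ (fun z => γ z a b) y := hγ.differentiableAt hy
  -- Metric compatibility for `γ`, regarded as the inverse of the metric `γ⁻¹`.
  have hcompat : ∀ l i j, pderiv l (fun z => γ z i j) y
      = -∑ m, (christoffel (fun z => (γ z)⁻¹) i l m y * γ y m j
        + christoffel (fun z => (γ z)⁻¹) j l m y * γ y i m) := fun l i j => by
    have h := hg.pderiv_inv hy l i j
    simp only [Matrix.nonsing_inv_nonsing_inv _ (hγ.isUnit_det hy)] at h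
    rw [← h]
    refine pderiv_congr ?_ l
    filter_upwards [hV] with z hz
    rw [Matrix.nonsing_inv_nonsing_inv _ (hγ.isUnit_det hz)]
  have hW : ∀ l, pderiv l (variationField γ k l) y
      = ∑ i, ∑ j, (pderiv l (fun z => γ z i j) y * christoffelVariation γ k l i j y
          + γ y i j * pderiv l (christoffelVariation γ k l i j) y)
        - ∑ i, (pderiv l (fun z => γ z i l) y * (∑ m, christoffelVariation γ k m i m y)
          + γ y i l * ∑ m, pderiv l (christoffelVariation γ k m i m) y) := fun l => by
    unfold variationField
    rw [pderiv_sub (DifferentiableAt.fun_sum fun i _ => DifferentiableAt.fun_sum fun j _ =>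
        (hdg i j).fun_mul (hdC l i j))
      (DifferentiableAt.fun_sum fun i _ => (hdg i l).fun_mul (DifferentiableAt.fun_sum fun m _ =>
        hdC m i m)),
      pderiv_sum (fun i _ => DifferentiableAt.fun_sum fun j _ => (hdg i j).fun_mul (hdC l i j)),
      pderiv_sum (fun i _ => (hdg i l).fun_mul (DifferentiableAt.fun_sum fun m _ => hdC m i m))]
    congr 1
    · refine Finset.sum_congr rfl fun i _ => ?_
      rw [pderiv_sum (fun j _ => (hdg i j).fun_mul (hdC l i j))]
      exact Finset.sum_congr rfl fun j _ => pderiv_mul (hdg i j) (hdC l i j) l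
    · refine Finset.sum_congr rfl fun i _ => ?_
      rw [pderiv_mul (hdg i l) (DifferentiableAt.fun_sum fun m _ => hdC m i m),
        pderiv_sum (fun m _ => hdC m i m)]
  -- The product rule, with `∂ₗ√g = √g Γᵐₗₘ` and `hcompat`, produces `√g` times the right side of
  -- the Palatini identity.
  have hdiv : ∑ l, pderiv l (fun z => Real.sqrt ((γ z)⁻¹).det * variationField γ k l z) y
      = S * ∑ i, ∑ j, γ y i j * linearRicci (fun a b c => christoffel (fun z => (γ z)⁻¹) a b c y)
        (fun a b c => christoffelVariation γ k a b c y)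
        (fun d a b c => pderiv d (christoffelVariation γ k a b c) y) i j := by
    refine Eq.trans ?_ (congrArg (S * ·) (sum_mul_linearRicci (γ y) _ _ _
      (fun a b c => hg.christoffel_symm hy a b c)
      (fun a b c => christoffelVariation_symm hγ hk hks hy a b c)).symm)
    rw [Finset.mul_sum]
    refine Finset.sum_congr rfl fun l _ => ?_
    rw [pderiv_mul hdS (hdW l), hg.pderiv_sqrt_det hy l, hW l]
    simp only [hcompat]
    rw [variationField]
    ring
  rw [hdiv]
  simp only [lineFamily_zero, zero_smul, add_zero]
  have hgk : ∑ i, ∑ j, (γ y)⁻¹ i j * k y j i = ∑ i, ∑ j, (γ y)⁻¹ i j * k y i j :=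
    Finset.sum_congr rfl fun i _ => Finset.sum_congr rfl fun j _ => by rw [hks y hy j i]
  have hE : ∑ i, ∑ j, einstein γ y i j * k y i j
      = ∑ i, ∑ j, k y i j * ricci (fun z => (γ z)⁻¹) y i j
        - 1 / 2 * (∑ a, ∑ b, γ y a b * ricci (fun z => (γ z)⁻¹) y a b)
          * ∑ i, ∑ j, (γ y)⁻¹ i j * k y i j := by
    simp only [einstein, sub_mul, Finset.sum_sub_distrib, Finset.mul_sum, mul_assoc]
    congr 1
    exact Finset.sum_congr rfl fun i _ => Finset.sum_congr rfl fun j _ => mul_comm _ _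
  rw [hgk, hE]
  simp only [Finset.sum_add_distrib]
  ring

end FirstVariation

/-! ### Curvature of a connection under a change of coordinates -/

section Curvature

variable {E : Type*} [NormedAddCommGroup E] [NormedSpace ℝ E]

/-- The curvature `R(w, u) v` of the connection with connection form `Γ`. -/
def curvatureOf (Γ : E → E →L[ℝ] E →L[ℝ] E) (y w u v : E) : E :=
  fderiv ℝ Γ y w u v - fderiv ℝ Γ y u w v + Γ y w (Γ y u v) - Γ y u (Γ y w v)

/-- `hT` is the inhomogeneous law of a connection form. Differentiating it and antisymmetrizing in
`w`, `u` removes the third derivative of `φ`; the second derivatives are absorbed by using `hT`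
again in the quadratic terms. -/
theorem fderiv_curvatureOf {Γ Γ' : E → E →L[ℝ] E →L[ℝ] E} {φ : E → E} {y : E}
    (hφ : ContDiffAt ℝ ∞ φ y) (hΓ : DifferentiableAt ℝ Γ y) (hΓ' : DifferentiableAt ℝ Γ' (φ y))
    (hT : ∀ᶠ z in 𝓝 y, ∀ u v, fderiv ℝ φ z (Γ z u v)
      = Γ' (φ z) (fderiv ℝ φ z u) (fderiv ℝ φ z v) + fderiv ℝ (fderiv ℝ φ) z u v) (w u v : E) :
    fderiv ℝ φ y (curvatureOf Γ y w u v)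
      = curvatureOf Γ' (φ y) (fderiv ℝ φ y w) (fderiv ℝ φ y u) (fderiv ℝ φ y v) := by
  have h1 : ContDiffAt ℝ ∞ (fderiv ℝ φ) y := hφ.fderiv_right (by simp)
  have h2 : ContDiffAt ℝ ∞ (fderiv ℝ (fderiv ℝ φ)) y := h1.fderiv_right (by simp)
  have d0 : HasFDerivAt φ (fderiv ℝ φ y) y := (hφ.differentiableAt (by simp)).hasFDerivAt
  have d1 := (h1.differentiableAt (by simp)).hasFDerivAt
  have d2 := (h2.differentiableAt (by simp)).hasFDerivAt
  have s1 : ∀ a b, fderiv ℝ (fderiv ℝ φ) y a b = fderiv ℝ (fderiv ℝ φ) y b a :=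
    (hφ.isSymmSndFDerivAt (by simpa using ENat.LEInfty.out)).eq
  have s2 : ∀ a b, fderiv ℝ (fderiv ℝ (fderiv ℝ φ)) y a b = fderiv ℝ (fderiv ℝ (fderiv ℝ φ)) y b a :=
    (h1.isSymmSndFDerivAt (by simpa using ENat.LEInfty.out)).eq
  have hG := hΓ.hasFDerivAt
  have hG' := HasFDerivAt.comp (g := Γ') (f := φ) y hΓ'.hasFDerivAt d0
  -- The derivative of `hT` at `y` in the direction `w`, with `u` and `v` held constant.
  have key : ∀ w u v, fderiv ℝ (fderiv ℝ φ) y w (Γ y u v) + fderiv ℝ φ y (fderiv ℝ Γ y w u v)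
      = fderiv ℝ Γ' (φ y) (fderiv ℝ φ y w) (fderiv ℝ φ y u) (fderiv ℝ φ y v)
        + Γ' (φ y) (fderiv ℝ (fderiv ℝ φ) y w u) (fderiv ℝ φ y v)
        + Γ' (φ y) (fderiv ℝ φ y u) (fderiv ℝ (fderiv ℝ φ) y w v)
        + fderiv ℝ (fderiv ℝ (fderiv ℝ φ)) y w u v := by
    intro w u v
    have hl := d1.clm_apply ((hG.clm_apply (hasFDerivAt_const u y)).clm_apply
      (hasFDerivAt_const v y))
    have hr := ((hG'.clm_apply (d1.clm_apply (hasFDerivAt_const u y))).clm_apply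
      (d1.clm_apply (hasFDerivAt_const v y))).add
      ((d2.clm_apply (hasFDerivAt_const u y)).clm_apply (hasFDerivAt_const v y))
    have hlr := hl.congr_of_eventuallyEq (f₁ := fun z => Γ' (φ z) (fderiv ℝ φ z u) (fderiv ℝ φ z v)
      + fderiv ℝ (fderiv ℝ φ) z u v) (by
        filter_upwards [hT] with z hz using (hz u v).symm)
    have h := congrArg (fun L : E →L[ℝ] E => L w) (hlr.unique hr)
    simp at h
    rw [add_comm, h]
    abel
  have hy := hT.self_of_nhds
  have k1 := key w u v
  have k2 := key u w v
  rw [s1 u w, s2 u w] at k2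
  simp only [curvatureOf, map_sub, map_add, hy] 
  rw [eq_sub_of_add_eq' k1, eq_sub_of_add_eq' k2]
  abel

end Curvature

/-! ### Tensoriality of the Ricci tensor -/

section Transformation

variable {n : ℕ}

theorem hasFDerivAt_sum_smul_const {E F ι : Type*} [NormedAddCommGroup E] [NormedSpace ℝ E]
    [NormedAddCommGroup F] [NormedSpace ℝ F] [Fintype ι] {f : ι → E → ℝ} {y : E}
    (hf : ∀ i, DifferentiableAt ℝ (f i) y) (c : ι → F) :
    HasFDerivAt (fun z => ∑ i, f i z • c i) (∑ i, (fderiv ℝ (f i) y).smulRight (c i)) y :=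
  HasFDerivAt.fun_sum fun i _ => (hf i).hasFDerivAt.smul_const (c i)

/-- The bilinear form with matrix `G y`. -/
def metricMap (G : Coord n → Matrix (Fin n) (Fin n) ℝ) (y : Coord n) :
    Coord n →L[ℝ] Coord n →L[ℝ] ℝ :=
  ∑ p : Fin n × Fin n, G y p.1 p.2 • (EuclideanSpace.proj p.1 : Coord n →L[ℝ] ℝ).smulRight
    (EuclideanSpace.proj p.2 : Coord n →L[ℝ] ℝ)

/-- The connection form with components `Γⁱ_jk`. -/
def christoffelMap (G : Coord n → Matrix (Fin n) (Fin n) ℝ) (y : Coord n) :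
    Coord n →L[ℝ] Coord n →L[ℝ] Coord n :=
  ∑ p : Fin n × Fin n × Fin n, christoffel G p.1 p.2.1 p.2.2 y •
    (EuclideanSpace.proj p.2.2 : Coord n →L[ℝ] ℝ).smulRight
      ((EuclideanSpace.proj p.2.1 : Coord n →L[ℝ] ℝ).smulRight (EuclideanSpace.single p.1 (1 : ℝ)))

theorem metricMap_apply (G : Coord n → Matrix (Fin n) (Fin n) ℝ) (y u v : Coord n) :
    metricMap G y u v = ∑ i, ∑ j, G y i j * u i * v j := by
  simp [metricMap, mul_assoc, Fintype.sum_prod_type]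

/-- The first argument pairs with the last index; where the symbols are symmetric the order does not
matter. -/
theorem christoffelMap_apply (G : Coord n → Matrix (Fin n) (Fin n) ℝ) (y u v : Coord n)
    (i : Fin n) : christoffelMap G y u v i = ∑ j, ∑ k, christoffel G i j k y * u k * v j := by
  simp [christoffelMap, mul_assoc, Pi.single_apply, Finset.sum_apply, Fintype.sum_prod_type]

theorem fderiv_eq_sum_pderiv (f : Coord n → ℝ) (y w : Coord n) :
    fderiv ℝ f y w = ∑ l, w l * pderiv l f y := by
  have h : w = ∑ l, w l • EuclideanSpace.single l (1 : ℝ) := by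
    ext i
    simp [Pi.single_apply]
  conv_lhs => rw [h]
  simp [pderiv]

variable {V : Set (Coord n)} {G : Coord n → Matrix (Fin n) (Fin n) ℝ}

theorem SmoothSymm.hasFDerivAt_metricMap (h : SmoothSymm V G) {y : Coord n} (hy : y ∈ V) :
    HasFDerivAt (metricMap G) (∑ p : Fin n × Fin n, (fderiv ℝ (fun z => G z p.1 p.2) y).smulRight
      ((EuclideanSpace.proj p.1 : Coord n →L[ℝ] ℝ).smulRight
        (EuclideanSpace.proj p.2 : Coord n →L[ℝ] ℝ))) y :=
  hasFDerivAt_sum_smul_const (fun p : Fin n × Fin n => h.differentiableAt hy p.1 p.2)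
    (fun p => (EuclideanSpace.proj p.1 : Coord n →L[ℝ] ℝ).smulRight
      (EuclideanSpace.proj p.2 : Coord n →L[ℝ] ℝ))

theorem SmoothSymm.fderiv_metricMap_apply (h : SmoothSymm V G) {y : Coord n} (hy : y ∈ V)
    (w u v : Coord n) : fderiv ℝ (metricMap G) y w u v
      = ∑ i, ∑ j, fderiv ℝ (fun z => G z i j) y w * u i * v j := by
  rw [(h.hasFDerivAt_metricMap hy).fderiv]
  simp [mul_assoc, Fintype.sum_prod_type]

theorem SmoothSymm.hasFDerivAt_christoffelMap (h : SmoothSymm V G) {y : Coord n} (hy : y ∈ V) :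
    HasFDerivAt (christoffelMap G) (∑ p : Fin n × Fin n × Fin n,
      (fderiv ℝ (christoffel G p.1 p.2.1 p.2.2) y).smulRight
        ((EuclideanSpace.proj p.2.2 : Coord n →L[ℝ] ℝ).smulRight
          ((EuclideanSpace.proj p.2.1 : Coord n →L[ℝ] ℝ).smulRight
            (EuclideanSpace.single p.1 (1 : ℝ))))) y := by
  have hd : ∀ p : Fin n × Fin n × Fin n, DifferentiableAt ℝ (christoffel G p.1 p.2.1 p.2.2) y :=
    fun p => ((h.contDiffOn_christoffel _ _ _).contDiffAt
      (h.isOpen.mem_nhds hy)).differentiableAt (by simp)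
  exact hasFDerivAt_sum_smul_const hd fun p => (EuclideanSpace.proj p.2.2 : Coord n →L[ℝ] ℝ).smulRight
    ((EuclideanSpace.proj p.2.1 : Coord n →L[ℝ] ℝ).smulRight (EuclideanSpace.single p.1 (1 : ℝ)))

theorem SmoothSymm.fderiv_christoffelMap_apply (h : SmoothSymm V G) {y : Coord n} (hy : y ∈ V)
    (w u v : Coord n) (i : Fin n) : fderiv ℝ (christoffelMap G) y w u v i
      = ∑ j, ∑ k, fderiv ℝ (christoffel G i j k) y w * u k * v j := by
  rw [(h.hasFDerivAt_christoffelMap hy).fderiv]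
  simp [mul_assoc, Pi.single_apply, Finset.sum_apply, Fintype.sum_prod_type]

/-- The Koszul formula. -/
theorem SmoothSymm.metricMap_christoffelMap (h : SmoothSymm V G) {y : Coord n} (hy : y ∈ V)
    (u v w : Coord n) : metricMap G y w (christoffelMap G y u v) = (1 / 2 : ℝ) *
      (fderiv ℝ (metricMap G) y u w v + fderiv ℝ (metricMap G) y v w u
        - fderiv ℝ (metricMap G) y w v u) := by
  have hL : metricMap G y w (christoffelMap G y u v)
      = ∑ c, ∑ a, ∑ b, (w c * v a * u b) * ∑ m, G y c m * christoffel G m a b y := by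
    rw [metricMap_apply]
    refine Finset.sum_congr rfl fun c _ => ?_
    simp only [christoffelMap_apply, Finset.mul_sum]
    rw [Finset.sum_comm]
    refine Finset.sum_congr rfl fun a _ => ?_
    rw [Finset.sum_comm]
    exact Finset.sum_congr rfl fun b _ => Finset.sum_congr rfl fun m _ => by ring
  have h1 : fderiv ℝ (metricMap G) y u w v
      = ∑ c, ∑ a, ∑ b, (w c * v a * u b) * pderiv b (fun z => G z c a) y := by
    rw [h.fderiv_metricMap_apply hy]
    refine Finset.sum_congr rfl fun c _ => Finset.sum_congr rfl fun a _ => ?_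
    rw [fderiv_eq_sum_pderiv, Finset.sum_mul, Finset.sum_mul]
    exact Finset.sum_congr rfl fun b _ => by ring
  have h2 : fderiv ℝ (metricMap G) y v w u
      = ∑ c, ∑ a, ∑ b, (w c * v a * u b) * pderiv a (fun z => G z c b) y := by
    rw [h.fderiv_metricMap_apply hy]
    refine Finset.sum_congr rfl fun c _ => ?_
    simp only [fderiv_eq_sum_pderiv, Finset.sum_mul]
    refine Eq.trans ?_ Finset.sum_comm
    exact Finset.sum_congr rfl fun b _ => Finset.sum_congr rfl fun a _ => by ring
  have h3 : fderiv ℝ (metricMap G) y w v u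
      = ∑ c, ∑ a, ∑ b, (w c * v a * u b) * pderiv c (fun z => G z a b) y := by
    rw [h.fderiv_metricMap_apply hy]
    simp only [fderiv_eq_sum_pderiv, Finset.sum_mul]
    rw [Finset.sum_congr rfl fun a _ => Finset.sum_comm, Finset.sum_comm]
    exact Finset.sum_congr rfl fun c _ => Finset.sum_congr rfl fun a _ =>
      Finset.sum_congr rfl fun b _ => by ring
  rw [hL, h1, h2, h3, ← Finset.sum_add_distrib, ← Finset.sum_sub_distrib, Finset.mul_sum]
  refine Finset.sum_congr rfl fun c _ => ?_
  rw [← Finset.sum_add_distrib, ← Finset.sum_sub_distrib, Finset.mul_sum]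
  refine Finset.sum_congr rfl fun a _ => ?_
  rw [← Finset.sum_add_distrib, ← Finset.sum_sub_distrib, Finset.mul_sum]
  refine Finset.sum_congr rfl fun b _ => ?_
  rw [h.sum_mul_christoffel hy]
  ring

theorem SmoothSymm.metricMap_symm (h : SmoothSymm V G) {y : Coord n} (hy : y ∈ V)
    (u v : Coord n) : metricMap G y u v = metricMap G y v u := by
  rw [metricMap_apply, metricMap_apply, Finset.sum_comm]
  refine Finset.sum_congr rfl fun i _ => Finset.sum_congr rfl fun j _ => ?_
  rw [h.symm y hy j i]
  ring

theorem SmoothSymm.eq_zero_of_metricMap (h : SmoothSymm V G) {y : Coord n} (hy : y ∈ V)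
    {x : Coord n} (hx : ∀ w, metricMap G y w x = 0) : x = 0 := by
  have h1 : (G y).mulVec x.ofLp = 0 := by
    funext i
    have := hx (EuclideanSpace.single i 1)
    rw [metricMap_apply] at this
    simpa [Pi.single_apply, Matrix.mulVec, dotProduct] using this
  have h2 := Matrix.eq_zero_of_mulVec_eq_zero (h.det_pos y hy).ne' h1
  ext i
  simp [h2]

variable {V' : Set (Coord n)} {G' : Coord n → Matrix (Fin n) (Fin n) ℝ} {φ : Coord n → Coord n}

/-- The transformation law of the Christoffel symbols. -/
theorem SmoothSymm.fderiv_christoffelMap (h : SmoothSymm V G) (h' : SmoothSymm V' G')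
    (hφ : ContDiffOn ℝ ∞ φ V) (hV : Set.MapsTo φ V V')
    (hG : ∀ z ∈ V, ∀ u v, metricMap G z u v
      = metricMap G' (φ z) (fderiv ℝ φ z u) (fderiv ℝ φ z v))
    (hs : ∀ z ∈ V, Function.Surjective (fderiv ℝ φ z)) {y : Coord n} (hy : y ∈ V)
    (u v : Coord n) : fderiv ℝ φ y (christoffelMap G y u v)
      = christoffelMap G' (φ y) (fderiv ℝ φ y u) (fderiv ℝ φ y v)
        + fderiv ℝ (fderiv ℝ φ) y u v := by
  have hφy := hφ.contDiffAt (h.isOpen.mem_nhds hy)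
  have h1 : ContDiffAt ℝ ∞ (fderiv ℝ φ) y := hφy.fderiv_right (by simp)
  have d0 : HasFDerivAt φ (fderiv ℝ φ y) y := (hφy.differentiableAt (by simp)).hasFDerivAt
  have d1 := (h1.differentiableAt (by simp)).hasFDerivAt
  have s1 : ∀ a b, fderiv ℝ (fderiv ℝ φ) y a b = fderiv ℝ (fderiv ℝ φ) y b a :=
    (hφy.isSymmSndFDerivAt (by simpa using ENat.LEInfty.out)).eq
  have hgy := (h.hasFDerivAt_metricMap hy).differentiableAt.hasFDerivAt
  have hgy' := HasFDerivAt.comp (g := metricMap G') (f := φ) y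
    (h'.hasFDerivAt_metricMap (hV hy)).differentiableAt.hasFDerivAt d0
  -- The derivative of the isometry identity `hG` in the direction `w`.
  have key : ∀ w u v, fderiv ℝ (metricMap G) y w u v
      = fderiv ℝ (metricMap G') (φ y) (fderiv ℝ φ y w) (fderiv ℝ φ y u) (fderiv ℝ φ y v)
        + metricMap G' (φ y) (fderiv ℝ (fderiv ℝ φ) y w u) (fderiv ℝ φ y v)
        + metricMap G' (φ y) (fderiv ℝ φ y u) (fderiv ℝ (fderiv ℝ φ) y w v) := by
    intro w u v
    have hl := (hgy.clm_apply (hasFDerivAt_const u y)).clm_apply (hasFDerivAt_const v y)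
    have hr := (hgy'.clm_apply (d1.clm_apply (hasFDerivAt_const u y))).clm_apply
      (d1.clm_apply (hasFDerivAt_const v y))
    have hlr := hl.congr_of_eventuallyEq
      (f₁ := fun z => metricMap G' (φ z) (fderiv ℝ φ z u) (fderiv ℝ φ z v)) (by
        filter_upwards [h.isOpen.mem_nhds hy] with z hz using (hG z hz u v).symm)
    have h := congrArg (fun L : Coord n →L[ℝ] ℝ => L w) (hlr.unique hr)
    simp at h
    rw [h]
    abel
  -- By nondegeneracy it suffices to pair with every `w'`, and each `w'` is some `Dφ w`. The Koszul
  -- formula on both sides then leaves only terms in `D²φ`, which combine by its symmetry.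
  refine sub_eq_zero.mp (h'.eq_zero_of_metricMap (hV hy) fun w' => ?_)
  obtain ⟨w, rfl⟩ := hs y hy w'
  have hK := h.metricMap_christoffelMap hy u v w
  have hK' := h'.metricMap_christoffelMap (hV hy) (fderiv ℝ φ y u) (fderiv ℝ φ y v) (fderiv ℝ φ y w)
  rw [hG y hy, key, key, key] at hK
  rw [map_sub, map_add, hK, hK', s1 v w, s1 w u, s1 v u,
    h'.metricMap_symm (hV hy) _ (fderiv ℝ φ y v), h'.metricMap_symm (hV hy) _ (fderiv ℝ φ y u)]
  ring

theorem trace_eq_sum_apply (L : Coord n →ₗ[ℝ] Coord n) :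
    LinearMap.trace ℝ _ L = ∑ l, L (EuclideanSpace.single l 1) l := by
  rw [LinearMap.trace_eq_matrix_trace ℝ (EuclideanSpace.basisFun (Fin n) ℝ).toBasis]
  simp [Matrix.trace, LinearMap.toMatrix_apply]

/-- The linear map `w ↦ R(w, u) v`. -/
def curvatureMap (Γ : Coord n → Coord n →L[ℝ] Coord n →L[ℝ] Coord n) (y u v : Coord n) :
    Coord n →ₗ[ℝ] Coord n where
  toFun w := curvatureOf Γ y w u v
  map_add' a b := by
    simp only [curvatureOf, map_add, add_apply]
    abel
  map_smul' c a := by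
    simp only [curvatureOf, map_smul, smul_apply, smul_sub, smul_add, RingHom.id_apply]

/-- The passage to an invariant description: a trace is unchanged by conjugation with `Dφ`. -/
theorem SmoothSymm.ricci_eq_trace (h : SmoothSymm V G) {y : Coord n} (hy : y ∈ V) (i k : Fin n) :
    ricci G y i k = LinearMap.trace ℝ _ (curvatureMap (christoffelMap G) y
      (EuclideanSpace.single k 1) (EuclideanSpace.single i 1)) := by
  rw [trace_eq_sum_apply]
  have e2 : ∀ a c (x : Coord n), christoffelMap G y (EuclideanSpace.single a 1) x c
      = ∑ s, christoffel G c a s y * x s := fun a c x => by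
    rw [christoffelMap_apply]
    simp only [h.christoffel_symm hy c a]
    simp
  have e3 : ∀ a b c d, fderiv ℝ (christoffelMap G) y (EuclideanSpace.single d 1)
      (EuclideanSpace.single a 1) (EuclideanSpace.single b 1) c = pderiv d (christoffel G c b a) y :=
    fun a b c d => by
      rw [h.fderiv_christoffelMap_apply hy]
      simp [pderiv]
  simp only [curvatureMap, LinearMap.coe_mk, AddHom.coe_mk, curvatureOf, PiLp.sub_apply,
    PiLp.add_apply, e3, e2, Finset.sum_add_distrib, Finset.sum_sub_distrib]
  simp [ricci, h.christoffel_symm hy _ k i, h.christoffel_symm hy _ _ i]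

/-- Bilinearity in `u` and `v`, needed to expand the images of the basis vectors under a change of
coordinates. -/
theorem curvatureMap_trace_bilin (Γ : Coord n → Coord n →L[ℝ] Coord n →L[ℝ] Coord n)
    (y u v : Coord n) : LinearMap.trace ℝ _ (curvatureMap Γ y u v)
      = ∑ a, ∑ b, v a * u b * LinearMap.trace ℝ _ (curvatureMap Γ y
        (EuclideanSpace.single b 1) (EuclideanSpace.single a 1)) := by
  have hadd : ∀ u u' v, curvatureMap Γ y (u + u') v = curvatureMap Γ y u v + curvatureMap Γ y u' v := by
    intro u u' v
    ext1 w
    simp only [curvatureMap, LinearMap.coe_mk, AddHom.coe_mk, curvatureOf, LinearMap.add_apply,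
      map_add, add_apply]
    abel
  have hsmul : ∀ (c : ℝ) u v, curvatureMap Γ y (c • u) v = c • curvatureMap Γ y u v := by
    intro c u v
    ext1 w
    simp only [curvatureMap, LinearMap.coe_mk, AddHom.coe_mk, curvatureOf, LinearMap.smul_apply,
      map_smul, smul_apply, smul_sub, smul_add]
  have hadd' : ∀ u v v', curvatureMap Γ y u (v + v') = curvatureMap Γ y u v + curvatureMap Γ y u v' := by
    intro u v v'
    ext1 w
    simp only [curvatureMap, LinearMap.coe_mk, AddHom.coe_mk, curvatureOf, LinearMap.add_apply,
      map_add]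
    abel
  have hsmul' : ∀ (c : ℝ) u v, curvatureMap Γ y u (c • v) = c • curvatureMap Γ y u v := by
    intro c u v
    ext1 w
    simp only [curvatureMap, LinearMap.coe_mk, AddHom.coe_mk, curvatureOf, LinearMap.smul_apply,
      map_smul, smul_sub, smul_add]
  let B : Coord n →ₗ[ℝ] Coord n →ₗ[ℝ] ℝ := LinearMap.mk₂ ℝ
    (fun v u => LinearMap.trace ℝ _ (curvatureMap Γ y u v))
    (fun v v' u => by rw [hadd', map_add]) (fun c v u => by rw [hsmul', map_smul])
    (fun v u u' => by rw [hadd, map_add]) (fun c v u => by rw [hsmul, map_smul])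
  have hx : ∀ w : Coord n, w = ∑ l, w l • EuclideanSpace.single l (1 : ℝ) := fun w => by
    ext i
    simp [Pi.single_apply]
  have hB : B v u = ∑ a, ∑ b, v a * u b * B (EuclideanSpace.single a 1) (EuclideanSpace.single b 1) := by
    conv_lhs => rw [hx v, hx u]
    simp only [map_sum, LinearMap.sum_apply, map_smul, LinearMap.smul_apply, smul_eq_mul,
      Finset.mul_sum]
    rw [Finset.sum_comm]
    exact Finset.sum_congr rfl fun a _ => Finset.sum_congr rfl fun b _ => by ring
  exact hB

/-- The Ricci tensor is a tensor: its transformation law under a change of coordinates. -/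
theorem SmoothSymm.ricci_comp (h : SmoothSymm V G) (h' : SmoothSymm V' G')
    (hφ : ContDiffOn ℝ ∞ φ V) (hV : Set.MapsTo φ V V')
    (hG : ∀ z ∈ V, ∀ u v, metricMap G z u v
      = metricMap G' (φ z) (fderiv ℝ φ z u) (fderiv ℝ φ z v))
    (hs : ∀ z ∈ V, Function.Bijective (fderiv ℝ φ z)) {y : Coord n} (hy : y ∈ V) (i k : Fin n) :
    ricci G y i k = ∑ a, ∑ b, fderiv ℝ φ y (EuclideanSpace.single i 1) a *
      fderiv ℝ φ y (EuclideanSpace.single k 1) b * ricci G' (φ y) a b := by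
  have hVy := h.isOpen.mem_nhds hy
  let e : Coord n ≃ₗ[ℝ] Coord n := LinearEquiv.ofBijective (fderiv ℝ φ y).toLinearMap (hs y hy)
  -- The two curvature endomorphisms are conjugate under `Dφ`, hence have the same trace.
  have hc : curvatureMap (christoffelMap G') (φ y) (fderiv ℝ φ y (EuclideanSpace.single k 1))
      (fderiv ℝ φ y (EuclideanSpace.single i 1))
      = e.conj (curvatureMap (christoffelMap G) y (EuclideanSpace.single k 1)
        (EuclideanSpace.single i 1)) := by
    ext1 w'
    obtain ⟨w, rfl⟩ := e.surjective w'
    rw [LinearEquiv.conj_apply_apply, e.symm_apply_apply]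
    refine (fderiv_curvatureOf (hφ.contDiffAt hVy) (h.hasFDerivAt_christoffelMap hy).differentiableAt
      (h'.hasFDerivAt_christoffelMap (hV hy)).differentiableAt ?_ w _ _).symm
    filter_upwards [hVy] with z hz u v using
      h.fderiv_christoffelMap h' hφ hV hG (fun z hz => (hs z hz).surjective) hz u v
  rw [h.ricci_eq_trace hy, ← LinearMap.trace_conj' _ e, ← hc, curvatureMap_trace_bilin]
  simp only [h'.ricci_eq_trace (hV hy)]

end Transformation

/-! ### Coordinate frames and their transformation -/

section Frames

variable {n : ℕ} {M : Type*} [TopologicalSpace M] [ChartedSpace (EuclideanSpace ℝ (Fin n)) M]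

/-- The coordinate frame of the chart `e` at the point `p`. -/
def frame (e : OpenPartialHomeomorph M (EuclideanSpace ℝ (Fin n))) (p : M) (i : Fin n) :
    TangentSpace (𝓡 n) p :=
  (mfderiv (𝓡 n) (𝓡 n) e.symm (e p) : Coord n →L[ℝ] Coord n)
    (EuclideanSpace.single i (1 : ℝ) : Coord n)

/-- The coordinate coframe of the chart `e` at the point `p`. -/
def coframe (e : OpenPartialHomeomorph M (EuclideanSpace ℝ (Fin n))) (p : M) (i : Fin n) :
    Module.Dual ℝ (TangentSpace (𝓡 n) p) :=
  ((EuclideanSpace.proj i : EuclideanSpace ℝ (Fin n) →L[ℝ] ℝ).comp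
    (mfderiv (𝓡 n) (𝓡 n) e p : TangentSpace (𝓡 n) p →L[ℝ] Coord n)).toLinearMap

/-- The Jacobian matrix of the transition from the chart `e` to the chart `e'` at `p`. -/
def jacobian (e e' : OpenPartialHomeomorph M (EuclideanSpace ℝ (Fin n))) (p : M) :
    Matrix (Fin n) (Fin n) ℝ := Matrix.of fun a i => coframe e' p a (frame e p i)

/-- Components are defined at the base point `e.symm (e p)`, which is `p` only up to a proof. The
tangent spaces share the model space `ℝⁿ`, so vectors can be held fixed while the point is moved. -/
theorem lowerComponents_apply (b : ∀ p : M, LinearMap.BilinForm ℝ (TangentSpace (𝓡 n) p))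
    (e : OpenPartialHomeomorph M (EuclideanSpace ℝ (Fin n))) {p : M} (hp : p ∈ e.source)
    (i j : Fin n) : lowerComponents b e (e p) i j = b p (frame e p i) (frame e p j) := by
  have h : ∀ (q : M) (_ : q = p) (v w : Coord n),
      b q (v : TangentSpace (𝓡 n) q) (w : TangentSpace (𝓡 n) q)
        = b p (v : TangentSpace (𝓡 n) p) (w : TangentSpace (𝓡 n) p) := by
    rintro q rfl v w
    rfl
  exact h _ (e.left_inv hp) _ _

theorem upperComponents_apply
    (γ : ∀ p : M, LinearMap.BilinForm ℝ (Module.Dual ℝ (TangentSpace (𝓡 n) p)))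
    (e : OpenPartialHomeomorph M (EuclideanSpace ℝ (Fin n))) {p : M} (hp : p ∈ e.source)
    (i j : Fin n) : upperComponents γ e (e p) i j = γ p (coframe e p i) (coframe e p j) := by
  have h : ∀ q : M, q = p → γ q (coframe e q i) (coframe e q j)
      = γ p (coframe e p i) (coframe e p j) := by
    rintro q rfl
    rfl
  exact h _ (e.left_inv hp)

variable [IsManifold (𝓡 n) ∞ M]
  {e e' : OpenPartialHomeomorph M (EuclideanSpace ℝ (Fin n))}

theorem coframe_frame (he : e ∈ atlas (EuclideanSpace ℝ (Fin n)) M) {p : M} (hp : p ∈ e.source)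
    (i j : Fin n) : coframe e p i (frame e p j) = if i = j then 1 else 0 := by
  have h := (mdifferentiable_of_mem_atlas (I := 𝓡 n) he).comp_symm_deriv (e.map_source hp)
  rw [e.left_inv hp] at h
  have h1 := congrArg (fun L : Coord n →L[ℝ] Coord n => L (EuclideanSpace.single j 1) i) h
  refine Eq.trans h1 ?_
  change (EuclideanSpace.single j (1 : ℝ) : Coord n) i = _
  simp

theorem sum_coframe_smul_frame (he : e ∈ atlas (EuclideanSpace ℝ (Fin n)) M) {p : M}
    (hp : p ∈ e.source) (v : TangentSpace (𝓡 n) p) : ∑ i, coframe e p i v • frame e p i = v := by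
  have h := (mdifferentiable_of_mem_atlas (I := 𝓡 n) he).symm_comp_deriv hp
  have h1 := congrArg (fun L : Coord n →L[ℝ] Coord n => L v) h
  refine Eq.trans ?_ h1
  let L1 : Coord n →L[ℝ] Coord n := mfderiv (𝓡 n) (𝓡 n) e p
  let L2 : Coord n →L[ℝ] Coord n := mfderiv (𝓡 n) (𝓡 n) e.symm (e p)
  change (∑ i, (L1 v) i • L2 (EuclideanSpace.single i (1 : ℝ)) : Coord n) = L2 (L1 v)
  have hx : ∀ w : Coord n, w = ∑ l, w l • EuclideanSpace.single l (1 : ℝ) := fun w => by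
    ext i
    simp [Pi.single_apply]
  conv_rhs => rw [hx (L1 v)]
  simp only [map_sum, map_smul]

theorem sum_apply_frame_smul_coframe (he : e ∈ atlas (EuclideanSpace ℝ (Fin n)) M) {p : M}
    (hp : p ∈ e.source) (α : Module.Dual ℝ (TangentSpace (𝓡 n) p)) :
    ∑ i, α (frame e p i) • coframe e p i = α := by
  ext1 v
  conv_rhs => rw [← sum_coframe_smul_frame he hp v]
  simp only [LinearMap.sum_apply, LinearMap.smul_apply, map_sum, map_smul, smul_eq_mul]
  exact Finset.sum_congr rfl fun i _ => mul_comm _ _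

theorem frame_eq_sum (he' : e' ∈ atlas (EuclideanSpace ℝ (Fin n)) M) {p : M}
    (hp' : p ∈ e'.source) (i : Fin n) :
    frame e p i = ∑ a, jacobian e e' p a i • frame e' p a :=
  (sum_coframe_smul_frame he' hp' (frame e p i)).symm

theorem coframe_eq_sum (he : e ∈ atlas (EuclideanSpace ℝ (Fin n)) M) {p : M} (hp : p ∈ e.source)
    (a : Fin n) : coframe e' p a = ∑ i, jacobian e e' p a i • coframe e p i :=
  (sum_apply_frame_smul_coframe he hp (coframe e' p a)).symm

theorem jacobian_mul_jacobian (he : e ∈ atlas (EuclideanSpace ℝ (Fin n)) M)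
    (he' : e' ∈ atlas (EuclideanSpace ℝ (Fin n)) M) {p : M} (hp : p ∈ e.source)
    (hp' : p ∈ e'.source) : jacobian e' e p * jacobian e e' p = 1 := by
  ext i j
  rw [Matrix.mul_apply, Matrix.one_apply, ← coframe_frame he hp i j]
  conv_rhs => rw [frame_eq_sum (e := e) he' hp' j]
  simp only [map_sum, map_smul, smul_eq_mul]
  exact Finset.sum_congr rfl fun a _ => mul_comm _ _

theorem isUnit_det_jacobian (he : e ∈ atlas (EuclideanSpace ℝ (Fin n)) M)
    (he' : e' ∈ atlas (EuclideanSpace ℝ (Fin n)) M) {p : M} (hp : p ∈ e.source)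
    (hp' : p ∈ e'.source) : IsUnit (jacobian e e' p).det :=
  Matrix.isUnit_det_of_left_inverse (jacobian_mul_jacobian he he' hp hp')

theorem lowerComponents_transform (he' : e' ∈ atlas (EuclideanSpace ℝ (Fin n)) M)
    (b : ∀ p : M, LinearMap.BilinForm ℝ (TangentSpace (𝓡 n) p)) {p : M} (hp : p ∈ e.source)
    (hp' : p ∈ e'.source) : lowerComponents b e (e p)
      = (jacobian e e' p).transpose * lowerComponents b e' (e' p) * jacobian e e' p := by
  ext i j
  rw [lowerComponents_apply b e hp, frame_eq_sum (e := e) he' hp' i, frame_eq_sum (e := e) he' hp' j]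
  simp only [map_sum, map_smul, LinearMap.sum_apply, LinearMap.smul_apply, smul_eq_mul,
    Matrix.mul_apply, Matrix.transpose_apply, lowerComponents_apply b e' hp', Finset.sum_mul]
  refine Finset.sum_congr rfl fun a _ => ?_
  rw [Finset.mul_sum]
  exact Finset.sum_congr rfl fun c _ => by ring

theorem upperComponents_transform (he : e ∈ atlas (EuclideanSpace ℝ (Fin n)) M)
    (γ : ∀ p : M, LinearMap.BilinForm ℝ (Module.Dual ℝ (TangentSpace (𝓡 n) p))) {p : M}
    (hp : p ∈ e.source) (hp' : p ∈ e'.source) : upperComponents γ e' (e' p)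
      = jacobian e e' p * upperComponents γ e (e p) * (jacobian e e' p).transpose := by
  ext i j
  rw [upperComponents_apply γ e' hp', coframe_eq_sum (e' := e') he hp i,
    coframe_eq_sum (e' := e') he hp j]
  simp only [map_sum, map_smul, LinearMap.sum_apply, LinearMap.smul_apply, smul_eq_mul,
    Matrix.mul_apply, Matrix.transpose_apply, upperComponents_apply γ e hp, Finset.sum_mul]
  refine Finset.sum_congr rfl fun a _ => ?_
  rw [Finset.mul_sum]
  exact Finset.sum_congr rfl fun c _ => by ring

/-- Only the Jacobian has to be invertible; the rule `(AB)⁻¹ = B⁻¹A⁻¹` holds for `Matrix.inv` even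
where `γ` is degenerate. -/
theorem metricOfInverse_transform (he : e ∈ atlas (EuclideanSpace ℝ (Fin n)) M)
    (he' : e' ∈ atlas (EuclideanSpace ℝ (Fin n)) M)
    (γ : ∀ p : M, LinearMap.BilinForm ℝ (Module.Dual ℝ (TangentSpace (𝓡 n) p))) {p : M}
    (hp : p ∈ e.source) (hp' : p ∈ e'.source) : metricOfInverse γ e (e p)
      = (jacobian e e' p).transpose * metricOfInverse γ e' (e' p) * jacobian e e' p := by
  have hJ := isUnit_det_jacobian he he' hp hp'
  have hJt : IsUnit (jacobian e e' p).transpose.det := by rwa [Matrix.det_transpose]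
  rw [metricOfInverse, metricOfInverse, upperComponents_transform he γ hp hp', Matrix.mul_inv_rev,
    Matrix.mul_inv_rev, Matrix.mul_assoc, Matrix.mul_assoc, Matrix.mul_assoc,
    Matrix.nonsing_inv_mul _ hJ, Matrix.mul_one, Matrix.mul_nonsing_inv_cancel_left _ _ hJt]

/-- The change of coordinates from the chart `e` to the chart `e'`. -/
def transition (e e' : OpenPartialHomeomorph M (EuclideanSpace ℝ (Fin n))) (y : Coord n) : Coord n :=
  e' (e.symm y)

theorem contDiffOn_transition (he : e ∈ atlas (EuclideanSpace ℝ (Fin n)) M)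
    (he' : e' ∈ atlas (EuclideanSpace ℝ (Fin n)) M) :
    ContDiffOn ℝ ∞ (transition e e') (e.symm.trans e').source := by
  have h := HasGroupoid.compatible (G := contDiffGroupoid ∞ (𝓡 n)) he he'
  rw [contDiffGroupoid, mem_groupoid_of_pregroupoid, contDiffPregroupoid] at h
  have h1 : ContDiffOn ℝ ∞ (fun y => e' (e.symm y)) (e.symm.trans e').source := by
    simpa [Function.comp_def] using h.1
  exact h1

theorem fderiv_transition (he : e ∈ atlas (EuclideanSpace ℝ (Fin n)) M)
    (he' : e' ∈ atlas (EuclideanSpace ℝ (Fin n)) M) {p : M} (hp : p ∈ e.source)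
    (hp' : p ∈ e'.source) (i a : Fin n) :
    fderiv ℝ (transition e e') (e p) (EuclideanSpace.single i 1) a = jacobian e e' p a i := by
  have h1 : MDifferentiableAt (𝓡 n) (𝓡 n) e' (e.symm (e p)) := by
    rw [e.left_inv hp]
    exact (mdifferentiable_of_mem_atlas (I := 𝓡 n) he').mdifferentiableAt hp'
  have h2 := (mdifferentiable_of_mem_atlas (I := 𝓡 n) he).mdifferentiableAt_symm (e.map_source hp)
  have h3 := mfderiv_comp (e p) h1 h2
  rw [mfderiv_eq_fderiv] at h3
  have h4 : fderiv ℝ (transition e e') (e p) (EuclideanSpace.single i 1) a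
      = coframe e' (e.symm (e p)) a (frame e p i : Coord n) := by
    exact congrArg (fun L : Coord n →L[ℝ] Coord n => L (EuclideanSpace.single i 1) a) h3
  have h5 : ∀ q : M, q = p → coframe e' q a (frame e p i : Coord n)
      = coframe e' p a (frame e p i) := by
    rintro q rfl
    rfl
  rw [h4, h5 _ (e.left_inv hp)]
  rfl

end Frames

/-! ### Tensors derived from a smooth inverse metric -/

section InverseMetric

variable {n : ℕ} {M : Type*} [TopologicalSpace M] [ChartedSpace (EuclideanSpace ℝ (Fin n)) M]

/-- A field `γ` of bilinear forms on the cotangent spaces whose components in each chart are smooth,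
symmetric, and of positive determinant. -/
def IsSmoothInverse
    (γ : ∀ p : M, LinearMap.BilinForm ℝ (Module.Dual ℝ (TangentSpace (𝓡 n) p))) : Prop :=
  ∀ e ∈ atlas (EuclideanSpace ℝ (Fin n)) M, SmoothSymm e.target (upperComponents γ e)

/-- Both sides are traces, and cyclicity moves `J` across. This is why full contractions do not
depend on the chart. -/
theorem sum_mul_transform (J A B : Matrix (Fin n) (Fin n) ℝ) :
    ∑ i, ∑ j, (J.transpose * A * J) i j * B i j
      = ∑ a, ∑ b, A a b * (J * B * J.transpose) a b := by
  have h : ∀ A B : Matrix (Fin n) (Fin n) ℝ,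
      ∑ i, ∑ j, A i j * B i j = (A * B.transpose).trace := fun A B => by
    simp [Matrix.trace, Matrix.mul_apply]
  rw [h, h, Matrix.transpose_mul, Matrix.transpose_mul, Matrix.transpose_transpose,
    Matrix.mul_assoc, Matrix.mul_assoc, Matrix.trace_mul_comm]
  simp only [Matrix.mul_assoc]

theorem metricMap_eq_dotProduct (G : Coord n → Matrix (Fin n) (Fin n) ℝ) (y u v : Coord n) :
    metricMap G y u v = u.ofLp ⬝ᵥ (G y).mulVec v.ofLp := by
  rw [metricMap_apply]
  simp only [dotProduct, Matrix.mulVec, Finset.mul_sum]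
  exact Finset.sum_congr rfl fun a _ => Finset.sum_congr rfl fun c _ => by ring

variable [IsManifold (𝓡 n) ∞ M]
  {e e' : OpenPartialHomeomorph M (EuclideanSpace ℝ (Fin n))}

theorem fderiv_transition_apply (he : e ∈ atlas (EuclideanSpace ℝ (Fin n)) M)
    (he' : e' ∈ atlas (EuclideanSpace ℝ (Fin n)) M) {p : M} (hp : p ∈ e.source)
    (hp' : p ∈ e'.source) (u : Coord n) :
    (fderiv ℝ (transition e e') (e p) u).ofLp = (jacobian e e' p).mulVec u.ofLp := by
  have hx : u = ∑ l, u l • EuclideanSpace.single l (1 : ℝ) := by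
    ext i
    simp [Pi.single_apply]
  funext a
  conv_lhs => rw [hx]
  simp only [map_sum, map_smul, WithLp.ofLp_sum, Finset.sum_apply, PiLp.smul_apply, smul_eq_mul,
    fderiv_transition he he' hp hp', Matrix.mulVec, dotProduct]
  exact Finset.sum_congr rfl fun i _ => mul_comm _ _

theorem bijective_fderiv_transition (he : e ∈ atlas (EuclideanSpace ℝ (Fin n)) M)
    (he' : e' ∈ atlas (EuclideanSpace ℝ (Fin n)) M) {p : M} (hp : p ∈ e.source)
    (hp' : p ∈ e'.source) : Function.Bijective (fderiv ℝ (transition e e') (e p)) := by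
  have hi : Function.Injective (fderiv ℝ (transition e e') (e p)).toLinearMap := by
    rw [← LinearMap.ker_eq_bot, LinearMap.ker_eq_bot']
    intro u hu
    have h : (jacobian e e' p).mulVec u.ofLp = 0 := by
      rw [← fderiv_transition_apply he he' hp hp']
      exact congrArg WithLp.ofLp hu
    have h2 := Matrix.eq_zero_of_mulVec_eq_zero (isUnit_det_jacobian he he' hp hp').ne_zero h
    ext i
    simp [h2]
  exact ⟨hi, LinearMap.injective_iff_surjective.mp hi⟩

variable {γ : ∀ p : M, LinearMap.BilinForm ℝ (Module.Dual ℝ (TangentSpace (𝓡 n) p))}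

/-- The transition map is an isometry between the two coordinate metrics on the overlap, so
`SmoothSymm.ricci_comp` applies. -/
theorem IsSmoothInverse.ricci_transform (hγ : IsSmoothInverse γ)
    (he : e ∈ atlas (EuclideanSpace ℝ (Fin n)) M)
    (he' : e' ∈ atlas (EuclideanSpace ℝ (Fin n)) M) {p : M} (hp : p ∈ e.source)
    (hp' : p ∈ e'.source) :
    Matrix.of (ricci (metricOfInverse γ e) (e p)) = (jacobian e e' p).transpose *
      Matrix.of (ricci (metricOfInverse γ e') (e' p)) * jacobian e e' p := by
  have hV : (e.symm.trans e').source = e.target ∩ e.symm ⁻¹' e'.source := by simp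
  have h1 : SmoothSymm (e.symm.trans e').source (metricOfInverse γ e) :=
    (hγ e he).inv.mono (e.symm.trans e').open_source (by rw [hV]; exact Set.inter_subset_left)
  have h2 : SmoothSymm e'.target (metricOfInverse γ e') := (hγ e' he').inv
  have hpt : ∀ z ∈ (e.symm.trans e').source, ∃ q, q ∈ e.source ∧ q ∈ e'.source ∧ e q = z := by
    intro z hz
    rw [hV] at hz
    exact ⟨e.symm z, e.map_target hz.1, hz.2, e.right_inv hz.1⟩
  have htr : ∀ q, q ∈ e.source → transition e e' (e q) = e' q := fun q hq => by
    rw [transition, e.left_inv hq]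
  have hm : Set.MapsTo (transition e e') (e.symm.trans e').source e'.target := by
    intro z hz
    obtain ⟨q, hq, hq', rfl⟩ := hpt z hz
    rw [htr q hq]
    exact e'.map_source hq'
  have hpV : e p ∈ (e.symm.trans e').source := by
    rw [hV]
    exact ⟨e.map_source hp, by simpa [e.left_inv hp] using hp'⟩
  ext i k
  have h := h1.ricci_comp h2 (contDiffOn_transition he he') hm (fun z hz u v => by
    obtain ⟨q, hq, hq', rfl⟩ := hpt z hz
    rw [metricMap_eq_dotProduct, metricMap_eq_dotProduct, fderiv_transition_apply he he' hq hq',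
      fderiv_transition_apply he he' hq hq', htr q hq, metricOfInverse_transform he he' γ hq hq',
      ← Matrix.mulVec_mulVec, ← Matrix.mulVec_mulVec, Matrix.dotProduct_mulVec u.ofLp,
      Matrix.vecMul_transpose]) (fun z hz => by
    obtain ⟨q, hq, hq', rfl⟩ := hpt z hz
    exact bijective_fderiv_transition he he' hq hq') hpV i k
  rw [Matrix.of_apply, h, htr p hp]
  simp only [fderiv_transition he he' hp hp', Matrix.mul_apply, Matrix.transpose_apply,
    Matrix.of_apply, Finset.sum_mul]
  rw [Finset.sum_comm]
  exact Finset.sum_congr rfl fun a _ => Finset.sum_congr rfl fun c _ => by ring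

theorem IsSmoothInverse.scalar_transform (hγ : IsSmoothInverse γ)
    (he : e ∈ atlas (EuclideanSpace ℝ (Fin n)) M)
    (he' : e' ∈ atlas (EuclideanSpace ℝ (Fin n)) M) {p : M} (hp : p ∈ e.source)
    (hp' : p ∈ e'.source) :
    ∑ i, ∑ j, upperComponents γ e (e p) i j * ricci (metricOfInverse γ e) (e p) i j
      = ∑ i, ∑ j, upperComponents γ e' (e' p) i j * ricci (metricOfInverse γ e') (e' p) i j := by
  have h := sum_mul_transform (jacobian e e' p) (Matrix.of (ricci (metricOfInverse γ e') (e' p)))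
    (upperComponents γ e (e p))
  rw [← hγ.ricci_transform he he' hp hp', ← upperComponents_transform he γ hp hp'] at h
  simp only [Matrix.of_apply] at h
  simpa only [mul_comm] using h

theorem IsSmoothInverse.scalarCurvature_eq (hγ : IsSmoothInverse γ)
    (he : e ∈ atlas (EuclideanSpace ℝ (Fin n)) M) {p : M} (hp : p ∈ e.source) :
    scalarCurvature γ p
      = ∑ i, ∑ j, upperComponents γ e (e p) i j * ricci (metricOfInverse γ e) (e p) i j :=
  hγ.scalar_transform (chart_mem_atlas _ p) he (mem_chart_source _ p) hp

theorem IsSmoothInverse.einstein_transform (hγ : IsSmoothInverse γ)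
    (he : e ∈ atlas (EuclideanSpace ℝ (Fin n)) M)
    (he' : e' ∈ atlas (EuclideanSpace ℝ (Fin n)) M) {p : M} (hp : p ∈ e.source)
    (hp' : p ∈ e'.source) :
    Matrix.of (einstein (upperComponents γ e) (e p)) = (jacobian e e' p).transpose *
      Matrix.of (einstein (upperComponents γ e') (e' p)) * jacobian e e' p := by
  have h : ∀ e : OpenPartialHomeomorph M (EuclideanSpace ℝ (Fin n)),
      Matrix.of (einstein (upperComponents γ e) (e p))
        = Matrix.of (ricci (metricOfInverse γ e) (e p)) - (1 / 2 * ∑ i, ∑ j,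
          upperComponents γ e (e p) i j * ricci (metricOfInverse γ e) (e p) i j)
            • metricOfInverse γ e (e p) := fun e => rfl
  rw [h, h, hγ.scalar_transform he he' hp hp', hγ.ricci_transform he he' hp hp',
    metricOfInverse_transform he he' γ hp hp', Matrix.mul_sub, Matrix.sub_mul, Matrix.mul_smul,
    Matrix.smul_mul]

theorem contraction_eq (E : SymTensorLower n M) (k : SymTensorUpper n M)
    (he : e ∈ atlas (EuclideanSpace ℝ (Fin n)) M) {p : M} (hp : p ∈ e.source) :
    contraction E k p = ∑ i, ∑ j, lowerComponents E.toFun e (e p) i j *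
      upperComponents k.toFun e (e p) i j := by
  have h := sum_mul_transform (jacobian (chartAt _ p) e p) (lowerComponents E.toFun e (e p))
    (upperComponents k.toFun (chartAt _ p) (chartAt _ p p))
  rw [← lowerComponents_transform he E.toFun (mem_chart_source _ p) hp,
    ← upperComponents_transform (chart_mem_atlas _ p) k.toFun (mem_chart_source _ p) hp] at h
  exact h

end InverseMetric

/-! ### The inverse of a Riemannian metric -/

section Metric

variable {n : ℕ} {M : Type*} [TopologicalSpace M] [ChartedSpace (EuclideanSpace ℝ (Fin n)) M]
  [IsManifold (𝓡 n) ∞ M] (g : Metric n M)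
  {e : OpenPartialHomeomorph M (EuclideanSpace ℝ (Fin n))}

theorem Metric.bilin_symm (p : M) (v w : TangentSpace (𝓡 n) p) : g.bilin p v w = g.bilin p w v :=
  g.symm p v w

theorem Metric.bilin_flat_symm (p : M) (α : Module.Dual ℝ (TangentSpace (𝓡 n) p))
    (v : TangentSpace (𝓡 n) p) : g.bilin p ((g.flat p).symm α) v = α v := by
  have h : g.flat p ((g.flat p).symm α) = g.bilin p ((g.flat p).symm α) := rfl
  rw [← h, LinearEquiv.apply_symm_apply]

theorem Metric.inverse_symm (p : M) (α β : Module.Dual ℝ (TangentSpace (𝓡 n) p)) :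
    g.inverse p α β = g.inverse p β α := g.bilin_symm p _ _

/-- The `i`-th row of `(gⁱʲ)` consists of the components of the vector representing `dxⁱ` through
`g`; pairing it with `∂ₖ` returns `dxⁱ(∂ₖ)`. -/
theorem Metric.upperComponents_inverse_mul (he : e ∈ atlas (EuclideanSpace ℝ (Fin n)) M) {p : M}
    (hp : p ∈ e.source) :
    upperComponents g.inverse e (e p) * lowerComponents g.bilin e (e p) = 1 := by
  ext i k
  have h1 : ∀ j, upperComponents g.inverse e (e p) i j
      = coframe e p j ((g.flat p).symm (coframe e p i)) := fun j => by
    rw [upperComponents_apply _ e hp, g.inverse_symm]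
    exact g.bilin_flat_symm p _ _
  rw [Matrix.mul_apply, Matrix.one_apply, ← coframe_frame he hp i k,
    ← g.bilin_flat_symm p (coframe e p i)]
  conv_rhs => rw [← sum_coframe_smul_frame he hp ((g.flat p).symm (coframe e p i))]
  simp only [map_sum, map_smul, LinearMap.sum_apply, LinearMap.smul_apply, smul_eq_mul, h1,
    lowerComponents_apply _ e hp]

theorem Metric.lowerComponents_posDef (he : e ∈ atlas (EuclideanSpace ℝ (Fin n)) M) {p : M}
    (hp : p ∈ e.source) : (lowerComponents g.bilin e (e p)).PosDef := by
  refine Matrix.PosDef.of_dotProduct_mulVec_pos ?_ fun x hx => ?_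
  · ext i j
    simp only [Matrix.conjTranspose_apply, star_trivial, lowerComponents_apply _ e hp]
    exact g.bilin_symm p _ _
  · have h : star x ⬝ᵥ (lowerComponents g.bilin e (e p)).mulVec x
        = g.bilin p (∑ i, x i • frame e p i) (∑ i, x i • frame e p i) := by
      simp only [map_sum, map_smul, LinearMap.sum_apply, LinearMap.smul_apply, smul_eq_mul,
        dotProduct, Matrix.mulVec, star_trivial, lowerComponents_apply _ e hp, Finset.mul_sum]
      rw [Finset.sum_comm]
      exact Finset.sum_congr rfl fun a _ => Finset.sum_congr rfl fun c _ => by ring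
    rw [h]
    refine g.pos p _ fun h0 => hx ?_
    funext j
    have h1 := congrArg (coframe e p j) h0
    simpa [coframe_frame he hp] using h1

/-- The coordinate vectors are the tangent map of `e.symm` on constant fields, hence smooth along
`e.symm`; evaluating the smooth section `g` on them is smooth. -/
theorem Metric.contDiffOn_lowerComponents (he : e ∈ atlas (EuclideanSpace ℝ (Fin n)) M)
    (i j : Fin n) : ContDiffOn ℝ ∞ (fun y => lowerComponents g.bilin e y i j) e.target := by
  have hs : ContMDiffOn (𝓡 n) (𝓡 n) ∞ e.symm e.target :=
    contMDiffOn_symm_of_mem_maximalAtlas (IsManifold.subset_maximalAtlas he)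
  have hv : ∀ i, ContMDiffOn (𝓡 n) (𝓡 n).tangent ∞ (fun y => Bundle.TotalSpace.mk'
      (EuclideanSpace ℝ (Fin n)) (E := fun p : M => TangentSpace (𝓡 n) p) (e.symm y)
        (coordVector e y i)) e.target := by
    intro i
    have h1 := hs.contMDiffOn_tangentMapWithin (m := ∞) (by simp) e.open_target.uniqueMDiffOn
    have h2 : ContMDiffOn (𝓡 n) (𝓡 n).tangent ∞ (fun y : EuclideanSpace ℝ (Fin n) =>
        (⟨y, EuclideanSpace.single i (1 : ℝ)⟩ :
          TangentBundle (𝓡 n) (EuclideanSpace ℝ (Fin n)))) e.target :=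
      contMDiffOn_vectorSpace_iff_contDiffOn.mpr contDiffOn_const
    refine (h1.comp h2 fun y hy => hy).congr fun y hy => ?_
    simp only [Function.comp_apply, tangentMapWithin]
    rw [mfderivWithin_of_isOpen e.open_target hy]
    rfl
  have hg : ContMDiffOn (𝓡 n) ((𝓡 n).prod 𝓘(ℝ, EuclideanSpace ℝ (Fin n) →L[ℝ]
      EuclideanSpace ℝ (Fin n) →L[ℝ] ℝ)) ∞ (fun y => Bundle.TotalSpace.mk'
        (EuclideanSpace ℝ (Fin n) →L[ℝ] EuclideanSpace ℝ (Fin n) →L[ℝ] ℝ)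
        (E := fun p : M => TangentSpace (𝓡 n) p →L[ℝ] TangentSpace (𝓡 n) p →L[ℝ] ℝ) (e.symm y)
        (g.inner (e.symm y))) e.target := g.contMDiff.comp_contMDiffOn hs
  have h : ContMDiffOn (𝓡 n) ((𝓡 n).prod 𝓘(ℝ)) ∞ (fun y => Bundle.TotalSpace.mk' ℝ
      (E := Bundle.Trivial M ℝ) (e.symm y)
        (g.inner (e.symm y) (coordVector e y i) (coordVector e y j))) e.target :=
    ContMDiffOn.clm_bundle_apply₂ (F₁ := EuclideanSpace ℝ (Fin n)) (F₂ := EuclideanSpace ℝ (Fin n))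
      hg (hv i) (hv j)
  intro y hy
  have h1 := h y hy
  simp only [Bundle.contMDiffWithinAt_totalSpace] at h1
  exact h1.2.contDiffWithinAt

theorem Metric.upperComponents_inverse (he : e ∈ atlas (EuclideanSpace ℝ (Fin n)) M)
    {y : Coord n} (hy : y ∈ e.target) :
    upperComponents g.inverse e y = (lowerComponents g.bilin e y)⁻¹ := by
  have h := g.upperComponents_inverse_mul he (e.map_target hy)
  rw [e.right_inv hy] at h
  exact (Matrix.inv_eq_left_inv h).symm

theorem Metric.smoothSymm_lowerComponents (he : e ∈ atlas (EuclideanSpace ℝ (Fin n)) M) :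
    SmoothSymm e.target (lowerComponents g.bilin e) where
  isOpen := e.open_target
  smooth := g.contDiffOn_lowerComponents he
  symm y _ i j := g.bilin_symm _ _ _
  det_pos y hy := by
    have h := (g.lowerComponents_posDef he (e.map_target hy)).det_pos
    rwa [e.right_inv hy] at h

theorem SmoothSymm.congr {V : Set (Coord n)} {G G' : Coord n → Matrix (Fin n) (Fin n) ℝ}
    (h : SmoothSymm V G) (hG : ∀ y ∈ V, G' y = G y) : SmoothSymm V G' where
  isOpen := h.isOpen
  smooth i j := (h.smooth i j).congr fun y hy => by rw [hG y hy]
  symm y hy i j := by rw [hG y hy, h.symm y hy]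
  det_pos y hy := by rw [hG y hy]; exact h.det_pos y hy

theorem Metric.isSmoothInverse : IsSmoothInverse g.inverse := fun _ he =>
  (g.smoothSymm_lowerComponents he).inv.congr fun _ hy => g.upperComponents_inverse he hy

theorem Metric.metricOfInverse_eq (he : e ∈ atlas (EuclideanSpace ℝ (Fin n)) M)
    {y : Coord n} (hy : y ∈ e.target) :
    metricOfInverse g.inverse e y = lowerComponents g.bilin e y := by
  rw [metricOfInverse, g.upperComponents_inverse he hy, Matrix.nonsing_inv_nonsing_inv]
  exact (g.smoothSymm_lowerComponents he).isUnit_det hy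

end Metric

/-! ### The Riemannian volume measure -/

section VolumeRatio

variable {n : ℕ} {M : Type*} [TopologicalSpace M] [ChartedSpace (EuclideanSpace ℝ (Fin n)) M]
  {e e' : OpenPartialHomeomorph M (EuclideanSpace ℝ (Fin n))}
  {γ γ' : ∀ p : M, LinearMap.BilinForm ℝ (Module.Dual ℝ (TangentSpace (𝓡 n) p))}

theorem IsSmoothInverse.sqrt_det_pos (hγ : IsSmoothInverse γ)
    (he : e ∈ atlas (EuclideanSpace ℝ (Fin n)) M) {y : Coord n} (hy : y ∈ e.target) :
    0 < Real.sqrt (metricOfInverse γ e y).det :=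
  Real.sqrt_pos.mpr ((hγ e he).inv_det_pos hy)

theorem continuous_of_charts {X : Type*} [TopologicalSpace X] {f : M → X}
    (hf : ∀ e ∈ atlas (EuclideanSpace ℝ (Fin n)) M, ContinuousOn (fun y => f (e.symm y)) e.target) :
    Continuous f := by
  refine continuous_iff_continuousAt.mpr fun p => ?_
  set e := chartAt (EuclideanSpace ℝ (Fin n)) p with hedef
  have hp : p ∈ e.source := mem_chart_source _ p
  have h1 : ContinuousAt (fun y => f (e.symm y)) (e p) :=
    (hf e (chart_mem_atlas _ p)).continuousAt (e.open_target.mem_nhds (e.map_source hp))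
  have h2 : ContinuousAt (fun q => f (e.symm (e q))) p := h1.comp (e.continuousAt hp)
  refine h2.congr ?_
  filter_upwards [e.open_source.mem_nhds hp] with q hq
  rw [e.left_inv hq]

/-- The density of the Riemannian volume of `γ'` with respect to that of `γ`. -/
def volumeRatio (γ γ' : ∀ p : M, LinearMap.BilinForm ℝ (Module.Dual ℝ (TangentSpace (𝓡 n) p)))
    (p : M) : ℝ :=
  Real.sqrt (metricOfInverse γ' (chartAt (EuclideanSpace ℝ (Fin n)) p)
      (chartAt (EuclideanSpace ℝ (Fin n)) p p)).det /
    Real.sqrt (metricOfInverse γ (chartAt (EuclideanSpace ℝ (Fin n)) p)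
      (chartAt (EuclideanSpace ℝ (Fin n)) p p)).det

theorem volumeRatio_nonneg
    (γ γ' : ∀ p : M, LinearMap.BilinForm ℝ (Module.Dual ℝ (TangentSpace (𝓡 n) p))) (p : M) :
    0 ≤ volumeRatio γ γ' p := div_nonneg (Real.sqrt_nonneg _) (Real.sqrt_nonneg _)

variable [IsManifold (𝓡 n) ∞ M]

theorem det_fderiv_transition (he : e ∈ atlas (EuclideanSpace ℝ (Fin n)) M)
    (he' : e' ∈ atlas (EuclideanSpace ℝ (Fin n)) M) {p : M} (hp : p ∈ e.source)
    (hp' : p ∈ e'.source) :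
    (fderiv ℝ (transition e e') (e p)).det = (jacobian e e' p).det := by
  rw [ContinuousLinearMap.det, ← LinearMap.det_toMatrix (EuclideanSpace.basisFun (Fin n) ℝ).toBasis]
  congr 1
  ext i j
  simp [LinearMap.toMatrix_apply, fderiv_transition he he' hp hp']

theorem sqrt_det_transform (he : e ∈ atlas (EuclideanSpace ℝ (Fin n)) M)
    (he' : e' ∈ atlas (EuclideanSpace ℝ (Fin n)) M)
    (γ : ∀ p : M, LinearMap.BilinForm ℝ (Module.Dual ℝ (TangentSpace (𝓡 n) p))) {p : M}
    (hp : p ∈ e.source) (hp' : p ∈ e'.source) : Real.sqrt (metricOfInverse γ e (e p)).det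
      = |(jacobian e e' p).det| * Real.sqrt (metricOfInverse γ e' (e' p)).det := by
  rw [metricOfInverse_transform he he' γ hp hp', Matrix.det_mul, Matrix.det_mul,
    Matrix.det_transpose, mul_right_comm, Real.sqrt_mul (mul_self_nonneg _),
    Real.sqrt_mul_self_eq_abs]

/-- Both densities acquire the same factor `|det J|`, so their ratio is a function on `M`. -/
theorem volumeRatio_eq (γ γ' : ∀ p : M, LinearMap.BilinForm ℝ (Module.Dual ℝ (TangentSpace (𝓡 n) p)))
    (he : e ∈ atlas (EuclideanSpace ℝ (Fin n)) M) {p : M} (hp : p ∈ e.source) :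
    volumeRatio γ γ' p = Real.sqrt (metricOfInverse γ' e (e p)).det /
      Real.sqrt (metricOfInverse γ e (e p)).det := by
  have hc := chart_mem_atlas (EuclideanSpace ℝ (Fin n)) p
  have hpc := mem_chart_source (EuclideanSpace ℝ (Fin n)) p
  rw [volumeRatio, sqrt_det_transform hc he γ hpc hp, sqrt_det_transform hc he γ' hpc hp,
    mul_div_mul_left]
  exact abs_ne_zero.mpr (isUnit_det_jacobian hc he hpc hp).ne_zero

theorem continuous_volumeRatio (hγ : IsSmoothInverse γ) (hγ' : IsSmoothInverse γ') :
    Continuous (volumeRatio γ γ') := by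
  refine continuous_of_charts (n := n) fun e he => ?_
  have h : ContinuousOn (fun y => Real.sqrt (metricOfInverse γ' e y).det /
      Real.sqrt (metricOfInverse γ e y).det) e.target :=
    (contDiffOn_det (hγ' e he).inv.smooth).continuousOn.sqrt.div
      (contDiffOn_det (hγ e he).inv.smooth).continuousOn.sqrt
      fun y hy => (hγ.sqrt_det_pos he hy).ne'
  refine h.congr fun y hy => ?_
  rw [volumeRatio_eq γ γ' he (e.map_target hy), e.right_inv hy]

end VolumeRatio

/-! ### Chart measures, their agreement on overlaps, and comparison of volumes -/

section Volume

variable {n : ℕ} {M : Type*} [TopologicalSpace M] [MeasurableSpace M] [BorelSpace M]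

theorem measurableSet_target_inter_preimage
    (e : OpenPartialHomeomorph M (EuclideanSpace ℝ (Fin n))) {s : Set M} (hs : MeasurableSet s) :
    MeasurableSet (e.target ∩ e.symm ⁻¹' s) := by
  have h : Measurable (e.target.domRestrict e.symm) :=
    (continuousOn_iff_continuous_domRestrict.mp e.continuousOn_symm).measurable
  have h2 := e.open_target.measurableSet.subtype_image (h hs)
  convert h2 using 1
  ext y
  simp [Set.mem_image, and_comm]

theorem aemeasurable_symm (e : OpenPartialHomeomorph M (EuclideanSpace ℝ (Fin n)))
    (f : Coord n → ENNReal) :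
    AEMeasurable e.symm (((volume : Measure (Coord n)).restrict e.target).withDensity f) :=
  (e.continuousOn_symm.aemeasurable e.open_target.measurableSet).mono_ac
    (withDensity_absolutelyContinuous _ _)

variable [ChartedSpace (EuclideanSpace ℝ (Fin n)) M]
  {e e' : OpenPartialHomeomorph M (EuclideanSpace ℝ (Fin n))}
  {γ γ' : ∀ p : M, LinearMap.BilinForm ℝ (Module.Dual ℝ (TangentSpace (𝓡 n) p))}

theorem chartVolume_apply (γ : ∀ p : M, LinearMap.BilinForm ℝ (Module.Dual ℝ (TangentSpace (𝓡 n) p)))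
    (e : OpenPartialHomeomorph M (EuclideanSpace ℝ (Fin n))) {s : Set M} (hs : MeasurableSet s) :
    chartVolume γ e s = ∫⁻ y in e.target ∩ e.symm ⁻¹' s,
      ENNReal.ofReal (Real.sqrt (metricOfInverse γ e y).det) := by
  have hT := e.open_target.measurableSet
  rw [chartVolume, Measure.map_apply_of_aemeasurable (aemeasurable_symm e _) hs,
    ← restrict_withDensity hT, Measure.restrict_apply' hT, Set.inter_comm,
    withDensity_apply _ (measurableSet_target_inter_preimage e hs)]

theorem chartVolume_restrict_source
    (γ : ∀ p : M, LinearMap.BilinForm ℝ (Module.Dual ℝ (TangentSpace (𝓡 n) p)))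
    (e : OpenPartialHomeomorph M (EuclideanSpace ℝ (Fin n))) :
    (chartVolume γ e).restrict e.source = chartVolume γ e := by
  ext s hs
  rw [Measure.restrict_apply hs, chartVolume_apply γ e hs,
    chartVolume_apply γ e (hs.inter e.open_source.measurableSet)]
  congr 2
  ext y
  simp only [Set.mem_inter_iff, Set.mem_preimage]
  exact ⟨fun h => ⟨h.1, h.2.1⟩, fun h => ⟨h.1, h.2, e.map_target h.1⟩⟩

theorem lintegral_chartVolume {f : M → ENNReal} (hf : Measurable f)
    (hγ : IsSmoothInverse γ) (he : e ∈ atlas (EuclideanSpace ℝ (Fin n)) M) :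
    ∫⁻ p, f p ∂(chartVolume γ e) = ∫⁻ y in e.target,
      ENNReal.ofReal (Real.sqrt (metricOfInverse γ e y).det) * f (e.symm y) := by
  have hd : ContinuousOn (fun y => Real.sqrt (metricOfInverse γ e y).det) e.target :=
    (contDiffOn_det (hγ e he).inv.smooth).continuousOn.sqrt
  have hd' : AEMeasurable (fun y => ENNReal.ofReal (Real.sqrt (metricOfInverse γ e y).det))
      (volume.restrict e.target) := (hd.aemeasurable e.open_target.measurableSet).ennreal_ofReal
  rw [chartVolume, lintegral_map' hf.aemeasurable (aemeasurable_symm e _),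
    lintegral_withDensity_eq_lintegral_mul₀ hd' (g := fun y => f (e.symm y)) (hf.comp_aemeasurable
      (e.continuousOn_symm.aemeasurable e.open_target.measurableSet))]
  rfl

/-- The density is strictly positive in charts. The fundamental lemma needs this to pass from a
vanishing integral to pointwise vanishing. -/
theorem IsSmoothInverse.isOpenPosMeasure (hγ : IsSmoothInverse γ) :
    (riemannianVolume γ).IsOpenPosMeasure := by
  refine ⟨fun U hU ⟨p, hpU⟩ h0 => ?_⟩
  set e := chartAt (EuclideanSpace ℝ (Fin n)) p with hedef
  have he : e ∈ atlas (EuclideanSpace ℝ (Fin n)) M := chart_mem_atlas _ p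
  have hp : p ∈ e.source := mem_chart_source _ p
  have hW : IsOpen (e.target ∩ e.symm ⁻¹' U) := e.symm.isOpen_inter_preimage hU
  have h1 : chartVolume γ e U = 0 :=
    le_antisymm ((le_iSup₂_of_le (f := fun e (_ : e ∈ atlas (EuclideanSpace ℝ (Fin n)) M) =>
      chartVolume γ e) e he le_rfl U).trans h0.le) bot_le
  have hd : ContinuousOn (fun y => Real.sqrt (metricOfInverse γ e y).det)
      (e.target ∩ e.symm ⁻¹' U) :=
    (contDiffOn_det (hγ e he).inv.smooth).continuousOn.sqrt.mono Set.inter_subset_left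
  rw [chartVolume_apply γ e hU.measurableSet,
    lintegral_eq_zero_iff' (hd.aemeasurable hW.measurableSet).ennreal_ofReal] at h1
  have h2 : ∀ᵐ y ∂(volume.restrict (e.target ∩ e.symm ⁻¹' U)), False := by
    filter_upwards [h1, ae_restrict_mem hW.measurableSet] with y hy hyW
    exact (ENNReal.ofReal_pos.mpr (hγ.sqrt_det_pos he hyW.1)).ne' hy
  rw [Filter.eventually_false_iff_eq_bot, ae_eq_bot, Measure.restrict_eq_zero] at h2
  refine (hW.measure_pos volume ⟨e p, e.map_source hp, ?_⟩).ne' h2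
  simpa [e.left_inv hp] using hpU

variable [IsManifold (𝓡 n) ∞ M]

/-- Change of variables along the transition map: its Jacobian factor is the one by which `√det g`
transforms. -/
theorem chartVolume_inter (he : e ∈ atlas (EuclideanSpace ℝ (Fin n)) M)
    (he' : e' ∈ atlas (EuclideanSpace ℝ (Fin n)) M)
    (γ : ∀ p : M, LinearMap.BilinForm ℝ (Module.Dual ℝ (TangentSpace (𝓡 n) p))) {s : Set M}
    (hs : MeasurableSet s) :
    chartVolume γ e' (s ∩ e.source) = chartVolume γ e (s ∩ e'.source) := by
  have hm := measurableSet_target_inter_preimage e (hs.inter e'.open_source.measurableSet)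
  rw [chartVolume_apply γ e' (hs.inter e.open_source.measurableSet),
    chartVolume_apply γ e (hs.inter e'.open_source.measurableSet)]
  have himg : transition e e' '' (e.target ∩ e.symm ⁻¹' (s ∩ e'.source))
      = e'.target ∩ e'.symm ⁻¹' (s ∩ e.source) := by
    ext z
    constructor
    · rintro ⟨y, ⟨hy, hys, hy'⟩, rfl⟩
      refine ⟨e'.map_source hy', ?_⟩
      simp only [transition, Set.mem_preimage, e'.left_inv hy']
      exact ⟨hys, e.map_target hy⟩
    · rintro ⟨hz, hzs, hz'⟩
      refine ⟨e (e'.symm z), ⟨e.map_source hz', ?_⟩, ?_⟩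
      · simp only [Set.mem_preimage, e.left_inv hz']
        exact ⟨hzs, e'.map_target hz⟩
      · simp only [transition, e.left_inv hz', e'.right_inv hz]
  have hsub : e.target ∩ e.symm ⁻¹' (s ∩ e'.source) ⊆ (e.symm.trans e').source := by
    rintro y ⟨hy, -, hy'⟩
    simpa using ⟨hy, hy'⟩
  rw [← himg, lintegral_image_eq_lintegral_abs_det_fderiv_mul volume hm
    (f' := fun y => fderiv ℝ (transition e e') y)]
  · refine setLIntegral_congr_fun hm fun y hy => ?_
    have hp := e.map_target hy.1
    have h1 := sqrt_det_transform he he' γ hp hy.2.2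
    have h2 := det_fderiv_transition he he' hp hy.2.2
    rw [e.right_inv hy.1] at h1 h2
    rw [h1, h2, ← ENNReal.ofReal_mul (abs_nonneg _)]
    rfl
  · intro y hy
    exact (((contDiffOn_transition he he').contDiffAt ((e.symm.trans e').open_source.mem_nhds
      (hsub hy))).differentiableAt (by simp)).hasFDerivAt.hasFDerivWithinAt
  · intro y hy z hz hyz
    have h1 := congrArg e'.symm hyz
    simp only [transition, e'.left_inv hy.2.2, e'.left_inv hz.2.2] at h1
    exact e.symm.injOn hy.1 hz.1 h1

/-- On a chart domain the Riemannian volume is `√det(g_ij) dx¹ ⋯ dxⁿ`. -/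
theorem riemannianVolume_restrict (he : e ∈ atlas (EuclideanSpace ℝ (Fin n)) M)
    (γ : ∀ p : M, LinearMap.BilinForm ℝ (Module.Dual ℝ (TangentSpace (𝓡 n) p))) :
    (riemannianVolume γ).restrict e.source = chartVolume γ e := by
  have hsrc := e.open_source.measurableSet
  apply le_antisymm
  · have hle : riemannianVolume γ
        ≤ chartVolume γ e + (riemannianVolume γ).restrict e.sourceᶜ := by
      refine iSup₂_le fun e' he' => ?_
      have hle' : chartVolume γ e' ≤ riemannianVolume γ := le_iSup₂_of_le e' he' le_rfl
      rw [← Measure.restrict_add_restrict_compl (μ := chartVolume γ e') hsrc]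
      refine add_le_add ?_ (Measure.restrict_mono_measure hle' _)
      refine Measure.le_iff.mpr fun s hs => ?_
      rw [Measure.restrict_apply hs, chartVolume_inter he he' γ hs]
      exact measure_mono Set.inter_subset_left
    have h := Measure.restrict_mono_measure hle e.source
    rwa [Measure.restrict_add, chartVolume_restrict_source, Measure.restrict_restrict hsrc,
      Set.inter_compl_self, Measure.restrict_empty, add_zero] at h
  · rw [← chartVolume_restrict_source γ e]
    exact Measure.restrict_mono_measure (le_iSup₂_of_le e he le_rfl) _

/-- Integration in a chart. -/
theorem setIntegral_source_riemannianVolume {f : M → ℝ} (hf : Continuous f)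
    (hγ : IsSmoothInverse γ) (he : e ∈ atlas (EuclideanSpace ℝ (Fin n)) M) :
    ∫ p in e.source, f p ∂(riemannianVolume γ) = ∫ y in e.target,
      Real.sqrt (metricOfInverse γ e y).det * f (e.symm y) := by
  have hd : ContinuousOn (fun y => Real.sqrt (metricOfInverse γ e y).det) e.target :=
    (contDiffOn_det (hγ e he).inv.smooth).continuousOn.sqrt
  have hd' : AEMeasurable (fun y => ENNReal.ofReal (Real.sqrt (metricOfInverse γ e y).det))
      (volume.restrict e.target) := (hd.aemeasurable e.open_target.measurableSet).ennreal_ofReal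
  rw [riemannianVolume_restrict he, chartVolume, integral_map (aemeasurable_symm e _)
    hf.measurable.aestronglyMeasurable, integral_withDensity_eq_integral_toReal_smul₀ hd'
    (Filter.Eventually.of_forall fun _ => ENNReal.ofReal_lt_top)]
  simp only [ENNReal.toReal_ofReal (Real.sqrt_nonneg _), smul_eq_mul]

theorem IsSmoothInverse.isLocallyFiniteMeasure (hγ : IsSmoothInverse γ) :
    IsLocallyFiniteMeasure (riemannianVolume γ) := by
  refine ⟨fun p => ?_⟩
  set e := chartAt (EuclideanSpace ℝ (Fin n)) p with hedef
  have he : e ∈ atlas (EuclideanSpace ℝ (Fin n)) M := chart_mem_atlas _ p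
  have hp : p ∈ e.source := mem_chart_source _ p
  obtain ⟨K, hK, hpK, hKt⟩ := exists_compact_subset e.open_target (e.map_source hp)
  refine ⟨e.source ∩ e ⁻¹' interior K, ?_, ?_⟩
  · exact (e.isOpen_inter_preimage isOpen_interior).mem_nhds ⟨hp, hpK⟩
  have hm : MeasurableSet (e.source ∩ e ⁻¹' interior K) :=
    (e.isOpen_inter_preimage isOpen_interior).measurableSet
  have h1 : riemannianVolume γ (e.source ∩ e ⁻¹' interior K)
      = chartVolume γ e (e.source ∩ e ⁻¹' interior K) := by
    rw [← riemannianVolume_restrict he, Measure.restrict_apply hm,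
      Set.inter_eq_left.mpr Set.inter_subset_left]
  rw [h1, chartVolume_apply γ e hm]
  have hd : ContinuousOn (fun y => Real.sqrt (metricOfInverse γ e y).det) K :=
    (contDiffOn_det (hγ e he).inv.smooth).continuousOn.sqrt.mono hKt
  refine lt_of_le_of_lt (lintegral_mono_set (t := K) ?_)
    (hd.integrableOn_compact hK).lintegral_lt_top
  rintro y ⟨hy, -, hyK⟩
  simp only [Set.mem_preimage, e.right_inv hy] at hyK
  exact interior_subset hyK

/-- This moves the dependence on `t` from the measure into the integrand. Countably many chart
domains cover `M`, so it is enough to compare the measures on each. -/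
theorem riemannianVolume_eq_withDensity [SecondCountableTopology M] (hγ : IsSmoothInverse γ)
    (hγ' : IsSmoothInverse γ') : riemannianVolume γ'
      = (riemannianVolume γ).withDensity fun p => ENNReal.ofReal (volumeRatio γ γ' p) := by
  have hJ : Measurable fun p => ENNReal.ofReal (volumeRatio γ γ' p) :=
    (continuous_volumeRatio hγ hγ').measurable.ennreal_ofReal
  obtain ⟨s, hs, hcov⟩ := TopologicalSpace.countable_cover_nhds fun p : M =>
    (chartAt (EuclideanSpace ℝ (Fin n)) p).open_source.mem_nhds (mem_chart_source _ p)
  rw [← Measure.restrict_univ (μ := riemannianVolume γ'), ← Measure.restrict_univ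
    (μ := (riemannianVolume γ).withDensity _), ← hcov, Measure.restrict_biUnion_congr hs]
  intro p _
  have he : chartAt (EuclideanSpace ℝ (Fin n)) p ∈ atlas (EuclideanSpace ℝ (Fin n)) M :=
    chart_mem_atlas _ p
  generalize chartAt (EuclideanSpace ℝ (Fin n)) p = e at he
  rw [riemannianVolume_restrict he, restrict_withDensity e.open_source.measurableSet,
    riemannianVolume_restrict he]
  ext t ht
  rw [withDensity_apply _ ht, ← lintegral_indicator ht,
    lintegral_chartVolume (hJ.indicator ht) hγ he, chartVolume_apply γ' e ht, Set.inter_comm,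
    ← Measure.restrict_restrict₀', ← lintegral_indicator₀]
  · refine setLIntegral_congr_fun e.open_target.measurableSet fun y hy => ?_
    have h := volumeRatio_eq γ γ' he (e.map_target hy)
    rw [e.right_inv hy] at h
    by_cases hyt : e.symm y ∈ t
    · have hyt' : y ∈ e.symm ⁻¹' t := hyt
      simp only [Set.indicator_of_mem hyt, Set.indicator_of_mem hyt', h]
      rw [← ENNReal.ofReal_mul (Real.sqrt_nonneg _), mul_div_cancel₀ _ (hγ.sqrt_det_pos he hy).ne']
    · have hyt' : y ∉ e.symm ⁻¹' t := hyt
      simp only [Set.indicator_of_notMem hyt, Set.indicator_of_notMem hyt', mul_zero]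
  · exact (e.continuousOn_symm.aemeasurable e.open_target.measurableSet).nullMeasurableSet_preimage ht
  · exact e.open_target.measurableSet.nullMeasurableSet

end Volume

/-! ### Locality and linearity of the variation of the curvature density -/

section LocalVariation

variable {n : ℕ}

theorem christoffel_congr {G G' : Coord n → Matrix (Fin n) (Fin n) ℝ} {y : Coord n}
    (h : G =ᶠ[𝓝 y] G') (i j k : Fin n) : christoffel G i j k y = christoffel G' i j k y := by
  have hp : ∀ a b c, pderiv c (fun z => G z a b) y = pderiv c (fun z => G' z a b) y := fun a b c =>
    pderiv_congr (h.mono fun z hz => by rw [hz]) c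
  simp only [christoffel, hp, h.self_of_nhds]

theorem ricci_congr {G G' : Coord n → Matrix (Fin n) (Fin n) ℝ} {y : Coord n}
    (h : G =ᶠ[𝓝 y] G') (i k : Fin n) : ricci G y i k = ricci G' y i k := by
  have hc := fun a b c => christoffel_congr h a b c
  have hp : ∀ a b c d, pderiv d (christoffel G a b c) y = pderiv d (christoffel G' a b c) y :=
    fun a b c d => pderiv_congr (h.eventuallyEq_nhds.mono fun z hz => christoffel_congr hz a b c) d
  simp only [ricci, hc, hp]

theorem curvatureDensity_congr {γ γ' : Coord n → Matrix (Fin n) (Fin n) ℝ} {y : Coord n}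
    (h : γ =ᶠ[𝓝 y] γ') : curvatureDensity γ y = curvatureDensity γ' y := by
  have hi : (fun z => (γ z)⁻¹) =ᶠ[𝓝 y] fun z => (γ' z)⁻¹ := h.mono fun z hz => by
    simp only [hz]
  simp only [curvatureDensity, h.self_of_nhds, ricci_congr hi]

variable {V : Set (Coord n)} {γ k : Coord n → Matrix (Fin n) (Fin n) ℝ}

theorem lineFamily_eventuallyEq {y : Coord n} (hk : k =ᶠ[𝓝 y] 0) (t : ℝ) :
    lineFamily γ k t =ᶠ[𝓝 y] γ := hk.mono fun z hz => by
  simp [lineFamily, hz]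

theorem christoffelVariation_eq_zero {y : Coord n} (hk : k =ᶠ[𝓝 y] 0) (i j l : Fin n) :
    christoffelVariation γ k i j l y = 0 := by
  have h : (fun t => christoffel (fun z => (lineFamily γ k t z)⁻¹) i j l y)
      = fun _ => christoffel (fun z => (γ z)⁻¹) i j l y := by
    funext t
    refine christoffel_congr ((lineFamily_eventuallyEq (γ := γ) hk t).mono fun z hz => ?_) i j l
    simp only [hz]
  rw [christoffelVariation, h, deriv_const]

theorem variationField_eq_zero {y : Coord n} (hk : k =ᶠ[𝓝 y] 0) (l : Fin n) :
    variationField γ k l y = 0 := by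
  simp [variationField, christoffelVariation_eq_zero hk]

/-- Integration by parts against the constant function `1`. -/
theorem integral_pderiv_eq_zero {X : Coord n → ℝ} (hX : ContDiff ℝ 1 X) (hc : HasCompactSupport X)
    (l : Fin n) : ∫ y, pderiv l X y = 0 := by
  have hcont : Continuous (fun y => fderiv ℝ X y (EuclideanSpace.single l (1 : ℝ))) :=
    (hX.continuous_fderiv (by simp)).clm_apply continuous_const
  have hcs : HasCompactSupport (fun y => fderiv ℝ X y (EuclideanSpace.single l (1 : ℝ))) :=
    hc.fderiv_apply (𝕜 := ℝ) _
  have h := integral_mul_fderiv_eq_neg_fderiv_mul_of_integrable (μ := (volume : Measure (Coord n)))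
    (f := X) (g := fun _ => (1 : ℝ)) (v := EuclideanSpace.single l (1 : ℝ))
    (by simpa using hcont.integrable_of_hasCompactSupport hcs) (by simp)
    (by simpa using hX.continuous.integrable_of_hasCompactSupport hc)
    (fun y _ => (hX.differentiable (by simp)) y) (fun y _ => differentiableAt_const _)
  simpa [pderiv] using h

/-- The divergence theorem for a field with compact support in an open set, one component at a
time. -/
theorem setIntegral_pderiv_eq_zero {X : Coord n → ℝ} (hV : IsOpen V) (hX : ContDiffOn ℝ ∞ X V)
    {K : Set (Coord n)} (hK : IsCompact K) (hKV : K ⊆ V) (h0 : ∀ y ∈ V, y ∉ K → X y = 0)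
    (l : Fin n) : IntegrableOn (pderiv l X) V ∧ ∫ y in V, pderiv l X y = 0 := by
  classical
  -- Extension by zero. It is `C¹` because a point outside `V` has a neighbourhood missing the
  -- closed set `K`, on which `Y` vanishes.
  let Y : Coord n → ℝ := V.indicator X
  have hY0 : ∀ y, y ∉ K → Y y = 0 := fun y hy => by
    by_cases hyV : y ∈ V
    · simp only [Y, Set.indicator_of_mem hyV, h0 y hyV hy]
    · simp only [Y, Set.indicator_of_notMem hyV]
  have hY : ContDiff ℝ 1 Y := by
    refine contDiff_iff_contDiffAt.mpr fun y => ?_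
    by_cases hyV : y ∈ V
    · refine ((hX.contDiffAt (hV.mem_nhds hyV)).of_le (by exact_mod_cast le_top)).congr_of_eventuallyEq ?_
      filter_upwards [hV.mem_nhds hyV] with z hz using Set.indicator_of_mem hz X
    · have hyK : y ∈ Kᶜ := fun h => hyV (hKV h)
      refine (contDiffAt_const (c := (0 : ℝ))).congr_of_eventuallyEq ?_
      filter_upwards [hK.isClosed.isOpen_compl.mem_nhds hyK] with z hz using hY0 z hz
  have hYc : HasCompactSupport Y := HasCompactSupport.intro hK fun y hy => hY0 y hy
  have hXY : Set.EqOn (pderiv l X) (pderiv l Y) V := fun y hy => pderiv_congr (by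
    filter_upwards [hV.mem_nhds hy] with z hz using (Set.indicator_of_mem hz X).symm) l
  refine ⟨?_, ?_⟩
  · have h : Integrable (pderiv l Y) := Continuous.integrable_of_hasCompactSupport
      ((hY.continuous_fderiv (by simp)).clm_apply continuous_const) (hYc.fderiv_apply (𝕜 := ℝ) _)
    exact (integrableOn_congr_fun hXY hV.measurableSet).mpr h.integrableOn
  rw [← integral_pderiv_eq_zero hY hYc l, setIntegral_congr_fun hV.measurableSet hXY]
  refine setIntegral_eq_integral_of_forall_compl_eq_zero fun y hy => ?_
  have hyK : y ∈ Kᶜ := fun h => hy (hKV h)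
  have h2 : Y =ᶠ[𝓝 y] fun _ => 0 := by
    filter_upwards [hK.isClosed.isOpen_compl.mem_nhds hyK] with z hz using hY0 z hz
  rw [pderiv_congr h2]
  simp [pderiv]

/-- The derivative at `t = 0` of the curvature density along `γ + t k`. -/
def densityVariation (γ k : Coord n → Matrix (Fin n) (Fin n) ℝ) (y : Coord n) : ℝ :=
  deriv (fun t => curvatureDensity (lineFamily γ k t) y) 0

/-- Additivity without any explicit formula: `τ ↦ curvatureDensity (γ + ∑ τₐ κₐ)` is differentiable
at `0`, so its derivative along `(1, …, 1)` is the sum of those along the basis vectors. -/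
theorem densityVariation_sum {ι : Type*} [Fintype ι] (hγ : SmoothSymm V γ)
    {κ : ι → Coord n → Matrix (Fin n) (Fin n) ℝ}
    (hκ : ∀ a i j, ContDiffOn ℝ ∞ (fun y => κ a y i j) V) {y : Coord n} (hy : y ∈ V) :
    densityVariation γ (fun z => ∑ a, κ a z) y = ∑ a, densityVariation γ (κ a) y := by
  classical
  let Γ : (ι → ℝ) → Coord n → Matrix (Fin n) (Fin n) ℝ := fun τ z => γ z + ∑ a, τ a • κ a z
  have hΓ : ∀ i j, ContDiffOn ℝ ∞ (fun q : (ι → ℝ) × Coord n => Γ q.1 q.2 i j)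
      (Set.univ ×ˢ V) := by
    intro i j
    have h1 : ContDiffOn ℝ ∞ (fun q : (ι → ℝ) × Coord n => γ q.2 i j) (Set.univ ×ˢ V) :=
      (hγ.smooth i j).comp contDiffOn_snd fun q hq => hq.2
    have h2 : ∀ a, ContDiffOn ℝ ∞ (fun q : (ι → ℝ) × Coord n => κ a q.2 i j) (Set.univ ×ˢ V) :=
      fun a => (hκ a i j).comp contDiffOn_snd fun q hq => hq.2
    simp only [Γ, Matrix.add_apply, Matrix.sum_apply, Matrix.smul_apply, smul_eq_mul]
    refine h1.add (ContDiffOn.sum fun a _ => ContDiffOn.mul ?_ (h2 a))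
    exact ((contDiff_apply ℝ ℝ a).comp contDiff_fst).contDiffOn
  let U : Set ((ι → ℝ) × Coord n) :=
    (Set.univ ×ˢ V) ∩ (fun q : (ι → ℝ) × Coord n => (Γ q.1 q.2).det) ⁻¹' Set.Ioi 0
  have hU : IsOpen U := (contDiffOn_det hΓ).continuousOn.isOpen_inter_preimage
    (isOpen_univ.prod hγ.isOpen) isOpen_Ioi
  have h0 : ((0 : ι → ℝ), y) ∈ U := ⟨⟨Set.mem_univ _, hy⟩, by simpa [Γ] using hγ.det_pos y hy⟩
  have hH := contDiffOn_curvatureDensity (γ := Γ) (fun i j => (hΓ i j).mono Set.inter_subset_left)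
    hU fun q hq => hq.2
  have hφ : DifferentiableAt ℝ (fun τ => curvatureDensity (Γ τ) y) 0 :=
    DifferentiableAt.comp (g := fun q : (ι → ℝ) × Coord n => curvatureDensity (Γ q.1) q.2)
      (f := fun τ : ι → ℝ => (τ, y)) 0
      ((hH.contDiffAt (hU.mem_nhds h0)).differentiableAt (by simp)) (by fun_prop)
  have hline : ∀ v : ι → ℝ, deriv (fun t : ℝ => curvatureDensity (Γ (t • v)) y) 0
      = fderiv ℝ (fun τ => curvatureDensity (Γ τ) y) 0 v := by
    intro v
    have hl : HasDerivAt (fun t : ℝ => t • v) v 0 := by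
      simpa using (hasDerivAt_id (0 : ℝ)).smul_const v
    have h1 : HasFDerivAt (fun τ => curvatureDensity (Γ τ) y)
        (fderiv ℝ (fun τ => curvatureDensity (Γ τ) y) 0) ((0 : ℝ) • v) := by
      simpa using hφ.hasFDerivAt
    exact (h1.comp_hasDerivAt 0 hl).deriv
  have e1 : ∀ t : ℝ, lineFamily γ (fun z => ∑ a, κ a z) t = Γ (t • fun _ => 1) := fun t => by
    funext z
    simp [lineFamily, Γ, Finset.smul_sum]
  have e2 : ∀ a, ∀ t : ℝ, lineFamily γ (κ a) t = Γ (t • Pi.single a 1) := fun a t => by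
    funext z
    simp only [lineFamily, Γ, Pi.smul_apply, smul_eq_mul, Pi.single_apply, mul_ite, mul_one,
      mul_zero, ite_smul, zero_smul, Finset.sum_ite_eq', Finset.mem_univ, if_true]
  simp only [densityVariation, e1, e2, hline]
  rw [← map_sum]
  congr 1
  funext a
  simp [Finset.sum_apply, Pi.single_apply]

end LocalVariation

/-! ### The Einstein tensor -/

section EinsteinTensor

variable {n : ℕ} {M : Type*} [TopologicalSpace M] [ChartedSpace (EuclideanSpace ℝ (Fin n)) M]

theorem SmoothSymm.contDiffOn_einstein {V : Set (Coord n)}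
    {γ : Coord n → Matrix (Fin n) (Fin n) ℝ} (h : SmoothSymm V γ) (i j : Fin n) :
    ContDiffOn ℝ ∞ (fun y => einstein γ y i j) V := by
  have hR := h.inv.contDiffOn_ricci
  refine (hR i j).sub (ContDiffOn.mul (contDiffOn_const.mul ?_) (h.inv.smooth i j))
  exact ContDiffOn.sum fun a _ => ContDiffOn.sum fun b _ => (h.smooth a b).mul (hR a b)

theorem SmoothSymm.einstein_symm {V : Set (Coord n)}
    {γ : Coord n → Matrix (Fin n) (Fin n) ℝ} (h : SmoothSymm V γ) {y : Coord n} (hy : y ∈ V)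
    (i j : Fin n) : einstein γ y i j = einstein γ y j i := by
  rw [einstein, einstein, h.inv.ricci_symm hy, h.inv_symm hy]

/-- If the Einstein tensor vanishes at a point then so does the Ricci tensor, and conversely. -/
theorem SmoothSymm.einstein_eq_zero_iff (hn : 3 ≤ n) {V : Set (Coord n)}
    {γ : Coord n → Matrix (Fin n) (Fin n) ℝ} (h : SmoothSymm V γ) {y : Coord n} (hy : y ∈ V) :
    (∀ i j, einstein γ y i j = 0) ↔ ∀ i j, ricci (fun z => (γ z)⁻¹) y i j = 0 := by
  constructor
  · intro hE
    set R := ∑ a, ∑ b, γ y a b * ricci (fun z => (γ z)⁻¹) y a b with hR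
    have hg : ∑ i, ∑ j, γ y i j * (γ y)⁻¹ i j = n := by
      have h1 : ∑ i, ∑ j, γ y i j * (γ y)⁻¹ i j = (γ y * (γ y)⁻¹).trace := by
        simp only [Matrix.trace, Matrix.diag_apply, Matrix.mul_apply]
        exact Finset.sum_congr rfl fun i _ => Finset.sum_congr rfl fun j _ => by
          rw [h.inv_symm hy i j]
      rw [h1, Matrix.mul_nonsing_inv _ (h.isUnit_det hy), Matrix.trace_one, Fintype.card_fin]
    -- The trace of the Einstein tensor is `(1 - n/2) R`; the factor would vanish for `n = 2`.
    have h2 : ∑ i, ∑ j, γ y i j * einstein γ y i j = R - 1 / 2 * R * n := by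
      rw [← hg, Finset.mul_sum, hR, ← Finset.sum_sub_distrib]
      refine Finset.sum_congr rfl fun i _ => ?_
      rw [Finset.mul_sum, ← Finset.sum_sub_distrib]
      refine Finset.sum_congr rfl fun j _ => ?_
      rw [einstein]
      ring
    simp only [hE, mul_zero, Finset.sum_const_zero] at h2
    have hn' : (3 : ℝ) ≤ n := by exact_mod_cast hn
    have hR0 : R = 0 := by
      have : R * (1 - n / 2) = 0 := by linarith
      rcases mul_eq_zero.mp this with h3 | h3
      · exact h3
      · linarith
    intro i j
    have h3 := hE i j
    rw [einstein, ← hR, hR0] at h3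
    simpa using h3
  · intro hR i j
    simp [einstein, hR]

variable [IsManifold (𝓡 n) ∞ M]

/-- The Einstein tensor `R_ij - ½ R g_ij`. -/
def Metric.einsteinForm (g : Metric n M) (p : M) : LinearMap.BilinForm ℝ (TangentSpace (𝓡 n) p) :=
  ∑ i, ∑ j, einstein (upperComponents g.inverse (chartAt (EuclideanSpace ℝ (Fin n)) p))
    (chartAt (EuclideanSpace ℝ (Fin n)) p p) i j •
      (coframe (chartAt (EuclideanSpace ℝ (Fin n)) p) p i).smulRight
        (coframe (chartAt (EuclideanSpace ℝ (Fin n)) p) p j)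

/-- The form is built from the preferred chart at each point; the transformation law gives it the
same expression in every chart, from which smoothness follows. -/
theorem Metric.lowerComponents_einsteinForm (g : Metric n M)
    {e : OpenPartialHomeomorph M (EuclideanSpace ℝ (Fin n))}
    (he : e ∈ atlas (EuclideanSpace ℝ (Fin n)) M) {y : Coord n} (hy : y ∈ e.target)
    (i j : Fin n) : lowerComponents g.einsteinForm e y i j
      = einstein (upperComponents g.inverse e) y i j := by
  obtain ⟨p, hp, rfl⟩ : ∃ p, p ∈ e.source ∧ e p = y := ⟨e.symm y, e.map_target hy, e.right_inv hy⟩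
  have h := g.isSmoothInverse.einstein_transform he (chart_mem_atlas _ p) hp (mem_chart_source _ p)
  have h1 := congrFun (congrFun h i) j
  rw [Matrix.of_apply] at h1
  rw [h1, lowerComponents_apply _ e hp]
  simp only [Metric.einsteinForm, LinearMap.sum_apply, LinearMap.smul_apply,
    LinearMap.smulRight_apply, smul_eq_mul, Matrix.mul_apply, Matrix.transpose_apply,
    Matrix.of_apply, jacobian, Finset.sum_mul]
  rw [Finset.sum_comm]
  exact Finset.sum_congr rfl fun a _ => Finset.sum_congr rfl fun b _ => by ring

/-- The Einstein tensor as a smooth symmetric tensor field. -/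
def Metric.einsteinTensor (g : Metric n M) : SymTensorLower n M where
  toFun := g.einsteinForm
  symm p v w := by
    simp only [Metric.einsteinForm, LinearMap.sum_apply, LinearMap.smul_apply,
      LinearMap.smulRight_apply, smul_eq_mul]
    rw [Finset.sum_comm]
    refine Finset.sum_congr rfl fun a _ => Finset.sum_congr rfl fun b _ => ?_
    rw [(g.isSmoothInverse _ (chart_mem_atlas _ p)).einstein_symm
      ((chartAt (EuclideanSpace ℝ (Fin n)) p).map_source (mem_chart_source _ p)) b a]
    ring
  smooth e he i j := ((g.isSmoothInverse e he).contDiffOn_einstein i j).congr fun y hy =>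
    g.lowerComponents_einsteinForm he hy i j

end EinsteinTensor

/-! ### Variations of the inverse metric -/

section Variation

variable {n : ℕ} {M : Type*} [TopologicalSpace M] [ChartedSpace (EuclideanSpace ℝ (Fin n)) M]

theorem upperComponents_eventuallyEq_zero (k : SymTensorUpper n M)
    {e : OpenPartialHomeomorph M (EuclideanSpace ℝ (Fin n))} {p : M} (hp : p ∈ e.source)
    (hk : p ∉ closure {p | k.toFun p ≠ 0}) : upperComponents k.toFun e =ᶠ[𝓝 (e p)] 0 := by
  have hO : IsOpen (e.target ∩ e.symm ⁻¹' (closure {p | k.toFun p ≠ 0})ᶜ) :=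
    e.symm.isOpen_inter_preimage isClosed_closure.isOpen_compl
  have hm : e p ∈ e.target ∩ e.symm ⁻¹' (closure {p | k.toFun p ≠ 0})ᶜ :=
    ⟨e.map_source hp, by simpa [e.left_inv hp] using hk⟩
  filter_upwards [hO.mem_nhds hm] with y hy
  have h0 : k.toFun (e.symm y) = 0 := by
    by_contra h
    exact hy.2 (subset_closure h)
  ext i j
  simp [upperComponents, h0]

theorem SymTensorUpper.upperComponents_symm (k : SymTensorUpper n M)
    (e : OpenPartialHomeomorph M (EuclideanSpace ℝ (Fin n))) (y : Coord n) (i j : Fin n) :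
    upperComponents k.toFun e y i j = upperComponents k.toFun e y j i := k.symm _ _ _

variable [IsManifold (𝓡 n) ∞ M]

/-- The family `g⁻¹ + t k`. -/
def Metric.varied (g : Metric n M) (k : SymTensorUpper n M) (t : ℝ) (p : M) :
    LinearMap.BilinForm ℝ (Module.Dual ℝ (TangentSpace (𝓡 n) p)) :=
  g.inverse p + t • k.toFun p

variable (g : Metric n M) (k : SymTensorUpper n M)
  {e : OpenPartialHomeomorph M (EuclideanSpace ℝ (Fin n))}

theorem Metric.upperComponents_varied (t : ℝ)
    (e : OpenPartialHomeomorph M (EuclideanSpace ℝ (Fin n))) :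
    upperComponents (g.varied k t) e
      = lineFamily (upperComponents g.inverse e) (upperComponents k.toFun e) t := rfl

theorem Metric.varied_zero : g.varied k 0 = g.inverse := by
  funext p
  simp [Metric.varied]

/-- Positivity of the determinant is open in `(t, p)`, so compactness gives a common interval of `t`
over the support of `k`; elsewhere nothing varies. One chart at each point suffices, since other
charts multiply the determinant by `(det J)²`. -/
theorem Metric.eventually_isSmoothInverse (hK : IsCompact (closure {p | k.toFun p ≠ 0})) :
    ∀ᶠ t in 𝓝 (0 : ℝ), IsSmoothInverse (g.varied k t) := by
  have h : ∀ᶠ t in 𝓝 (0 : ℝ), ∀ p ∈ closure {p | k.toFun p ≠ 0},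
      ∀ e ∈ atlas (EuclideanSpace ℝ (Fin n)) M, p ∈ e.source →
        0 < (upperComponents (g.varied k t) e (e p)).det := by
    refine hK.eventually_forall_of_forall_eventually fun p _ => ?_
    set c := chartAt (EuclideanSpace ℝ (Fin n)) p with hcdef
    have hc : c ∈ atlas (EuclideanSpace ℝ (Fin n)) M := chart_mem_atlas _ p
    have hp : p ∈ c.source := mem_chart_source _ p
    have hO := isOpen_lineDomain (g.isSmoothInverse c hc) (k.smooth c hc)
    have h0 := zero_mem_lineDomain (k := upperComponents k.toFun c) (g.isSmoothInverse c hc)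
      (c.map_source hp)
    have hcont : ContinuousAt (fun z : ℝ × M => (z.1, c z.2)) (0, p) :=
      continuousAt_fst.prodMk ((c.continuousAt hp).comp continuousAt_snd)
    filter_upwards [hcont.preimage_mem_nhds (hO.mem_nhds h0),
      continuousAt_snd.preimage_mem_nhds (c.open_source.mem_nhds hp)] with z hz hz' e he hze
    rw [upperComponents_transform hc (g.varied k z.1) hz' hze, Matrix.det_mul, Matrix.det_mul,
      Matrix.det_transpose, mul_right_comm]
    exact mul_pos (mul_self_pos.mpr (isUnit_det_jacobian hc he hz' hze).ne_zero) hz.2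
  filter_upwards [h] with t ht e he
  refine ⟨e.open_target, fun i j => ?_, fun y hy i j => ?_, fun y hy => ?_⟩
  · have h1 := (g.isSmoothInverse e he).smooth i j
    have h2 := k.smooth e he i j
    exact h1.add (contDiffOn_const.mul h2)
  · rw [g.upperComponents_varied, lineFamily]
    simp only [Matrix.add_apply, Matrix.smul_apply]
    rw [(g.isSmoothInverse e he).symm y hy i j, k.upperComponents_symm e y i j]
  · by_cases hy' : e.symm y ∈ closure {p | k.toFun p ≠ 0}
    · have h1 := ht _ hy' e he (e.map_target hy)
      rwa [e.right_inv hy] at h1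
    · have h1 := (upperComponents_eventuallyEq_zero k (e.map_target hy) hy').self_of_nhds
      rw [e.right_inv hy] at h1
      rw [g.upperComponents_varied, lineFamily, h1]
      simpa using (g.isSmoothInverse e he).det_pos y hy

/-- The density of `R dμ`, for the inverse metric `g⁻¹ + t k`, with respect to the Riemannian volume
of `g`. -/
def Metric.relativeDensity (t : ℝ) (p : M) : ℝ :=
  scalarCurvature (g.varied k t) p * volumeRatio g.inverse (g.varied k t) p

/-- The derivative of the relative density in `t`. -/
def Metric.relativeDensityDeriv (t : ℝ) (p : M) : ℝ :=
  deriv (fun s => g.relativeDensity k s p) t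

variable {g k}

theorem Metric.relativeDensity_eq {t : ℝ} (ht : IsSmoothInverse (g.varied k t))
    (he : e ∈ atlas (EuclideanSpace ℝ (Fin n)) M) {p : M} (hp : p ∈ e.source) :
    g.relativeDensity k t p = curvatureDensity (lineFamily (upperComponents g.inverse e)
        (upperComponents k.toFun e) t) (e p) /
      Real.sqrt (metricOfInverse g.inverse e (e p)).det := by
  rw [Metric.relativeDensity, ht.scalarCurvature_eq he hp, volumeRatio_eq _ _ he hp,
    ← mul_div_assoc]
  rfl

theorem Metric.mem_lineDomain {t : ℝ} (ht : IsSmoothInverse (g.varied k t))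
    (he : e ∈ atlas (EuclideanSpace ℝ (Fin n)) M) {y : Coord n} (hy : y ∈ e.target) :
    (t, y) ∈ lineDomain e.target (upperComponents g.inverse e) (upperComponents k.toFun e) :=
  ⟨hy, (ht e he).det_pos y hy⟩

theorem Metric.contDiffOn_curvatureDensity (he : e ∈ atlas (EuclideanSpace ℝ (Fin n)) M) :
    ContDiffOn ℝ ∞ (fun q : ℝ × Coord n => curvatureDensity (lineFamily
        (upperComponents g.inverse e) (upperComponents k.toFun e) q.1) q.2)
      (lineDomain e.target (upperComponents g.inverse e) (upperComponents k.toFun e)) :=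
  EinsteinHilbert.contDiffOn_curvatureDensity
    (contDiffOn_lineFamily_lineDomain (g.isSmoothInverse e he) (k.smooth e he))
    (isOpen_lineDomain (g.isSmoothInverse e he) (k.smooth e he)) fun _ hq => hq.2

theorem Metric.hasDerivAt_relativeDensity_chart {t : ℝ}
    (ht : ∀ᶠ s in 𝓝 t, IsSmoothInverse (g.varied k s))
    (he : e ∈ atlas (EuclideanSpace ℝ (Fin n)) M) {p : M} (hp : p ∈ e.source) :
    HasDerivAt (fun s => g.relativeDensity k s p)
      (deriv (fun s => curvatureDensity (lineFamily (upperComponents g.inverse e)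
        (upperComponents k.toFun e) s) (e p)) t /
        Real.sqrt (metricOfInverse g.inverse e (e p)).det) t := by
  have h1 := differentiableAt_slice (f := fun s y => curvatureDensity (lineFamily
    (upperComponents g.inverse e) (upperComponents k.toFun e) s) y)
    (Metric.contDiffOn_curvatureDensity he)
    (isOpen_lineDomain (g.isSmoothInverse e he) (k.smooth e he))
    (Metric.mem_lineDomain ht.self_of_nhds he (e.map_source hp))
  refine (h1.div_const (Real.sqrt (metricOfInverse g.inverse e (e p)).det)).congr_of_eventuallyEq ?_
  filter_upwards [ht] with s hs using Metric.relativeDensity_eq hs he hp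

theorem Metric.relativeDensityDeriv_eq {t : ℝ}
    (ht : ∀ᶠ s in 𝓝 t, IsSmoothInverse (g.varied k s))
    (he : e ∈ atlas (EuclideanSpace ℝ (Fin n)) M) {p : M} (hp : p ∈ e.source) :
    g.relativeDensityDeriv k t p = deriv (fun s => curvatureDensity (lineFamily
        (upperComponents g.inverse e) (upperComponents k.toFun e) s) (e p)) t /
        Real.sqrt (metricOfInverse g.inverse e (e p)).det :=
  (Metric.hasDerivAt_relativeDensity_chart ht he hp).deriv

theorem Metric.hasDerivAt_relativeDensity {t : ℝ}
    (ht : ∀ᶠ s in 𝓝 t, IsSmoothInverse (g.varied k s)) (p : M) :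
    HasDerivAt (fun s => g.relativeDensity k s p) (g.relativeDensityDeriv k t p) t :=
  (Metric.hasDerivAt_relativeDensity_chart ht (chart_mem_atlas _ p)
    (mem_chart_source _ p)).differentiableAt.hasDerivAt

/-- Continuity jointly in `t` and `p` is what yields a bound uniform in `t` for dominated
convergence. -/
theorem Metric.continuousAt_relativeDensityDeriv {t : ℝ} {O : Set ℝ} (hO : IsOpen O)
    (hk : ∀ s ∈ O, IsSmoothInverse (g.varied k s)) (ht : t ∈ O) (p : M) :
    ContinuousAt (fun z : ℝ × M => g.relativeDensityDeriv k z.1 z.2) (t, p) := by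
  set e := chartAt (EuclideanSpace ℝ (Fin n)) p with hedef
  have he : e ∈ atlas (EuclideanSpace ℝ (Fin n)) M := chart_mem_atlas _ p
  have hp : p ∈ e.source := mem_chart_source _ p
  have hev : ∀ s ∈ O, ∀ᶠ s in 𝓝 s, IsSmoothInverse (g.varied k s) := fun s hs => by
    filter_upwards [hO.mem_nhds hs] with r hr using hk r hr
  have hU := isOpen_lineDomain (g.isSmoothInverse e he) (k.smooth e he)
  have h1 := contDiffOn_deriv (f := fun s y => curvatureDensity (lineFamily
    (upperComponents g.inverse e) (upperComponents k.toFun e) s) y)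
    (Metric.contDiffOn_curvatureDensity he) hU
  have h2 := h1.continuousOn.continuousAt (hU.mem_nhds (Metric.mem_lineDomain (hk t ht) he
    (e.map_source hp)))
  have hec : ContinuousAt (fun z : ℝ × M => e z.2) (t, p) := (e.continuousAt hp).comp continuousAt_snd
  have hcont : ContinuousAt (fun z : ℝ × M => (z.1, e z.2)) (t, p) := continuousAt_fst.prodMk hec
  have h3 : ContinuousAt (fun y => Real.sqrt (metricOfInverse g.inverse e y).det) (e p) :=
    (contDiffOn_det (g.isSmoothInverse e he).inv.smooth).continuousOn.sqrt.continuousAt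
      (e.open_target.mem_nhds (e.map_source hp))
  have h4 := (ContinuousAt.comp (x := (t, p)) (f := fun z : ℝ × M => (z.1, e z.2)) h2 hcont).div
    (ContinuousAt.comp (x := (t, p)) (f := fun z : ℝ × M => e z.2) h3 hec)
    (g.isSmoothInverse.sqrt_det_pos he (e.map_source hp)).ne'
  refine h4.congr ?_
  filter_upwards [continuousAt_fst.preimage_mem_nhds (hO.mem_nhds ht),
    continuousAt_snd.preimage_mem_nhds (e.open_source.mem_nhds hp)] with z hz hz'
  exact (Metric.relativeDensityDeriv_eq (hev _ hz) he hz').symm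

theorem Metric.continuous_relativeDensity {t : ℝ} (ht : IsSmoothInverse (g.varied k t)) :
    Continuous (g.relativeDensity k t) := by
  refine continuous_of_charts (n := n) fun e he => ?_
  have h1 : ContinuousOn (fun y => curvatureDensity (lineFamily (upperComponents g.inverse e)
      (upperComponents k.toFun e) t) y) e.target :=
    ContinuousOn.comp (f := fun y => (t, y)) (Metric.contDiffOn_curvatureDensity he).continuousOn
      (by fun_prop) fun y hy => Metric.mem_lineDomain ht he hy
  have h2 : ContinuousOn (fun y => Real.sqrt (metricOfInverse g.inverse e y).det) e.target :=
    (contDiffOn_det (g.isSmoothInverse e he).inv.smooth).continuousOn.sqrt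
  refine (h1.div h2 fun y hy => (g.isSmoothInverse.sqrt_det_pos he hy).ne').congr fun y hy => ?_
  rw [Metric.relativeDensity_eq ht he (e.map_target hy), e.right_inv hy]
  rfl

theorem Metric.relativeDensity_eq_of_notMem {t : ℝ} (ht : IsSmoothInverse (g.varied k t)) {p : M}
    (hp : p ∉ closure {p | k.toFun p ≠ 0}) : g.relativeDensity k t p = g.relativeDensity k 0 p := by
  have hc := mem_chart_source (EuclideanSpace ℝ (Fin n)) p
  have hk := upperComponents_eventuallyEq_zero k hc hp
  rw [Metric.relativeDensity_eq ht (chart_mem_atlas _ p) hc,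
    Metric.relativeDensity_eq (by rw [g.varied_zero]; exact g.isSmoothInverse) (chart_mem_atlas _ p) hc,
    curvatureDensity_congr (lineFamily_eventuallyEq hk t),
    curvatureDensity_congr (lineFamily_eventuallyEq hk 0)]

theorem Metric.relativeDensityDeriv_eq_zero {t : ℝ}
    (ht : ∀ᶠ s in 𝓝 t, IsSmoothInverse (g.varied k s)) {p : M}
    (hp : p ∉ closure {p | k.toFun p ≠ 0}) : g.relativeDensityDeriv k t p = 0 := by
  have h : (fun s => g.relativeDensity k s p) =ᶠ[𝓝 t] fun _ => g.relativeDensity k 0 p := by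
    filter_upwards [ht] with s hs using Metric.relativeDensity_eq_of_notMem hs hp
  rw [Metric.relativeDensityDeriv, h.deriv_eq, deriv_const]

theorem Metric.continuous_relativeDensityDeriv (hK : IsCompact (closure {p | k.toFun p ≠ 0})) :
    Continuous (g.relativeDensityDeriv k 0) := by
  obtain ⟨ε, hε, hsm⟩ := Metric.eventually_nhds_iff.mp (g.eventually_isSmoothInverse k hK)
  exact continuous_iff_continuousAt.mpr fun p =>
    ContinuousAt.comp (x := p) (f := fun p : M => ((0 : ℝ), p))
      (Metric.continuousAt_relativeDensityDeriv Metric.isOpen_ball (fun s hs => hsm hs)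
        (Metric.mem_ball_self hε) p) (by fun_prop)

variable [MeasurableSpace M] [BorelSpace M] [SecondCountableTopology M]

theorem Metric.totalScalarCurvature_varied {t : ℝ} (ht : IsSmoothInverse (g.varied k t))
    {Ω : Set M} (hΩ : MeasurableSet Ω) : totalScalarCurvature Ω (g.varied k t)
      = ∫ p in Ω, g.relativeDensity k t p ∂(riemannianVolume g.inverse) := by
  rw [totalScalarCurvature, riemannianVolume_eq_withDensity g.isSmoothInverse ht,
    restrict_withDensity hΩ, integral_withDensity_eq_integral_toReal_smul
      (continuous_volumeRatio g.isSmoothInverse ht).measurable.ennreal_ofReal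
      (Filter.Eventually.of_forall fun _ => ENNReal.ofReal_lt_top)]
  refine integral_congr_ae (Filter.Eventually.of_forall fun p => ?_)
  simp only [ENNReal.toReal_ofReal (volumeRatio_nonneg _ _ p), smul_eq_mul,
    Metric.relativeDensity, mul_comm]

/-- Differentiation of the total scalar curvature under the integral sign. -/
theorem Metric.hasDerivAt_totalScalarCurvature [T2Space M] {Ω : Set M} (hΩ : IsOpen Ω)
    (hΩc : IsCompact (closure Ω)) (hK : IsCompact (closure {p | k.toFun p ≠ 0})) :
    HasDerivAt (fun t => totalScalarCurvature Ω (g.varied k t))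
      (∫ p in Ω, g.relativeDensityDeriv k 0 p ∂(riemannianVolume g.inverse)) 0 := by
  have := g.isSmoothInverse.isLocallyFiniteMeasure
  obtain ⟨ε, hε, hsm⟩ := Metric.eventually_nhds_iff.mp (g.eventually_isSmoothInverse k hK)
  have hO : IsOpen (Metric.ball (0 : ℝ) ε) := Metric.isOpen_ball
  have hsm' : ∀ s ∈ Metric.ball (0 : ℝ) ε, IsSmoothInverse (g.varied k s) := fun s hs => hsm hs
  have hev : ∀ s ∈ Metric.ball (0 : ℝ) ε, ∀ᶠ r in 𝓝 s, IsSmoothInverse (g.varied k r) :=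
    fun s hs => by filter_upwards [hO.mem_nhds hs] with r hr using hsm' r hr
  have hsub : Metric.closedBall (0 : ℝ) (ε / 2) ⊆ Metric.ball 0 ε :=
    Metric.closedBall_subset_ball (by linarith)
  have hcont : ContinuousOn (fun z : ℝ × M => g.relativeDensityDeriv k z.1 z.2)
      (Metric.closedBall (0 : ℝ) (ε / 2) ×ˢ closure {p | k.toFun p ≠ 0}) := fun z hz =>
    (Metric.continuousAt_relativeDensityDeriv hO hsm' (hsub hz.1) z.2).continuousWithinAt
  -- `B` dominates the derivative over the support of `k`. Elsewhere the derivative is zero, and the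
  -- bound used is `max B 0` because `B` could be negative if the support is empty.
  obtain ⟨B, hB⟩ := ((isCompact_closedBall (0 : ℝ) (ε / 2)).prod hK).exists_bound_of_continuousOn hcont
  have h0 : (0 : ℝ) ∈ Metric.ball (0 : ℝ) ε := Metric.mem_ball_self hε
  have hfin : riemannianVolume g.inverse Ω < ⊤ :=
    (measure_mono subset_closure).trans_lt hΩc.measure_lt_top
  have hFint : Integrable (g.relativeDensity k 0) ((riemannianVolume g.inverse).restrict Ω) :=
    ((Metric.continuous_relativeDensity (hsm' 0 h0)).continuousOn.integrableOn_compact hΩc).mono_set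
      subset_closure
  have hF'cont : Continuous (g.relativeDensityDeriv k 0) :=
    Metric.continuous_relativeDensityDeriv hK
  have key := hasDerivAt_integral_of_dominated_loc_of_deriv_le
    (μ := (riemannianVolume g.inverse).restrict Ω) (F := g.relativeDensity k)
    (F' := g.relativeDensityDeriv k) (bound := fun _ => max B 0) (x₀ := (0 : ℝ))
    (s := Metric.ball 0 (ε / 2)) (Metric.ball_mem_nhds _ (by linarith))
    (by filter_upwards [hO.mem_nhds h0] with t ht using
      (Metric.continuous_relativeDensity (hsm' t ht)).measurable.aestronglyMeasurable)
    hFint hF'cont.measurable.aestronglyMeasurable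
    (Filter.Eventually.of_forall fun p t ht => by
      by_cases hp : p ∈ closure {p | k.toFun p ≠ 0}
      · exact (hB (t, p) ⟨Metric.ball_subset_closedBall ht, hp⟩).trans (le_max_left _ _)
      · rw [Metric.relativeDensityDeriv_eq_zero (hev t (hsub (Metric.ball_subset_closedBall ht))) hp]
        simp)
    (integrableOn_const hfin.ne)
    (Filter.Eventually.of_forall fun p t ht =>
      Metric.hasDerivAt_relativeDensity (hev t (hsub (Metric.ball_subset_closedBall ht))) p)
  refine key.2.congr_of_eventuallyEq ?_
  filter_upwards [hO.mem_nhds h0] with t ht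
    using Metric.totalScalarCurvature_varied (hsm' t ht) hΩ.measurableSet

end Variation

/-! ### The first variation -/

section FirstVariation

variable {n : ℕ} {M : Type*} [TopologicalSpace M] [ChartedSpace (EuclideanSpace ℝ (Fin n)) M]

/-- The product of a tensor field with a smooth function. -/
def SymTensorUpper.smul [IsManifold (𝓡 n) ∞ M] (ρ : M → ℝ) (hρ : ContMDiff (𝓡 n) 𝓘(ℝ) ∞ ρ)
    (k : SymTensorUpper n M) : SymTensorUpper n M where
  toFun p := ρ p • k.toFun p
  symm p α β := by simp [k.symm p α β]
  smooth e he i j := by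
    have h : ContDiffOn ℝ ∞ (fun y => ρ (e.symm y)) e.target :=
      (hρ.comp_contMDiffOn (contMDiffOn_symm_of_mem_maximalAtlas
        (IsManifold.subset_maximalAtlas he))).contDiffOn
    exact h.mul (k.smooth e he i j)

theorem contraction_eq_zero (E : SymTensorLower n M) (k : SymTensorUpper n M) {p : M}
    (hp : p ∉ closure {p | k.toFun p ≠ 0}) : contraction E k p = 0 := by
  have h := (upperComponents_eventuallyEq_zero k (mem_chart_source _ p) hp).self_of_nhds
  simp [contraction, h]

theorem contraction_eq_sum {ι : Type*} [Fintype ι] (E : SymTensorLower n M)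
    {k : SymTensorUpper n M} {κ : ι → SymTensorUpper n M}
    (hk : ∀ p, k.toFun p = ∑ a, (κ a).toFun p) (p : M) :
    contraction E k p = ∑ a, contraction E (κ a) p := by
  simp only [contraction, upperComponents, hk, Matrix.of_apply, LinearMap.sum_apply, Finset.mul_sum]
  rw [Finset.sum_comm_cycle]

variable [IsManifold (𝓡 n) ∞ M]
  {e : OpenPartialHomeomorph M (EuclideanSpace ℝ (Fin n))}

theorem continuous_contraction (E : SymTensorLower n M) (k : SymTensorUpper n M) :
    Continuous (contraction E k) := by
  refine continuous_of_charts (n := n) fun e he => ?_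
  have h : ContinuousOn (fun y => ∑ i, ∑ j, lowerComponents E.toFun e y i j *
      upperComponents k.toFun e y i j) e.target :=
    continuousOn_finsetSum _ fun i _ => continuousOn_finsetSum _ fun j _ =>
      (E.smooth e he i j).continuousOn.mul (k.smooth e he i j).continuousOn
  refine h.congr fun y hy => ?_
  rw [contraction_eq E k he (e.map_target hy), e.right_inv hy]

/-- A compactly supported tensor field is a finite sum of tensor fields compactly supported in chart
domains. -/
theorem SymTensorUpper.exists_decomposition [T2Space M] [SecondCountableTopology M]
    (k : SymTensorUpper n M)
    (hK : IsCompact (closure {p | k.toFun p ≠ 0})) :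
    ∃ (t : Finset M) (κ : t → SymTensorUpper n M),
      (∀ p, k.toFun p = ∑ a, (κ a).toFun p) ∧
      ∀ a, IsCompact (closure {p | (κ a).toFun p ≠ 0}) ∧
        ∃ e ∈ atlas (EuclideanSpace ℝ (Fin n)) M, closure {p | (κ a).toFun p ≠ 0} ⊆ e.source := by
  have : LocallyCompactSpace M := ChartedSpace.locallyCompactSpace (EuclideanSpace ℝ (Fin n)) M
  obtain ⟨t, -, ht⟩ := hK.elim_nhds_subcover (fun p : M => (chartAt (EuclideanSpace ℝ (Fin n)) p).source)
    fun p _ => (chartAt (EuclideanSpace ℝ (Fin n)) p).open_source.mem_nhds (mem_chart_source _ p)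
  obtain ⟨f, hf⟩ := SmoothPartitionOfUnity.exists_isSubordinate (𝓡 n) hK.isClosed
    (fun a : t => (chartAt (EuclideanSpace ℝ (Fin n)) (a : M)).source)
    (fun a => (chartAt (EuclideanSpace ℝ (Fin n)) (a : M)).open_source) fun p hp => by
      obtain ⟨a, ha, hpa⟩ := Set.mem_iUnion₂.mp (ht hp)
      exact Set.mem_iUnion.mpr ⟨⟨a, ha⟩, hpa⟩
  refine ⟨t, fun a => k.smul (f a) (f a).contMDiff, fun p => ?_, fun a => ⟨?_, ?_⟩⟩
  · change k.toFun p = ∑ a, f a p • k.toFun p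
    rw [← Finset.sum_smul]
    -- The partition sums to one only on the support of `k`; elsewhere both sides are zero.
    by_cases hp : k.toFun p = 0
    · simp [hp]
    · rw [← finsum_eq_sum_of_fintype, f.sum_eq_one (subset_closure hp), one_smul]
  · refine hK.of_isClosed_subset isClosed_closure (closure_mono fun p hp h => hp ?_)
    change f a p • k.toFun p = 0
    rw [h, smul_zero]
  · refine ⟨_, chart_mem_atlas _ (a : M), (closure_mono fun p hp => ?_).trans (hf a)⟩
    intro h
    refine hp ?_
    change f a p • k.toFun p = 0
    rw [h, zero_smul]

variable {g : Metric n M}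

theorem Metric.relativeDensityDeriv_zero_eq {k : SymTensorUpper n M}
    (hK : IsCompact (closure {p | k.toFun p ≠ 0}))
    (he : e ∈ atlas (EuclideanSpace ℝ (Fin n)) M) {p : M} (hp : p ∈ e.source) :
    g.relativeDensityDeriv k 0 p =
      densityVariation (upperComponents g.inverse e) (upperComponents k.toFun e) (e p) /
        Real.sqrt (metricOfInverse g.inverse e (e p)).det :=
  Metric.relativeDensityDeriv_eq (g.eventually_isSmoothInverse k hK) he hp

theorem Metric.relativeDensityDeriv_eq_sum {ι : Type*} [Fintype ι]
    {k : SymTensorUpper n M} {κ : ι → SymTensorUpper n M}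
    (hK : IsCompact (closure {p | k.toFun p ≠ 0}))
    (hκ : ∀ a, IsCompact (closure {p | (κ a).toFun p ≠ 0}))
    (hk : ∀ p, k.toFun p = ∑ a, (κ a).toFun p) (p : M) :
    g.relativeDensityDeriv k 0 p = ∑ a, g.relativeDensityDeriv (κ a) 0 p := by
  have he : chartAt (EuclideanSpace ℝ (Fin n)) p ∈ atlas (EuclideanSpace ℝ (Fin n)) M :=
    chart_mem_atlas _ p
  have hp := mem_chart_source (EuclideanSpace ℝ (Fin n)) p
  generalize chartAt (EuclideanSpace ℝ (Fin n)) p = e at he hp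
  have h : upperComponents k.toFun e = fun y => ∑ a, upperComponents (κ a).toFun e y := by
    funext y
    ext i j
    simp [upperComponents, hk, Matrix.sum_apply]
  rw [Metric.relativeDensityDeriv_zero_eq hK he hp, h, densityVariation_sum
    (g.isSmoothInverse e he) (fun a => (κ a).smooth e he) (e.map_source hp), Finset.sum_div]
  exact Finset.sum_congr rfl fun a _ =>
    (Metric.relativeDensityDeriv_zero_eq (hκ a) he hp).symm

variable [T2Space M] [MeasurableSpace M] [BorelSpace M]

theorem Metric.integrable_of_support_subset (g : Metric n M) {f : M → ℝ} (hf : Continuous f)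
    {K : Set M} (hK : IsCompact K) (h0 : ∀ p, p ∉ K → f p = 0) :
    Integrable f (riemannianVolume g.inverse) :=
  have := g.isSmoothInverse.isLocallyFiniteMeasure
  hf.integrable_of_hasCompactSupport (HasCompactSupport.intro hK h0)

/-- The first variation for a tensor field supported in a chart domain. -/
theorem Metric.integral_relativeDensityDeriv_of_subset_source {k : SymTensorUpper n M}
    (hK : IsCompact (closure {p | k.toFun p ≠ 0}))
    (he : e ∈ atlas (EuclideanSpace ℝ (Fin n)) M) (hKe : closure {p | k.toFun p ≠ 0} ⊆ e.source) :
    ∫ p, g.relativeDensityDeriv k 0 p ∂(riemannianVolume g.inverse)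
      = ∫ p, contraction g.einsteinTensor k p ∂(riemannianVolume g.inverse) := by
  set K := closure {p | k.toFun p ≠ 0} with hKdef
  set γ := upperComponents g.inverse e with hγdef
  set κ := upperComponents k.toFun e with hκdef
  have hγ : SmoothSymm e.target γ := g.isSmoothInverse e he
  have h1c : Continuous (g.relativeDensityDeriv k 0) := Metric.continuous_relativeDensityDeriv hK
  have h2c := continuous_contraction g.einsteinTensor k
  have h10 : ∀ p, p ∉ K → g.relativeDensityDeriv k 0 p = 0 := fun p hp =>
    Metric.relativeDensityDeriv_eq_zero (g.eventually_isSmoothInverse k hK) hp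
  have h20 : ∀ p, p ∉ K → contraction g.einsteinTensor k p = 0 := fun p hp =>
    contraction_eq_zero _ k hp
  rw [← sub_eq_zero, ← integral_sub (g.integrable_of_support_subset h1c hK h10)
    (g.integrable_of_support_subset h2c hK h20),
    ← setIntegral_eq_integral_of_forall_compl_eq_zero (s := e.source) fun p hp => by
      rw [h10 p fun h => hp (hKe h), h20 p fun h => hp (hKe h), sub_zero],
    setIntegral_source_riemannianVolume (f := fun p => g.relativeDensityDeriv k 0 p -
      contraction g.einsteinTensor k p) (h1c.sub h2c) g.isSmoothInverse he]
  -- The field vanishes off the image of `K` in the chart, a compact subset of `e.target`, so there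
  -- is no boundary term.
  have hdiv : ∀ l, IntegrableOn (pderiv l fun z => Real.sqrt ((γ z)⁻¹).det
        * variationField γ κ l z) e.target ∧
      ∫ y in e.target, pderiv l (fun z => Real.sqrt ((γ z)⁻¹).det * variationField γ κ l z) y = 0 := by
    intro l
    have hs : ContDiffOn ℝ ∞ (fun z => Real.sqrt ((γ z)⁻¹).det) e.target :=
      (contDiffOn_det hγ.inv.smooth).sqrt fun y hy => (hγ.inv_det_pos hy).ne'
    refine setIntegral_pderiv_eq_zero e.open_target
      (hs.mul (contDiffOn_variationField hγ (k.smooth e he) l))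
      (hK.image_of_continuousOn (e.continuousOn.mono hKe))
      (Set.image_subset_iff.mpr fun p hp => e.map_source (hKe hp)) (fun y hy hyK => ?_) l
    have hz := upperComponents_eventuallyEq_zero k (e.map_target hy) fun h =>
      hyK ⟨_, h, e.right_inv hy⟩
    rw [e.right_inv hy] at hz
    rw [variationField_eq_zero hz, mul_zero]
  -- In coordinates the difference of the two integrands is exactly the divergence in the first
  -- variation formula.
  have hpt : ∀ y ∈ e.target, Real.sqrt (metricOfInverse g.inverse e y).det *
      (g.relativeDensityDeriv k 0 (e.symm y) - contraction g.einsteinTensor k (e.symm y))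
      = ∑ l, pderiv l (fun z => Real.sqrt ((γ z)⁻¹).det * variationField γ κ l z) y := by
    intro y hy
    have hpos := g.isSmoothInverse.sqrt_det_pos he hy
    have hd := (hasDerivAt_curvatureDensity hγ (k.smooth e he)
      (fun y _ i j => k.upperComponents_symm e y i j) hy).deriv
    rw [Metric.relativeDensityDeriv_zero_eq hK he (e.map_target hy),
      contraction_eq _ k he (e.map_target hy), e.right_inv hy, densityVariation, mul_sub,
      mul_div_cancel₀ _ hpos.ne', hd]
    have hE : ∀ i j, lowerComponents g.einsteinTensor.toFun e y i j = einstein γ y i j :=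
      fun i j => g.lowerComponents_einsteinForm he hy i j
    simp only [hE]
    have hm : metricOfInverse g.inverse e y = (γ y)⁻¹ := rfl
    rw [hm]
    ring
  rw [setIntegral_congr_fun e.open_target.measurableSet hpt,
    integral_finsetSum _ fun l _ => (hdiv l).1]
  exact Finset.sum_eq_zero fun l _ => (hdiv l).2

variable [SecondCountableTopology M]

/-- Both integrands are additive in `k`, so a partition of unity reduces to the case of one chart.
-/
theorem Metric.integral_relativeDensityDeriv {k : SymTensorUpper n M}
    (hK : IsCompact (closure {p | k.toFun p ≠ 0})) :
    ∫ p, g.relativeDensityDeriv k 0 p ∂(riemannianVolume g.inverse)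
      = ∫ p, contraction g.einsteinTensor k p ∂(riemannianVolume g.inverse) := by
  obtain ⟨t, κ, hk, hκ⟩ := k.exists_decomposition hK
  have h1 := funext (Metric.relativeDensityDeriv_eq_sum (g := g) hK (fun a => (hκ a).1) hk)
  have h2 := funext (contraction_eq_sum g.einsteinTensor hk)
  rw [h1, h2, integral_finsetSum _ fun a _ => g.integrable_of_support_subset
      (Metric.continuous_relativeDensityDeriv (hκ a).1) (hκ a).1 fun p hp =>
        Metric.relativeDensityDeriv_eq_zero (g.eventually_isSmoothInverse _ (hκ a).1) hp,
    integral_finsetSum _ fun a _ => g.integrable_of_support_subset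
      (continuous_contraction _ _) (hκ a).1 fun p hp => contraction_eq_zero _ _ hp]
  refine Finset.sum_congr rfl fun a _ => ?_
  obtain ⟨hc, e, he, hs⟩ := hκ a
  exact Metric.integral_relativeDensityDeriv_of_subset_source hc he hs

/-- The Einstein tensor is the Euler-Lagrange expression of the total scalar curvature. -/
theorem Metric.isEulerLagrangeExpression_einsteinTensor (g : Metric n M) :
    g.IsEulerLagrangeExpression g.einsteinTensor := by
  intro Ω hΩ hΩc k hk
  have hK : IsCompact (closure {p | k.toFun p ≠ 0}) :=
    hΩc.of_isClosed_subset isClosed_closure (hk.trans subset_closure)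
  have h := Metric.hasDerivAt_totalScalarCurvature (g := g) (k := k) hΩ hΩc hK
  rw [setIntegral_eq_integral_of_forall_compl_eq_zero fun p hp =>
      Metric.relativeDensityDeriv_eq_zero (g.eventually_isSmoothInverse k hK) fun h => hp (hk h),
    Metric.integral_relativeDensityDeriv hK] at h
  rwa [setIntegral_eq_integral_of_forall_compl_eq_zero fun p hp =>
    contraction_eq_zero _ k fun h => hp (hk h)]

end FirstVariation

/-! ### Uniqueness of the Euler-Lagrange expression -/

section Uniqueness

variable {n : ℕ} {M : Type*} [TopologicalSpace M] [ChartedSpace (EuclideanSpace ℝ (Fin n)) M]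

open scoped MatrixOrder Matrix.Norms.L2Operator in
/-- The squared norm of a bilinear form with respect to an inner product is positive definite. -/
theorem sum_mul_conj_nonneg {γ : Matrix (Fin n) (Fin n) ℝ} (hγ : γ.PosDef)
    (D : Matrix (Fin n) (Fin n) ℝ) :
    0 ≤ ∑ i, ∑ j, D i j * (γ * D * γ.transpose) i j ∧
      (∑ i, ∑ j, D i j * (γ * D * γ.transpose) i j = 0 → D = 0) := by
  -- With `γ = BᵀB` the sum becomes the sum of squares of the entries of `B D Bᵀ`. If it vanishes
  -- then `γ D γᵀ = 0`, and the invertible `γ` cancels.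
  obtain ⟨B, hB⟩ := CStarAlgebra.nonneg_iff_eq_star_mul_self.mp hγ.posSemidef.nonneg
  rw [Matrix.star_eq_conjTranspose, Matrix.conjTranspose_eq_transpose_of_trivial] at hB
  have h1 : γ * D * γ.transpose = B.transpose * (B * D * B.transpose) * B := by
    rw [hB, Matrix.transpose_mul, Matrix.transpose_transpose]
    simp only [Matrix.mul_assoc]
  have h2 : ∑ i, ∑ j, D i j * (γ * D * γ.transpose) i j
      = ∑ i, ∑ j, (B * D * B.transpose) i j * (B * D * B.transpose) i j := by
    rw [h1, ← sum_mul_transform B (B * D * B.transpose) D]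
    exact Finset.sum_congr rfl fun i _ => Finset.sum_congr rfl fun j _ => mul_comm _ _
  rw [h2]
  refine ⟨Finset.sum_nonneg fun i _ => Finset.sum_nonneg fun j _ => mul_self_nonneg _, fun h => ?_⟩
  have h3 : B * D * B.transpose = 0 := by
    ext i j
    have hi := (Finset.sum_eq_zero_iff_of_nonneg fun i _ =>
      Finset.sum_nonneg fun j _ => mul_self_nonneg _).mp h i (Finset.mem_univ i)
    exact mul_self_eq_zero.mp
      ((Finset.sum_eq_zero_iff_of_nonneg fun j _ => mul_self_nonneg _).mp hi j (Finset.mem_univ j))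
  have hu : IsUnit γ.det := hγ.det_pos.ne'.isUnit
  have hut : IsUnit γ.transpose.det := by rwa [Matrix.det_transpose]
  rw [h3, Matrix.mul_zero, Matrix.zero_mul] at h1
  have h4 := congrArg (fun A => γ⁻¹ * (A * γ.transpose⁻¹)) h1
  simpa [Matrix.mul_assoc, Matrix.mul_nonsing_inv _ hut, Matrix.nonsing_inv_mul_cancel_left _ _ hu]
    using h4

theorem SymTensorLower.ext_toFun {E E' : SymTensorLower n M} (h : ∀ p, E.toFun p = E'.toFun p) :
    E = E' := by
  cases E
  cases E'
  congr
  exact funext h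

/-- The difference of two tensor fields. -/
def SymTensorLower.sub (E E' : SymTensorLower n M) : SymTensorLower n M where
  toFun p := E.toFun p - E'.toFun p
  symm p v w := by simp [E.symm p v w, E'.symm p v w]
  smooth e he i j := (E.smooth e he i j).sub (E'.smooth e he i j)

theorem contraction_sub (E E' : SymTensorLower n M) (k : SymTensorUpper n M) (p : M) :
    contraction (E.sub E') k p = contraction E k p - contraction E' k p := by
  simp only [contraction, ← Finset.sum_sub_distrib, ← sub_mul]
  rfl

variable [IsManifold (𝓡 n) ∞ M] {e : OpenPartialHomeomorph M (EuclideanSpace ℝ (Fin n))}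

theorem SymTensorLower.toFun_eq_zero_iff (E : SymTensorLower n M)
    (he : e ∈ atlas (EuclideanSpace ℝ (Fin n)) M) {p : M} (hp : p ∈ e.source) :
    E.toFun p = 0 ↔ ∀ i j, lowerComponents E.toFun e (e p) i j = 0 := by
  simp only [lowerComponents_apply E.toFun e hp]
  refine ⟨fun h i j => by simp [h], fun h => ?_⟩
  ext v w
  rw [← sum_coframe_smul_frame he hp v, ← sum_coframe_smul_frame he hp w]
  simp [h]

theorem contraction_smul (E : SymTensorLower n M) (k : SymTensorUpper n M) {ρ : M → ℝ}
    (hρ : ContMDiff (𝓡 n) 𝓘(ℝ) ∞ ρ) (p : M) :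
    contraction E (k.smul ρ hρ) p = ρ p * contraction E k p := by
  have hp := mem_chart_source (EuclideanSpace ℝ (Fin n)) p
  simp only [contraction, upperComponents_apply _ _ hp, Finset.mul_sum]
  refine Finset.sum_congr rfl fun i _ => Finset.sum_congr rfl fun j _ => ?_
  simp only [SymTensorUpper.smul, LinearMap.smul_apply, smul_eq_mul]
  ring

variable (g : Metric n M)

/-- The bilinear form on the cotangent spaces that `g` associates to one on the tangent spaces. -/
def Metric.raiseForm (b : ∀ p : M, LinearMap.BilinForm ℝ (TangentSpace (𝓡 n) p)) (p : M) :
    LinearMap.BilinForm ℝ (Module.Dual ℝ (TangentSpace (𝓡 n) p)) :=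
  (b p).compl₁₂ (g.flat p).symm.toLinearMap (g.flat p).symm.toLinearMap

theorem Metric.flat_symm_coframe (he : e ∈ atlas (EuclideanSpace ℝ (Fin n)) M) {p : M}
    (hp : p ∈ e.source) (i : Fin n) : (g.flat p).symm (coframe e p i)
      = ∑ a, upperComponents g.inverse e (e p) i a • frame e p a := by
  conv_lhs => rw [← sum_coframe_smul_frame he hp ((g.flat p).symm (coframe e p i))]
  refine Finset.sum_congr rfl fun a _ => ?_
  rw [upperComponents_apply _ e hp, g.inverse_symm]
  congr 1
  exact (g.bilin_flat_symm p _ _).symm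

theorem Metric.upperComponents_raiseForm
    (b : ∀ p : M, LinearMap.BilinForm ℝ (TangentSpace (𝓡 n) p))
    (he : e ∈ atlas (EuclideanSpace ℝ (Fin n)) M) {y : Coord n} (hy : y ∈ e.target) :
    upperComponents (g.raiseForm b) e y = upperComponents g.inverse e y * lowerComponents b e y *
      (upperComponents g.inverse e y).transpose := by
  obtain ⟨p, hp, rfl⟩ : ∃ p, p ∈ e.source ∧ e p = y := ⟨e.symm y, e.map_target hy, e.right_inv hy⟩
  ext i j
  rw [upperComponents_apply _ e hp]
  simp only [Metric.raiseForm, LinearMap.compl₁₂_apply, LinearEquiv.coe_coe,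
    g.flat_symm_coframe he hp, map_sum, map_smul, LinearMap.sum_apply, LinearMap.smul_apply,
    smul_eq_mul, Matrix.mul_apply, Matrix.transpose_apply, lowerComponents_apply b e hp,
    Finset.sum_mul]
  refine Finset.sum_congr rfl fun a _ => ?_
  rw [Finset.mul_sum]
  exact Finset.sum_congr rfl fun c _ => by ring

/-- Raising both indices of a tensor field. -/
def Metric.raise (D : SymTensorLower n M) : SymTensorUpper n M where
  toFun := g.raiseForm D.toFun
  symm p α β := D.symm p _ _
  smooth e he i j := by
    have hγ := (g.isSmoothInverse e he).smooth
    have h : ContDiffOn ℝ ∞ (fun y => ∑ b, (∑ a, upperComponents g.inverse e y i a *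
        lowerComponents D.toFun e y a b) * upperComponents g.inverse e y j b) e.target :=
      ContDiffOn.sum fun b _ => (ContDiffOn.sum fun a _ =>
        (hγ i a).mul (D.smooth e he a b)).mul (hγ j b)
    refine h.congr fun y hy => ?_
    rw [g.upperComponents_raiseForm D.toFun he hy]
    simp only [Matrix.mul_apply, Matrix.transpose_apply]

theorem Metric.upperComponents_inverse_posDef (he : e ∈ atlas (EuclideanSpace ℝ (Fin n)) M) {p : M}
    (hp : p ∈ e.source) : (upperComponents g.inverse e (e p)).PosDef := by
  rw [g.upperComponents_inverse he (e.map_source hp)]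
  exact (g.lowerComponents_posDef he hp).inv

/-- This contraction is the squared norm `D_ij Dⁱʲ`; positive definiteness of `g` enters here. -/
theorem Metric.contraction_raise (D : SymTensorLower n M) (p : M) :
    0 ≤ contraction D (g.raise D) p ∧ (contraction D (g.raise D) p = 0 → D.toFun p = 0) := by
  have he := chart_mem_atlas (EuclideanSpace ℝ (Fin n)) p
  have hp := mem_chart_source (EuclideanSpace ℝ (Fin n)) p
  have h := sum_mul_conj_nonneg (g.upperComponents_inverse_posDef he hp)
    (lowerComponents D.toFun (chartAt (EuclideanSpace ℝ (Fin n)) p)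
      (chartAt (EuclideanSpace ℝ (Fin n)) p p))
  rw [← g.upperComponents_raiseForm D.toFun he (OpenPartialHomeomorph.map_source _ hp)] at h
  refine ⟨h.1, fun h0 => (D.toFun_eq_zero_iff he hp).mpr fun i j => ?_⟩
  rw [h.2 h0]
  rfl

/-- Vanishing of a tensor at `p` can be tested in any single chart, so the pointwise algebra in one
chart governs all charts around `p`. -/
theorem Metric.einsteinTensor_eq_zero_iff (hn : 3 ≤ n) (p : M) :
    g.einsteinTensor.toFun p = 0 ↔ g.RicciVanishesAt p := by
  have key : ∀ e ∈ atlas (EuclideanSpace ℝ (Fin n)) M, p ∈ e.source →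
      (g.einsteinTensor.toFun p = 0 ↔ ∀ i j, ricci (lowerComponents g.bilin e) (e p) i j = 0) := by
    intro e he hp
    have hr : (fun z => (upperComponents g.inverse e z)⁻¹) =ᶠ[𝓝 (e p)]
        lowerComponents g.bilin e := by
      filter_upwards [e.open_target.mem_nhds (e.map_source hp)] with z hz
        using g.metricOfInverse_eq he hz
    simp only [← ricci_congr hr]
    rw [← (g.isSmoothInverse e he).einstein_eq_zero_iff hn (e.map_source hp),
      g.einsteinTensor.toFun_eq_zero_iff he hp]
    have hE : ∀ i j, lowerComponents g.einsteinTensor.toFun e (e p) i j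
        = einstein (upperComponents g.inverse e) (e p) i j := fun i j =>
      g.lowerComponents_einsteinForm he (e.map_source hp) i j
    simp only [hE]
  exact ⟨fun h e he hp => (key e he hp).mp h, fun h =>
    (key _ (chart_mem_atlas _ p) (mem_chart_source _ p)).mpr
      (h _ (chart_mem_atlas _ p) (mem_chart_source _ p))⟩

variable [T2Space M] [MeasurableSpace M] [BorelSpace M]

/-- The fundamental lemma of the calculus of variations for symmetric tensor fields. -/
theorem Metric.toFun_eq_zero_of_integral_contraction_eq_zero (D : SymTensorLower n M)
    (h : ∀ Ω : Set M, IsOpen Ω → IsCompact (closure Ω) → ∀ k : SymTensorUpper n M,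
      closure {p | k.toFun p ≠ 0} ⊆ Ω → ∫ p in Ω, contraction D k p ∂(riemannianVolume g.inverse) = 0)
    (p : M) : D.toFun p = 0 := by
  have : LocallyCompactSpace M := ChartedSpace.locallyCompactSpace (EuclideanSpace ℝ (Fin n)) M
  have := g.isSmoothInverse.isLocallyFiniteMeasure
  have := g.isSmoothInverse.isOpenPosMeasure
  by_contra hp
  obtain ⟨f⟩ : Nonempty (SmoothBumpFunction (𝓡 n) p) := inferInstance
  -- The test field makes the integrand `f |D|²`, which is nonnegative and, if `D` does not vanish
  -- at `p`, positive there.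
  set k := (g.raise D).smul f f.contMDiff with hk
  have hkf : closure {q | k.toFun q ≠ 0} ⊆ tsupport f := closure_mono fun q hq h0 => hq (by
    change f q • _ = _
    rw [h0, zero_smul])
  -- The admissible domain is the interior of `K`: relatively compact, and containing the support of
  -- the test field.
  obtain ⟨K, hK, hfK⟩ := exists_compact_superset f.hasCompactSupport.isCompact
  have h1 := h (interior K) isOpen_interior (hK.of_isClosed_subset isClosed_closure
    (closure_minimal interior_subset hK.isClosed)) k (hkf.trans hfK)
  have h0 : ∀ q, q ∉ tsupport f → contraction D k q = 0 := fun q hq =>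
    contraction_eq_zero D k fun h => hq (hkf h)
  rw [setIntegral_eq_integral_of_forall_compl_eq_zero fun q hq =>
    h0 q fun h => hq (hfK h)] at h1
  refine ((continuous_contraction D k).integral_pos_of_hasCompactSupport_nonneg_nonzero (x := p)
    (HasCompactSupport.intro f.hasCompactSupport.isCompact h0) (fun q => ?_) ?_).ne' h1
  · rw [Pi.zero_apply, hk, contraction_smul]
    exact mul_nonneg f.nonneg (g.contraction_raise D q).1
  · rw [hk, contraction_smul, f.eq_one, one_mul]
    exact fun h => hp ((g.contraction_raise D p).2 h)

variable {g}

/-- Derivatives are unique, so `E - E'` integrates to zero against every admissible `k`. -/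
theorem Metric.IsEulerLagrangeExpression.eq {E E' : SymTensorLower n M}
    (hE : g.IsEulerLagrangeExpression E) (hE' : g.IsEulerLagrangeExpression E') : E = E' := by
  refine SymTensorLower.ext_toFun fun p => sub_eq_zero.mp
    (g.toFun_eq_zero_of_integral_contraction_eq_zero (E.sub E') (fun Ω hΩ hΩc k hk => ?_) p)
  have hK : IsCompact (closure {p | k.toFun p ≠ 0}) :=
    hΩc.of_isClosed_subset isClosed_closure (hk.trans subset_closure)
  have hint : ∀ E : SymTensorLower n M,
      IntegrableOn (contraction E k) Ω (riemannianVolume g.inverse) := fun E =>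
    (g.integrable_of_support_subset (continuous_contraction E k) hK fun p hp =>
      contraction_eq_zero E k hp).integrableOn
  simp only [contraction_sub]
  rw [integral_sub (hint E) (hint E'), (hE Ω hΩ hΩc k hk).unique (hE' Ω hΩ hΩc k hk), sub_self]

theorem Metric.isExtremal_iff [SecondCountableTopology M] :
    g.IsExtremal ↔ ∀ p, g.einsteinTensor.toFun p = 0 := by
  constructor
  · intro h p
    exact g.toFun_eq_zero_of_integral_contraction_eq_zero _ (fun Ω hΩ hΩc k hk =>
      (g.isEulerLagrangeExpression_einsteinTensor Ω hΩ hΩc k hk).unique (h Ω hΩ hΩc k hk)) p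
  · intro h Ω hΩ hΩc k hk
    have h0 : ∀ p, contraction g.einsteinTensor k p = 0 := fun p => by
      simp [contraction, (g.einsteinTensor.toFun_eq_zero_iff (chart_mem_atlas _ p)
        (mem_chart_source _ p)).mp (h p)]
    simpa [h0] using g.isEulerLagrangeExpression_einsteinTensor Ω hΩ hΩc k hk

end Uniqueness

end EinsteinHilbert

end

/-- The Euler-Lagrange equations of the total scalar curvature, varied with respect to the inverse
metric, are `R_ij = 0`. -/
theorem theorem3p11 (n : ℕ) (hn : 3 ≤ n)
    {M : Type*} [TopologicalSpace M] [T2Space M] [SecondCountableTopology M]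
    [ChartedSpace (EuclideanSpace ℝ (Fin n)) M] [IsManifold (𝓡 n) ∞ M]
    [MeasurableSpace M] [BorelSpace M]
    (g : EinsteinHilbert.Metric n M) :
    (∃! E : EinsteinHilbert.SymTensorLower n M,
      EinsteinHilbert.Metric.IsEulerLagrangeExpression g E) ∧
    (∀ E : EinsteinHilbert.SymTensorLower n M,
      EinsteinHilbert.Metric.IsEulerLagrangeExpression g E →
        ∀ p : M, E.toFun p = 0 ↔ EinsteinHilbert.Metric.RicciVanishesAt g p) ∧
    (EinsteinHilbert.Metric.IsExtremal g ↔
      ∀ p : M, EinsteinHilbert.Metric.RicciVanishesAt g p) := by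
  have hE := g.isEulerLagrangeExpression_einsteinTensor
  refine ⟨⟨g.einsteinTensor, hE, fun E h => h.eq hE⟩, fun E h p => ?_, ?_⟩
  · rw [h.eq hE]
    exact g.einsteinTensor_eq_zero_iff hn p
  · rw [EinsteinHilbert.Metric.isExtremal_iff]
    exact forall_congr' fun p => g.einsteinTensor_eq_zero_iff hn p
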